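/- For a smooth function $v:\mathbb R^2\setminus\{0\}\to\mathbb C$ and $i\ne j$ put $$K_{12}=x_1\partial_2-x_2\partial_1,\qquad A_{12}=x_1\partial_1-x_2\partial_2,\qquad N_{ij}=x_i\partial_j .$$ For real $\ell$ let $V_\ell$ be the space of smooth $v:\mathbb R^2\setminus\{0\}\to\mathbb C$ that are even and homogeneous of degree $\ell$, i.e. $v(rx)=|r|^\ell v(x)$ for all real $r\neq0$. Fix $0\le k<1$ and $\tau>0$. Call $\mu$ an eigenvalue of the companion problem if $$\mu v=\left(K_{12}^2-k^2A_{12}^2\right)v$$ has a non-zero solution $v\in V_\ell$, let $\mu(k,\ell)$ be the supremum of the real parts of the eigenvalues, and define $$L(k,\ell)=\tau^2\left[\ell+\tfrac12\ell^2+\mu(k,\ell)\right],\qquad \gamma_j(k)=\frac{\partial^jL}{\partial\ell^j}(k,0).$$ Let $$\mathsf K=\int_0^{\pi/2}\frac{dt}{\sqrt{1-k^2\sin^2t}},\qquad \mathsf E=\int_0^{\pi/2}\sqrt{1-k^2\sin^2t}\,dt,\qquad q=\exp\left[-\pi\,\frac{\mathsf K(\sqrt{1-k^2})}{\mathsf K(k)}\right]$$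 be the complete elliptic integrals of modulus $k$ and the nome (with $q=0$ when $k=0$). Then: 1. For all $\ell$ sufficiently close to $0$, the supremum is attained: $\mu(k,\ell)$ is itself an eigenvalue of the companion problem, and $L(k,\ell)=\sum_{j\ge1}\gamma_j(k)\,\ell^j/j!$. 2. The leading eigenvalue $\mu(k,\ell)$ is analytic in $\ell$ at $\ell=0$, and $\mu(k,\ell)=\mu_1\ell+\mu_2\ell^2+O(\ell^3)$ with $$\mu_1=2\left(\frac{\mathsf E}{\mathsf K}-1\right),\qquad \mu_2=1-k^2-\frac{\mathsf E}{\mathsf K}+\frac{2\pi^2}{\mathsf K^2}\sum_{j=1}^\infty\left(\frac{q^{2j}}{1-q^{4j}}\right)^2-\frac{6\pi^2}{\mathsf K^2}\sum_{j=1}^\infty\left(\frac{q^{2j-1}}{1-q^{4j-2}}\right)^2,$$ both series being convergent. 3. Consequently $$\frac{\gamma_1(k)}{\tau^2}=2\,\frac{\mathsf E}{\mathsf K}-1,\qquad \frac1{\tau^2}\frac{\gamma_2(k)}2=\frac32-k^2-\frac{\mathsf E}{\mathsf K}+\frac{2\pi^2}{\mathsf K^2}\sum_{j=1}^\infty\left(\frac{q^{2j}}{1-q^{4j}}\right)^2-\frac{6\pi^2}{\mathsf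 K^2}\sum_{j=1}^\infty\left(\frac{q^{2j-1}}{1-q^{4j-2}}\right)^2 .$$ 4. (Physical case.) If $k=1/\sqrt2$ then, for all $\ell$ sufficiently close to $0$, $1+L(k,\ell)$ is an eigenvalue on $V_\ell$ of the continuum limit $1+\tau^2(N_{12}^2+N_{21}^2)$ of the transfer operator, and no eigenvalue of that operator on $V_\ell$ has a larger real part. -/

import Mathlib

open Filter Topology
open scoped ContDiff Nat

noncomputable section

namespace RenewingFlow

/-- The partial derivative `∂f/∂x_j` of a complex-valued function on `ℝ^d`. -/
def pd {d : ℕ} (j : Fin d) (f : (Fin d → ℝ) → ℂ) : (Fin d → ℝ) → ℂ :=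
  fun x => fderiv ℝ f x (Pi.single j 1)

/-- The generator `K_{ij} = x_i ∂/∂x_j - x_j ∂/∂x_i` of rotations in the `x_i`-`x_j` plane. -/
def genK {d : ℕ} (i j : Fin d) (f : (Fin d → ℝ) → ℂ) : (Fin d → ℝ) → ℂ :=
  fun x => (x i : ℂ) * pd j f x - (x j : ℂ) * pd i f x

/-- The generator `A_{ij} = x_i ∂/∂x_i - x_j ∂/∂x_j` of diagonal matrices. -/
def genA {d : ℕ} (i j : Fin d) (f : (Fin d → ℝ) → ℂ) : (Fin d → ℝ) → ℂ :=
  fun x => (x i : ℂ) * pd i f x - (x j : ℂ) * pd j f x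

/-- The generator `N_{ij} = x_i ∂/∂x_j` of shears. -/
def genN {d : ℕ} (i j : Fin d) (f : (Fin d → ℝ) → ℂ) : (Fin d → ℝ) → ℂ :=
  fun x => (x i : ℂ) * pd j f x

/-- The pairs `(i, j)` with `i < j`. -/
def ltPairs (d : ℕ) : Finset (Fin d × Fin d) := Finset.univ.filter fun p => p.1 < p.2

/-- The pairs `(i, j)` with `i ≠ j`. -/
def nePairs (d : ℕ) : Finset (Fin d × Fin d) := Finset.univ.filter fun p => p.1 ≠ p.2

/-- The Casimir operator `Δ_K = ∑_{i<j} K_{ij}²` of `SO(d)`. -/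
def casimirK (d : ℕ) (f : (Fin d → ℝ) → ℂ) : (Fin d → ℝ) → ℂ :=
  fun x => ∑ p ∈ ltPairs d, genK p.1 p.2 (genK p.1 p.2 f) x

/-- The operator `∑_{i<j} A_{ij}²`. -/
def sumASq (d : ℕ) (f : (Fin d → ℝ) → ℂ) : (Fin d → ℝ) → ℂ :=
  fun x => ∑ p ∈ ltPairs d, genA p.1 p.2 (genA p.1 p.2 f) x

/-- The operator `∑_{i≠j} N_{ij}²`. -/
def sumNSq (d : ℕ) (f : (Fin d → ℝ) → ℂ) : (Fin d → ℝ) → ℂ :=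
  fun x => ∑ p ∈ nePairs d, genN p.1 p.2 (genN p.1 p.2 f) x

/-- The representation space `V_ℓ`: smooth functions on `ℝ^d ∖ {0}` that are even and homogeneous
of degree `ℓ`, that is, `v (r x) = |r|^ℓ v x` for every real `r ≠ 0`. (The value at the origin is
irrelevant.) -/
def V (d : ℕ) (ℓ : ℝ) : Set ((Fin d → ℝ) → ℂ) :=
  {v | ContDiffOn ℝ ∞ v {0}ᶜ ∧
    ∀ r : ℝ, r ≠ 0 → ∀ x : Fin d → ℝ, x ≠ 0 → v (r • x) = ((|r| ^ ℓ : ℝ) : ℂ) * v x}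

/-- The complex numbers `lam` for which `D v = lam v` on `ℝ^d ∖ {0}` has a non-zero solution
`v ∈ V_ℓ`. -/
def eigenvalues {d : ℕ} (D : ((Fin d → ℝ) → ℂ) → ((Fin d → ℝ) → ℂ)) (ℓ : ℝ) : Set ℂ :=
  {lam | ∃ v ∈ V d ℓ, (∃ x, x ≠ 0 ∧ v x ≠ 0) ∧ ∀ x, x ≠ 0 → D v x = lam * v x}

/-- The real number `m` is the leading eigenvalue of `D` on `V_ℓ`: it is an eigenvalue, and no
eigenvalue has a larger real part. -/
def IsLeadingEigenvalue {d : ℕ} (D : ((Fin d → ℝ) → ℂ) → ((Fin d → ℝ) → ℂ)) (ℓ m : ℝ) : Prop :=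
  (m : ℂ) ∈ eigenvalues D ℓ ∧ ∀ lam ∈ eigenvalues D ℓ, lam.re ≤ m

/-- The operator `Δ_K - k² ∑_{i<j} A_{ij}²` of the companion spectral problem. -/
def companion (d : ℕ) (k : ℝ) (f : (Fin d → ℝ) → ℂ) : (Fin d → ℝ) → ℂ :=
  fun x => casimirK d f x - (k : ℂ) ^ 2 * sumASq d f x

/-- The continuum limit `1 + τ² ∑_{i≠j} N_{ij}²` of the transfer operator (symmetric disorder). -/
def transfer (d : ℕ) (τ : ℝ) (f : (Fin d → ℝ) → ℂ) : (Fin d → ℝ) → ℂ :=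
  fun x => f x + (τ : ℂ) ^ 2 * sumNSq d f x

/-- `μ(k, ℓ)`, the leading eigenvalue of the companion problem. -/
def mu (d : ℕ) (k ℓ : ℝ) : ℝ := sSup (Complex.re '' eigenvalues (companion d k) ℓ)

/-- The `k`-dependent generalised Lyapunov exponent
`L(k, ℓ) = τ² [(d - 1) ℓ + (d - 1) / d ℓ² + μ(k, ℓ)]`. -/
def lyap (d : ℕ) (τ k ℓ : ℝ) : ℝ :=
  τ ^ 2 * (((d : ℝ) - 1) * ℓ + ((d : ℝ) - 1) / d * ℓ ^ 2 + mu d k ℓ)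

/-- The cumulant `γ_j(k)`: the coefficient of `ℓ^j / j!` in the Taylor series of `L(k, ·)` at 0. -/
def cumulant (d : ℕ) (τ k : ℝ) (j : ℕ) : ℝ := iteratedDeriv j (lyap d τ k) 0

/-- The complete elliptic integral of the first kind, of modulus `k`. -/
def ellK (k : ℝ) : ℝ := ∫ t in (0 : ℝ)..(Real.pi / 2), 1 / √(1 - k ^ 2 * Real.sin t ^ 2)

/-- The complete elliptic integral of the second kind, of modulus `k`. -/
def ellE (k : ℝ) : ℝ := ∫ t in (0 : ℝ)..(Real.pi / 2), √(1 - k ^ 2 * Real.sin t ^ 2)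

/-- The nome `exp (-π K(k') / K(k))`, `k' = √(1 - k²)`. At `k = 0`, where `K(k')` is infinite, it
is `0`. -/
def nome (k : ℝ) : ℝ :=
  if k = 0 then 0 else Real.exp (-Real.pi * ellK √(1 - k ^ 2) / ellK k)

/-- The term `(q^{2j} / (1 - q^{4j}))²`, with `j = i + 1`. -/
def evenTerm (q : ℝ) (i : ℕ) : ℝ := (q ^ (2 * (i + 1)) / (1 - q ^ (4 * (i + 1)))) ^ 2

/-- The term `(q^{2j-1} / (1 - q^{4j-2}))²`, with `j = i + 1`. -/
def oddTerm (q : ℝ) (i : ℕ) : ℝ := (q ^ (2 * i + 1) / (1 - q ^ (4 * i + 2))) ^ 2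

end RenewingFlow

end

/-! An even homogeneous `v` is determined by a `π`-periodic function `g` of the angle, and the
companion equation becomes a second order periodic equation for `g`. Put `Δ = delta k (2θ)`. The
substitution `g = Δ^(ℓ/2) exp (∫ r/Δ)` turns it into the Riccati equation `r' = Δ⁻¹ (m + ε k² cos²
2θ / Δ² - r²)`, in which `ℓ` enters only through `ε = 2ℓ + ℓ²`. A periodic `r` with `∫ r/Δ = 0` over
a period gives a positive periodic eigenfunction, and by a maximum principle
(`re_le_of_pos_solution`) its eigenvalue bounds the real parts of all eigenvalues. The leading
eigenvalue near `ℓ = 0` is therefore `m(ε)` along the branch of Riccati solutions through `r = 0`,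
`m = 0`, which is analytic by the inverse function theorem in the Banach algebra of continuous
functions on the circle (`exists_riccati_branch`).

Let `V = -k² cos² 2θ / Δ²` and average with weight `1/Δ`. Then `m'(0) = ⟨V⟩ = E/K - 1` and `m''(0) =
2⟨Z²⟩`, where `Z` is the primitive of `(V - ⟨V⟩)/Δ` of mean zero; `Z` is half a translate of
Jacobi's zeta function at the doubled angle. The chain rule gives `μ₁ = 2 m'(0)` and `μ₂ = m'(0) + 2
m''(0)`, so that `μ₂ = E/K - 1 + zetaSq k / K`.

It remains to identify `zetaSq k`. Differentiating in `k` gives the closed form `ellK_mul_zetaSq` in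
`π²`, `E K` and `K²`. On the other side, Landen's transformation and Poisson summation give `K =
(π/2) θ₃²` and `k = θ₂²/θ₃²` at the nome, and Jacobi's triple product turns two monomials in `k`,
`k'`, `K` into Euler products in `q`. Their logarithmic derivatives in `k`, with `dq/dk` supplied by
Legendre's relation, express the two Lambert series through the same quantities (`lambertSq_sub`,
`lambertSq_nome_sq`).

The physical case rests on the Casimir identity `A₁₂² + (N₁₂ + N₂₁)² - K₁₂² = ℓ(ℓ + 2)` on `V_ℓ`: it
makes `N₁₂² + N₂₁²` equal to `K₁₂² - A₁₂²/2 + ℓ + ℓ²/2`. -/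

noncomputable section

namespace RenewingFlow

/-! ### Integrals depending on a parameter -/

section Parametric

variable {U : Set ℝ} {F F' : ℝ → ℝ → ℝ}

theorem continuousOn_parametric_primitive (hF : ContinuousOn F.uncurry (U ×ˢ Set.univ)) (a : ℝ) :
    ContinuousOn (fun p : ℝ × ℝ => ∫ t in a..p.2, F p.1 t) (U ×ˢ Set.univ) := by
  have h1 : Continuous (Function.uncurry fun (x : U) (t : ℝ) => F x t) := by
    have : (Function.uncurry fun (x : U) (t : ℝ) => F x t) =
        fun p : U × ℝ => F.uncurry ((p.1 : ℝ), p.2) := rfl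
    rw [this]
    exact hF.comp_continuous (by fun_prop) (fun p => ⟨p.1.2, trivial⟩)
  have h2 := intervalIntegral.continuous_parametric_primitive_of_continuous
    (μ := MeasureTheory.volume) (a₀ := a) h1
  rw [continuousOn_iff_continuous_domRestrict]
  exact h2.comp (f := fun p : (U ×ˢ (Set.univ : Set ℝ) : Set (ℝ × ℝ)) =>
    ((⟨p.1.1, p.2.1⟩ : U), p.1.2)) (by fun_prop)

theorem continuousOn_parametric_integral (hF : ContinuousOn F.uncurry (U ×ˢ Set.univ)) (a b : ℝ) :
    ContinuousOn (fun x => ∫ t in a..b, F x t) U :=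
  (continuousOn_parametric_primitive hF a).comp (f := fun x : ℝ => (x, b))
    (by fun_prop) fun _ hx => ⟨hx, trivial⟩

theorem continuous_section (hF : ContinuousOn F.uncurry (U ×ˢ Set.univ)) {x : ℝ} (hx : x ∈ U) :
    Continuous (F x) :=
  hF.comp_continuous (f := fun t : ℝ => (x, t)) (by fun_prop) fun _ => ⟨hx, trivial⟩

theorem hasDerivAt_parametric_integral (hU : IsOpen U)
    (hF : ContinuousOn F.uncurry (U ×ˢ Set.univ))
    (hF' : ContinuousOn F'.uncurry (U ×ˢ Set.univ))
    (hd : ∀ x ∈ U, ∀ t, HasDerivAt (fun y => F y t) (F' x t) x) (a b : ℝ) {x : ℝ} (hx : x ∈ U) :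
    HasDerivAt (fun y => ∫ t in a..b, F y t) (∫ t in a..b, F' x t) x := by
  obtain ⟨r, hr, hrU⟩ := Metric.nhds_basis_closedBall.mem_iff.1 (hU.mem_nhds hx)
  have hc : IsCompact (Metric.closedBall x r ×ˢ Set.uIcc a b) :=
    (isCompact_closedBall x r).prod isCompact_uIcc
  obtain ⟨B, hB⟩ := hc.exists_bound_of_continuousOn
    (hF'.mono (Set.prod_mono hrU (Set.subset_univ _)))
  refine (intervalIntegral.hasDerivAt_integral_of_dominated_loc_of_deriv_le
    (bound := fun _ => B) (Metric.closedBall_mem_nhds x hr) ?_ ?_ ?_ ?_ ?_ ?_).2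
  · filter_upwards [hU.mem_nhds hx] with y hy
    exact (continuous_section hF hy).aestronglyMeasurable
  · exact (continuous_section hF hx).intervalIntegrable _ _
  · exact (continuous_section hF' hx).aestronglyMeasurable
  · exact MeasureTheory.ae_of_all _ fun t ht y hy => hB (y, t) ⟨hy, Set.uIoc_subset_uIcc ht⟩
  · exact intervalIntegrable_const
  · exact MeasureTheory.ae_of_all _ fun t _ y hy => hd y (hrU hy) t

end Parametric

/-! ### Incomplete elliptic integrals of powers of `Δ` -/

/-- The delta amplitude `√(1 - k² sin² t)` as a function of the angle. -/
def delta (k t : ℝ) : ℝ := √(1 - k ^ 2 * Real.sin t ^ 2)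

/-- The incomplete elliptic integral `∫₀^x Δⁿ`. -/
def ellInc (n : ℤ) (k x : ℝ) : ℝ := ∫ t in (0 : ℝ)..x, delta k t ^ n

/-- The moduli `-1 < k < 1`. -/
def moduli : Set ℝ := Set.Ioo (-1) 1

theorem isOpen_moduli : IsOpen moduli := isOpen_Ioo

theorem mem_moduli {k : ℝ} (h0 : 0 ≤ k) (h1 : k < 1) : k ∈ moduli := ⟨by linarith, h1⟩

theorem one_sub_sq_pos {k : ℝ} (hk : k ∈ moduli) : 0 < 1 - k ^ 2 := by
  obtain ⟨h1, h2⟩ := hk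
  nlinarith

theorem delta_arg_pos {k : ℝ} (hk : k ∈ moduli) (t : ℝ) : 0 < 1 - k ^ 2 * Real.sin t ^ 2 := by
  have := one_sub_sq_pos hk
  nlinarith [Real.sin_sq_add_cos_sq t, sq_nonneg (Real.cos t), sq_nonneg (Real.sin t), sq_nonneg k,
    mul_nonneg (sq_nonneg k) (sq_nonneg (Real.cos t))]

theorem delta_pos {k : ℝ} (hk : k ∈ moduli) (t : ℝ) : 0 < delta k t :=
  Real.sqrt_pos.2 (delta_arg_pos hk t)

theorem delta_ne_zero {k : ℝ} (hk : k ∈ moduli) (t : ℝ) : delta k t ≠ 0 := (delta_pos hk t).ne'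

theorem delta_sq {k : ℝ} (hk : k ∈ moduli) (t : ℝ) :
    delta k t ^ 2 = 1 - k ^ 2 * Real.sin t ^ 2 :=
  Real.sq_sqrt (delta_arg_pos hk t).le

theorem continuous_delta : Continuous (Function.uncurry delta) := by
  unfold delta Function.uncurry
  fun_prop

theorem continuousOn_delta_zpow (n : ℤ) :
    ContinuousOn (Function.uncurry fun k t => delta k t ^ n) (moduli ×ˢ Set.univ) := fun p hp =>
  (continuous_delta.continuousAt.zpow₀ n (Or.inl (delta_ne_zero hp.1 p.2))).continuousWithinAt

theorem continuous_delta_zpow {k : ℝ} (hk : k ∈ moduli) (n : ℤ) :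
    Continuous fun t => delta k t ^ n :=
  continuous_section (continuousOn_delta_zpow n) hk

theorem hasDerivAt_delta_fst {k : ℝ} (hk : k ∈ moduli) (t : ℝ) :
    HasDerivAt (fun y => delta y t) (-(k * Real.sin t ^ 2) / delta k t) k := by
  have h : HasDerivAt (fun y : ℝ => 1 - y ^ 2 * Real.sin t ^ 2) (-(2 * k * Real.sin t ^ 2)) k := by
    have := (((hasDerivAt_id k).pow 2).mul_const (Real.sin t ^ 2)).const_sub 1
    simpa using this
  refine (h.sqrt (delta_arg_pos hk t).ne').congr_deriv ?_
  have := delta_ne_zero hk t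
  unfold delta at this ⊢
  field_simp

theorem hasDerivAt_delta_snd {k : ℝ} (hk : k ∈ moduli) (t : ℝ) :
    HasDerivAt (fun y => delta k y) (-(k ^ 2 * Real.sin t * Real.cos t) / delta k t) t := by
  have h : HasDerivAt (fun y : ℝ => 1 - k ^ 2 * Real.sin y ^ 2)
      (-(k ^ 2 * (2 * Real.sin t * Real.cos t))) t := by
    have := (((Real.hasDerivAt_sin t).pow 2).const_mul (k ^ 2)).const_sub 1
    simpa using this
  refine (h.sqrt (delta_arg_pos hk t).ne').congr_deriv ?_
  have := delta_ne_zero hk t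
  unfold delta at this ⊢
  field_simp

theorem hasDerivAt_delta_zpow_fst {k : ℝ} (hk : k ∈ moduli) (n : ℤ) (t : ℝ) :
    HasDerivAt (fun y => delta y t ^ n)
      (-(n * (k * Real.sin t ^ 2) * delta k t ^ (n - 2))) k := by
  have h0 := delta_ne_zero hk t
  have := (hasDerivAt_zpow n (delta k t) (Or.inl h0)).comp k (hasDerivAt_delta_fst hk t)
  refine this.congr_deriv ?_
  rw [show n - 2 = n - 1 - 1 by ring, zpow_sub_one₀ h0 (n - 1)]
  field_simp

theorem hasDerivAt_delta_zpow_snd {k : ℝ} (hk : k ∈ moduli) (n : ℤ) (t : ℝ) :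
    HasDerivAt (fun y => delta k y ^ n)
      (-(n * (k ^ 2 * Real.sin t * Real.cos t) * delta k t ^ (n - 2))) t := by
  have h0 := delta_ne_zero hk t
  have := (hasDerivAt_zpow n (delta k t) (Or.inl h0)).comp t (hasDerivAt_delta_snd hk t)
  refine this.congr_deriv ?_
  rw [show n - 2 = n - 1 - 1 by ring, zpow_sub_one₀ h0 (n - 1)]
  field_simp

theorem hasDerivAt_ellInc_snd {k : ℝ} (hk : k ∈ moduli) (n : ℤ) (x : ℝ) :
    HasDerivAt (ellInc n k) (delta k x ^ n) x :=
  intervalIntegral.integral_hasDerivAt_right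
    ((continuous_delta_zpow hk n).intervalIntegrable _ _)
    ((continuous_delta_zpow hk n).stronglyMeasurableAtFilter _ _)
    (continuous_delta_zpow hk n).continuousAt

theorem continuousOn_ellInc (n : ℤ) :
    ContinuousOn (fun p : ℝ × ℝ => ellInc n p.1 p.2) (moduli ×ˢ Set.univ) :=
  continuousOn_parametric_primitive (continuousOn_delta_zpow n) 0

theorem continuousOn_ellInc_fst (n : ℤ) (x : ℝ) : ContinuousOn (fun k => ellInc n k x) moduli :=
  continuousOn_parametric_integral (continuousOn_delta_zpow n) 0 x

theorem hasDerivAt_ellInc_fst_raw {k : ℝ} (hk : k ∈ moduli) (n : ℤ) (x : ℝ) :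
    HasDerivAt (fun y => ellInc n y x)
      (∫ t in (0 : ℝ)..x, -(n * (k * Real.sin t ^ 2) * delta k t ^ (n - 2))) k := by
  refine hasDerivAt_parametric_integral (F' := fun k t =>
    -(n * (k * Real.sin t ^ 2) * delta k t ^ (n - 2))) isOpen_moduli (continuousOn_delta_zpow n)
    ?_ (fun x hx t => hasDerivAt_delta_zpow_fst hx n t) 0 x hk
  have h1 := continuousOn_delta_zpow (n - 2)
  have h2 : Continuous fun p : ℝ × ℝ => (n : ℝ) * (p.1 * Real.sin p.2 ^ 2) := by fun_prop
  exact (h2.continuousOn.mul h1).neg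

/-- `k ∂ₖ ∫ Δⁿ = n (∫ Δⁿ - ∫ Δⁿ⁻²)`. -/
theorem hasDerivAt_ellInc_fst {k : ℝ} (hk : k ∈ moduli) (h0 : k ≠ 0) (n : ℤ) (x : ℝ) :
    HasDerivAt (fun y => ellInc n y x) (n * (ellInc n k x - ellInc (n - 2) k x) / k) k := by
  refine (hasDerivAt_ellInc_fst_raw hk n x).congr_deriv ?_
  unfold ellInc
  rw [← intervalIntegral.integral_sub ((continuous_delta_zpow hk n).intervalIntegrable _ _)
    ((continuous_delta_zpow hk _).intervalIntegrable _ _), ← intervalIntegral.integral_const_mul,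
    ← intervalIntegral.integral_div]
  refine intervalIntegral.integral_congr fun t _ => ?_
  have h1 := delta_ne_zero hk t
  have h2 := delta_sq hk t
  -- Since `k² sin² = 1 - Δ²`, the `k`-derivative of `Δⁿ` is a combination of `Δⁿ` and `Δⁿ⁻²`.
  have h3 : delta k t ^ n = delta k t ^ (n - 2) * delta k t ^ 2 := by
    rw [← zpow_natCast, ← zpow_add₀ h1]; congr 1; simp
  simp only [h3, h2]
  field_simp
  ring

/-- The reduction formula obtained by differentiating `k² sin cos Δⁿ`. -/
theorem ellInc_recurrence {k : ℝ} (hk : k ∈ moduli) (n : ℤ) (x : ℝ) :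
    (n + 2) * ellInc (n + 2) k x - (n + 1) * (2 - k ^ 2) * ellInc n k x
      + n * (1 - k ^ 2) * ellInc (n - 2) k x =
      k ^ 2 * Real.sin x * Real.cos x * delta k x ^ n := by
  have hI : ∀ m : ℤ, IntervalIntegrable (fun t => delta k t ^ m) MeasureTheory.volume 0 x :=
    fun m => (continuous_delta_zpow hk m).intervalIntegrable _ _
  have hd : ∀ t, HasDerivAt (fun t => k ^ 2 * Real.sin t * Real.cos t * delta k t ^ n)
      ((n + 2) * delta k t ^ (n + 2) - (n + 1) * (2 - k ^ 2) * delta k t ^ n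
        + n * (1 - k ^ 2) * delta k t ^ (n - 2)) t := by
    intro t
    have := (((Real.hasDerivAt_sin t).const_mul (k ^ 2)).mul (Real.hasDerivAt_cos t)).mul
      (hasDerivAt_delta_zpow_snd hk n t)
    refine this.congr_deriv ?_
    have h1 := delta_ne_zero hk t
    have h2 := delta_sq hk t
    have h3 : delta k t ^ n = delta k t ^ (n - 2) * delta k t ^ 2 := by
      rw [← zpow_natCast, ← zpow_add₀ h1]; congr 1; simp
    have h4 : delta k t ^ (n + 2) = delta k t ^ (n - 2) * (delta k t ^ 2) ^ 2 := by
      rw [← pow_mul, ← zpow_natCast, ← zpow_add₀ h1]; congr 1; push_cast; ring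
    rw [h3, h4, h2]
    simp only [Pi.mul_apply]
    have h5 := Real.cos_sq' t
    linear_combination (delta k t ^ (n - 2) * (k^2 * (1 - k ^ 2 * Real.sin t ^ 2)
      - n * k^4 * Real.sin t^2)) * h5
  have := intervalIntegral.integral_eq_sub_of_hasDerivAt (a := 0) (b := x) (fun t _ => hd t)
    (((((hI _).const_mul _)).sub ((hI _).const_mul _)).add ((hI _).const_mul _))
  rw [intervalIntegral.integral_add (((hI _).const_mul _).sub ((hI _).const_mul _))
    ((hI _).const_mul _), intervalIntegral.integral_sub ((hI _).const_mul _) ((hI _).const_mul _),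
    intervalIntegral.integral_const_mul, intervalIntegral.integral_const_mul,
    intervalIntegral.integral_const_mul] at this
  simpa [ellInc] using this

/-! ### Complete elliptic integrals and their derivatives -/

theorem ellK_eq (k : ℝ) : ellK k = ellInc (-1) k (Real.pi / 2) := by
  unfold ellK ellInc delta
  simp

theorem ellE_eq (k : ℝ) : ellE k = ellInc 1 k (Real.pi / 2) := by
  unfold ellE ellInc delta
  simp

/-- The boundary term of the recurrence contains `cos x` and vanishes at `π / 2`; for `n = -1` the
middle coefficient vanishes as well. -/
theorem ellInc_pi_div_two_neg_three {k : ℝ} (hk : k ∈ moduli) :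
    (1 - k ^ 2) * ellInc (-3) k (Real.pi / 2) = ellE k := by
  have := ellInc_recurrence hk (-1) (Real.pi / 2)
  norm_num at this
  rw [ellE_eq]
  linarith

theorem ellInc_pi_div_two_neg_five {k : ℝ} (hk : k ∈ moduli) :
    3 * (1 - k ^ 2) ^ 2 * ellInc (-5) k (Real.pi / 2) =
      2 * (2 - k ^ 2) * ellE k - (1 - k ^ 2) * ellK k := by
  have := ellInc_recurrence hk (-3) (Real.pi / 2)
  have h := ellInc_pi_div_two_neg_three hk
  norm_num at this
  rw [ellK_eq, ← h]
  linear_combination -(1 - k ^ 2) * this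

theorem ellInc_pos {k : ℝ} (hk : k ∈ moduli) (n : ℤ) {x : ℝ} (hx : 0 < x) : 0 < ellInc n k x :=
  intervalIntegral.intervalIntegral_pos_of_pos ((continuous_delta_zpow hk n).intervalIntegrable _ _)
    (fun t => zpow_pos (delta_pos hk t) n) hx

theorem ellK_pos {k : ℝ} (hk : k ∈ moduli) : 0 < ellK k := by
  rw [ellK_eq]; exact ellInc_pos hk _ (by positivity)

theorem continuousOn_ellK : ContinuousOn ellK moduli :=
  (continuousOn_ellInc_fst (-1) (Real.pi / 2)).congr fun k _ => ellK_eq k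

theorem continuousOn_ellE : ContinuousOn ellE moduli :=
  (continuousOn_ellInc_fst 1 (Real.pi / 2)).congr fun k _ => ellE_eq k

theorem hasDerivAt_ellK {k : ℝ} (hk : k ∈ moduli) (h0 : k ≠ 0) :
    HasDerivAt ellK ((ellE k / (1 - k ^ 2) - ellK k) / k) k := by
  have h := hasDerivAt_ellInc_fst hk h0 (-1) (Real.pi / 2)
  have h2 := ellInc_pi_div_two_neg_three hk
  have h3 := (one_sub_sq_pos hk).ne'
  refine (h.congr_of_eventuallyEq (Eventually.of_forall ellK_eq)).congr_deriv ?_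
  rw [ellK_eq, ← h2, mul_div_cancel_left₀ _ h3]
  norm_num

theorem hasDerivAt_ellE {k : ℝ} (hk : k ∈ moduli) (h0 : k ≠ 0) :
    HasDerivAt ellE ((ellE k - ellK k) / k) k := by
  have h := hasDerivAt_ellInc_fst hk h0 1 (Real.pi / 2)
  refine (h.congr_of_eventuallyEq (Eventually.of_forall ellE_eq)).congr_deriv ?_
  rw [ellK_eq, ellE_eq]
  norm_num

theorem ellK_zero : ellK 0 = Real.pi / 2 := by simp [ellK]

theorem ellE_zero : ellE 0 = Real.pi / 2 := by simp [ellE]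

theorem moduli_of_mem_Ioo {k : ℝ} (hk : k ∈ Set.Ioo (0 : ℝ) 1) : k ∈ moduli :=
  mem_moduli hk.1.le hk.2

/-- A function with zero derivative on `(0, 1)` is equal to its limit at `0`. -/
theorem eq_of_hasDerivAt_zero_of_tendsto {f : ℝ → ℝ} {c : ℝ}
    (hd : ∀ x ∈ Set.Ioo (0 : ℝ) 1, HasDerivAt f 0 x) (hl : Tendsto f (𝓝[>] 0) (𝓝 c)) {x : ℝ}
    (hx : x ∈ Set.Ioo (0 : ℝ) 1) : f x = c := by
  have hconst : ∀ y ∈ Set.Ioo (0 : ℝ) 1, f y = f x := fun y hy =>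
    isOpen_Ioo.is_const_of_deriv_eq_zero isPreconnected_Ioo
      (fun z hz => (hd z hz).differentiableAt.differentiableWithinAt)
      (fun z hz => (hd z hz).deriv) hy hx
  have h : Tendsto f (𝓝[>] 0) (𝓝 (f x)) := by
    refine tendsto_const_nhds.congr' ?_
    filter_upwards [Ioo_mem_nhdsGT (zero_lt_one (α := ℝ))] with y hy
    exact (hconst y hy).symm
  exact tendsto_nhds_unique h hl

/-! ### Legendre's relation and the nome -/

/-- The complementary modulus. -/
def compl (k : ℝ) : ℝ := √(1 - k ^ 2)

theorem compl_mem_Ioo {k : ℝ} (hk : k ∈ Set.Ioo (0 : ℝ) 1) : compl k ∈ Set.Ioo (0 : ℝ) 1 := by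
  have h := one_sub_sq_pos (moduli_of_mem_Ioo hk)
  refine ⟨Real.sqrt_pos.2 h, ?_⟩
  rw [compl, Real.sqrt_lt' one_pos]
  nlinarith [hk.1]

theorem compl_sq {k : ℝ} (hk : k ∈ moduli) : compl k ^ 2 = 1 - k ^ 2 :=
  Real.sq_sqrt (one_sub_sq_pos hk).le

theorem compl_compl {k : ℝ} (hk : k ∈ Set.Ioo (0 : ℝ) 1) : compl (compl k) = k := by
  rw [compl, compl_sq (moduli_of_mem_Ioo hk), sub_sub_cancel, Real.sqrt_sq hk.1.le]

theorem hasDerivAt_compl {k : ℝ} (hk : k ∈ moduli) : HasDerivAt compl (-k / compl k) k := by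
  have h : HasDerivAt (fun y : ℝ => 1 - y ^ 2) (-(2 * k)) k := by
    simpa using ((hasDerivAt_id k).pow 2).const_sub 1
  have h0 := one_sub_sq_pos hk
  refine (h.sqrt h0.ne').congr_deriv ?_
  have := (Real.sqrt_pos.2 h0).ne'
  unfold compl
  field_simp

theorem hasDerivAt_ellK_compl {k : ℝ} (hk : k ∈ Set.Ioo (0 : ℝ) 1) :
    HasDerivAt (fun y => ellK (compl y))
      (-(ellE (compl k) - k ^ 2 * ellK (compl k)) / (k * (1 - k ^ 2))) k := by
  have hc := compl_mem_Ioo hk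
  have hk' := moduli_of_mem_Ioo hk
  have h := (hasDerivAt_ellK (moduli_of_mem_Ioo hc) hc.1.ne').comp k (hasDerivAt_compl hk')
  refine h.congr_deriv ?_
  have h1 := hk.1.ne'
  have h2 := hc.1.ne'
  rw [← compl_sq hk']
  have h3 : 1 - compl k ^ 2 = k ^ 2 := by rw [compl_sq hk']; ring
  rw [h3]
  field_simp

theorem hasDerivAt_ellE_compl {k : ℝ} (hk : k ∈ Set.Ioo (0 : ℝ) 1) :
    HasDerivAt (fun y => ellE (compl y))
      (-(k * (ellE (compl k) - ellK (compl k))) / (1 - k ^ 2)) k := by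
  have hc := compl_mem_Ioo hk
  have hk' := moduli_of_mem_Ioo hk
  have h := (hasDerivAt_ellE (moduli_of_mem_Ioo hc) hc.1.ne').comp k (hasDerivAt_compl hk')
  refine h.congr_deriv ?_
  have h2 := hc.1.ne'
  rw [← compl_sq hk']
  field_simp

theorem continuous_ellE : Continuous ellE := by
  unfold ellE
  exact intervalIntegral.continuous_parametric_intervalIntegral_of_continuous' (by fun_prop) _ _

theorem ellE_one : ellE 1 = 1 := by
  unfold ellE
  rw [intervalIntegral.integral_congr (g := Real.cos)]
  · simp
  · intro t ht
    rw [Set.uIcc_of_le (by positivity)] at ht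
    have : 0 ≤ Real.cos t :=
      Real.cos_nonneg_of_mem_Icc ⟨by linarith [ht.1, Real.pi_pos], ht.2⟩
    simp only [one_pow, one_mul]
    rw [← Real.cos_sq', Real.sqrt_sq this]

theorem ellK_le {k : ℝ} (hk : k ∈ moduli) : ellK k ≤ Real.pi / 2 / compl k := by
  have h0 := one_sub_sq_pos hk
  have hI : ∀ t, delta k t ^ (-1 : ℤ) ≤ 1 / compl k := by
    intro t
    rw [zpow_neg_one, ← one_div]
    refine one_div_le_one_div_of_le (Real.sqrt_pos.2 h0) (Real.sqrt_le_sqrt ?_)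
    nlinarith [Real.sin_sq_le_one t, sq_nonneg k]
  rw [ellK_eq]
  refine (intervalIntegral.integral_mono_on (by positivity)
    ((continuous_delta_zpow hk _).intervalIntegrable _ _) intervalIntegrable_const
    fun t _ => hI t).trans_eq ?_
  simp [div_eq_mul_inv]

theorem ellK_sub_ellE_nonneg {k : ℝ} (hk : k ∈ moduli) : 0 ≤ ellK k - ellE k := by
  rw [ellK_eq, ellE_eq, ellInc, ellInc, ← intervalIntegral.integral_sub
    ((continuous_delta_zpow hk _).intervalIntegrable _ _)
    ((continuous_delta_zpow hk _).intervalIntegrable _ _)]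
  refine intervalIntegral.integral_nonneg (by positivity) fun t _ => ?_
  have h1 := delta_pos hk t
  have h2 := delta_sq hk t
  rw [zpow_neg_one, zpow_one, sub_nonneg, le_inv_comm₀ h1 h1, ← one_div, le_div_iff₀ h1, ← sq, h2]
  nlinarith [mul_nonneg (sq_nonneg k) (sq_nonneg (Real.sin t))]

theorem ellK_sub_ellE_le {k : ℝ} (hk : k ∈ moduli) : ellK k - ellE k ≤ k ^ 2 * ellK k := by
  rw [ellK_eq, ellE_eq, ellInc, ellInc, ← intervalIntegral.integral_sub
    ((continuous_delta_zpow hk _).intervalIntegrable _ _)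
    ((continuous_delta_zpow hk _).intervalIntegrable _ _), ← intervalIntegral.integral_const_mul]
  refine intervalIntegral.integral_mono_on (by positivity)
    (((continuous_delta_zpow hk _).sub (continuous_delta_zpow hk _)).intervalIntegrable _ _)
    ((continuous_const.mul (continuous_delta_zpow hk _)).intervalIntegrable _ _) fun t _ => ?_
  have h1 := delta_pos hk t
  have h2 := delta_sq hk t
  have h3 : delta k t ^ (-1 : ℤ) - delta k t ^ (1 : ℤ) =
      (1 - delta k t ^ 2) * delta k t ^ (-1 : ℤ) := by
    rw [zpow_neg_one, zpow_one]; field_simp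
  rw [h3]
  refine mul_le_mul_of_nonneg_right ?_ (zpow_pos h1 _).le
  nlinarith [Real.sin_sq_le_one t, sq_nonneg k]

/-- Legendre's relation. -/
theorem legendre_relation {k : ℝ} (hk : k ∈ Set.Ioo (0 : ℝ) 1) :
    ellE k * ellK (compl k) + ellE (compl k) * ellK k - ellK k * ellK (compl k) =
      Real.pi / 2 := by
  refine eq_of_hasDerivAt_zero_of_tendsto (f := fun k => ellE k * ellK (compl k) +
    ellE (compl k) * ellK k - ellK k * ellK (compl k)) ?_ ?_ hk
  · intro k hk
    have hm := moduli_of_mem_Ioo hk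
    have h0 := hk.1.ne'
    have hE := hasDerivAt_ellE hm h0
    have hK := hasDerivAt_ellK hm h0
    have hE' := hasDerivAt_ellE_compl hk
    have hK' := hasDerivAt_ellK_compl hk
    refine (((hE.mul hK').add (hE'.mul hK)).sub (hK.mul hK')).congr_deriv ?_
    have h1 := (one_sub_sq_pos hm).ne'
    field_simp
    ring
  · have h0 : (0 : ℝ) ∈ moduli := mem_moduli le_rfl one_pos
    have hKc : Tendsto ellK (𝓝[>] 0) (𝓝 (Real.pi / 2)) := by
      rw [← ellK_zero]
      exact ((continuousOn_ellK.continuousAt (isOpen_moduli.mem_nhds h0)).tendsto).mono_left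
        nhdsWithin_le_nhds
    have h1 : Tendsto (fun k => ellE (compl k) * ellK k) (𝓝[>] 0) (𝓝 (1 * (Real.pi / 2))) := by
      refine Tendsto.mul ?_ hKc
      have : Continuous fun k => ellE (compl k) := continuous_ellE.comp (by unfold compl; fun_prop)
      have h2 := this.tendsto 0
      simp only [compl] at h2
      norm_num [ellE_one] at h2
      exact h2.mono_left nhdsWithin_le_nhds
    -- `K(k')` blows up as `k → 0`, but the crude bound `K(k') ≤ π / (2k)` suffices against `K - E ≤
    -- k² K`: the product is `O(k)`.
    have h2 : Tendsto (fun k => (ellK k - ellE k) * ellK (compl k)) (𝓝[>] 0) (𝓝 0) := by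
      refine tendsto_of_tendsto_of_tendsto_of_le_of_le' (g := fun _ => 0)
        (h := fun k => k * ellK k * (Real.pi / 2)) tendsto_const_nhds ?_ ?_ ?_
      · have := ((tendsto_id.mono_left (nhdsWithin_le_nhds (a := (0 : ℝ)) (s := Set.Ioi 0))).mul
          hKc).mul_const (Real.pi / 2)
        simpa using this
      · filter_upwards [Ioo_mem_nhdsGT (zero_lt_one (α := ℝ))] with k hk
        exact mul_nonneg (ellK_sub_ellE_nonneg (moduli_of_mem_Ioo hk))
          (ellK_pos (moduli_of_mem_Ioo (compl_mem_Ioo hk))).le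
      · filter_upwards [Ioo_mem_nhdsGT (zero_lt_one (α := ℝ))] with k hk
        have hm := moduli_of_mem_Ioo hk
        have hc := compl_mem_Ioo hk
        have h3 := ellK_sub_ellE_le hm
        have h4 := ellK_le (moduli_of_mem_Ioo hc)
        rw [compl_compl hk] at h4
        calc (ellK k - ellE k) * ellK (compl k) ≤ k ^ 2 * ellK k * (Real.pi / 2 / k) :=
              mul_le_mul h3 h4 (ellK_pos (moduli_of_mem_Ioo hc)).le
                (mul_nonneg (sq_nonneg _) (ellK_pos hm).le)
          _ = k * ellK k * (Real.pi / 2) := by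
              have := hk.1.ne'
              field_simp
    have := h1.sub h2
    simp only [one_mul, sub_zero] at this
    exact this.congr fun k => by ring

/-- The numerator of the quotient rule is the Wronskian of `K` and `K'`, which Legendre's relation
evaluates as a constant divided by `k (1 - k²)`. This is the source of the formula for `dq/dk`. -/
theorem hasDerivAt_ellK_div {k : ℝ} (hk : k ∈ Set.Ioo (0 : ℝ) 1) :
    HasDerivAt (fun k => ellK (compl k) / ellK k)
      (-Real.pi / (2 * k * (1 - k ^ 2) * ellK k ^ 2)) k := by
  have hm := moduli_of_mem_Ioo hk
  have h0 := hk.1.ne'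
  have hp := (ellK_pos hm).ne'
  have h1 := (one_sub_sq_pos hm).ne'
  refine ((hasDerivAt_ellK_compl hk).div (hasDerivAt_ellK hm h0) hp).congr_deriv ?_
  have h2 := legendre_relation hk
  field_simp
  linear_combination -2 * h2

theorem nome_eq {k : ℝ} (hk : k ≠ 0) :
    nome k = Real.exp (-Real.pi * (ellK (compl k) / ellK k)) := by
  rw [nome, if_neg hk, compl, mul_div_assoc]

theorem hasDerivAt_nome {k : ℝ} (hk : k ∈ Set.Ioo (0 : ℝ) 1) :
    HasDerivAt nome (nome k * (Real.pi ^ 2 / (2 * k * (1 - k ^ 2) * ellK k ^ 2))) k := by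
  have h := ((hasDerivAt_ellK_div hk).const_mul (-Real.pi)).exp
  rw [← nome_eq hk.1.ne'] at h
  refine (h.congr_of_eventuallyEq ?_).congr_deriv (by ring)
  filter_upwards [isOpen_Ioo.mem_nhds hk] with y hy
  exact nome_eq hy.1.ne'

theorem nome_mem_Ioo {k : ℝ} (hk : k ∈ Set.Ioo (0 : ℝ) 1) : nome k ∈ Set.Ioo (0 : ℝ) 1 := by
  rw [nome_eq hk.1.ne']
  refine ⟨Real.exp_pos _, Real.exp_lt_one_iff.2 ?_⟩
  have := div_pos (ellK_pos (moduli_of_mem_Ioo (compl_mem_Ioo hk)))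
    (ellK_pos (moduli_of_mem_Ioo hk))
  nlinarith [Real.pi_pos]

/-- The period ratio determines the modulus. -/
theorem ellK_div_injOn : Set.InjOn (fun k => ellK (compl k) / ellK k) (Set.Ioo (0 : ℝ) 1) := by
  have : StrictAntiOn (fun k => ellK (compl k) / ellK k) (Set.Ioo (0 : ℝ) 1) := by
    refine strictAntiOn_of_deriv_neg (convex_Ioo 0 1)
      (fun x hx => (hasDerivAt_ellK_div hx).continuousAt.continuousWithinAt) fun x hx => ?_
    rw [interior_Ioo] at hx
    have hm := moduli_of_mem_Ioo hx
    rw [(hasDerivAt_ellK_div hx).deriv]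
    have h1 := hx.1
    have h2 := one_sub_sq_pos hm
    have h3 := ellK_pos hm
    exact div_neg_of_neg_of_pos (by linarith [Real.pi_pos]) (by positivity)
  exact this.injOn

/-! ### Jacobi's zeta function and its mean square -/

/-- The primitive of `k'² Δ⁻³ - (E/K) Δ⁻¹`, a translate of Jacobi's zeta function. -/
def zetaInc (k x : ℝ) : ℝ := (1 - k ^ 2) * ellInc (-3) k x - ellE k / ellK k * ellInc (-1) k x

theorem hasDerivAt_zetaInc_snd {k : ℝ} (hk : k ∈ moduli) (x : ℝ) :
    HasDerivAt (zetaInc k)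
      ((1 - k ^ 2) * delta k x ^ (-3 : ℤ) - ellE k / ellK k * delta k x ^ (-1 : ℤ)) x :=
  ((hasDerivAt_ellInc_snd hk _ x).const_mul _).sub ((hasDerivAt_ellInc_snd hk _ x).const_mul _)

theorem zetaInc_zero (k : ℝ) : zetaInc k 0 = 0 := by simp [zetaInc, ellInc]

theorem zetaInc_pi_div_two {k : ℝ} (hk : k ∈ moduli) : zetaInc k (Real.pi / 2) = 0 := by
  have := (ellK_pos hk).ne'
  rw [zetaInc, ellInc_pi_div_two_neg_three hk, ← ellK_eq]
  field_simp
  ring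

/-- Differentiation in `k` produces `∫ Δ⁻⁵`; the recurrence at `n = -3` trades it for `∫ Δ⁻³`, `∫
Δ⁻¹` and a boundary term, and the integrals recombine into a multiple of `zetaInc` itself. -/
theorem hasDerivAt_zetaInc_fst {k : ℝ} (hk : k ∈ Set.Ioo (0 : ℝ) 1) (x : ℝ) :
    HasDerivAt (fun y => zetaInc y x)
      ((1 / k - ellE k / ellK k / (k * (1 - k ^ 2))) * zetaInc k x
        - k * Real.sin x * Real.cos x * delta k x ^ (-3 : ℤ)) k := by
  have hm := moduli_of_mem_Ioo hk
  have h0 := hk.1.ne'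
  have h1 := (one_sub_sq_pos hm).ne'
  have hp := (ellK_pos hm).ne'
  have hq : HasDerivAt (fun y : ℝ => 1 - y ^ 2) (-(2 * k)) k := by
    simpa using ((hasDerivAt_id k).pow 2).const_sub 1
  have h := (hq.mul (hasDerivAt_ellInc_fst hm h0 (-3) x)).sub
    (((hasDerivAt_ellE hm h0).div (hasDerivAt_ellK hm h0) hp).mul
      (hasDerivAt_ellInc_fst hm h0 (-1) x))
  refine h.congr_deriv ?_
  have hr := ellInc_recurrence hm (-3) x
  norm_num at hr ⊢
  unfold zetaInc
  have hr' : k * Real.sin x * Real.cos x * (delta k x ^ 3)⁻¹ =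
    (-ellInc (-1) k x + 2 * (2 - k ^ 2) * ellInc (-3) k x
      - 3 * (1 - k ^ 2) * ellInc (-5) k x) / k := by
    rw [eq_div_iff h0]
    linear_combination -hr
  rw [hr']
  field_simp
  ring

theorem continuousOn_zetaInc :
    ContinuousOn (Function.uncurry zetaInc) (moduli ×ˢ Set.univ) := by
  have h3 := continuousOn_ellInc (-3)
  have h1 := continuousOn_ellInc (-1)
  have hf : Set.MapsTo Prod.fst (moduli ×ˢ (Set.univ : Set ℝ)) moduli := fun p hp => hp.1
  have hK := continuousOn_ellK.comp continuousOn_fst hf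
  have hE := continuousOn_ellE.comp continuousOn_fst hf
  have hq : ContinuousOn (fun p : ℝ × ℝ => 1 - p.1 ^ 2) (moduli ×ˢ Set.univ) := by fun_prop
  exact (hq.mul h3).sub ((hE.div hK fun p hp => (ellK_pos hp.1).ne').mul h1)

theorem continuousOn_zetaInc_sq_mul : ContinuousOn
    (Function.uncurry fun k x => zetaInc k x ^ 2 * delta k x ^ (-1 : ℤ)) (moduli ×ˢ Set.univ) :=
  (continuousOn_zetaInc.pow 2).mul (continuousOn_delta_zpow (-1))

/-- The integral `∫₀^{π/2} Z² Δ⁻¹` over a quarter period. -/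
def zetaSq (k : ℝ) : ℝ :=
  ∫ x in (0 : ℝ)..(Real.pi / 2), zetaInc k x ^ 2 * delta k x ^ (-1 : ℤ)

theorem continuousOn_zetaSq : ContinuousOn zetaSq moduli :=
  continuousOn_parametric_integral
    (F := fun k x => zetaInc k x ^ 2 * delta k x ^ (-1 : ℤ))
    continuousOn_zetaInc_sq_mul 0 (Real.pi / 2)

/-- Modulo an exact derivative in `x`, the `k`-derivative of the integrand is a multiple of `Z² Δ⁻¹`
plus powers of `Δ`. Hence `zetaSq` satisfies a linear first order equation in `k` with complete
elliptic integrals as source. -/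
theorem hasDerivAt_zetaSq {k : ℝ} (hk : k ∈ Set.Ioo (0 : ℝ) 1) :
    HasDerivAt zetaSq
      ((1 / k - ellE k / ellK k / (k * (1 - k ^ 2))) * zetaSq k
        + 1 / k * ((1 - k ^ 2) * ellInc (-5) k (Real.pi / 2)
          - ellE k / ellK k * ellInc (-3) k (Real.pi / 2))) k := by
  have hm := moduli_of_mem_Ioo hk
  have h0 := hk.1.ne'
  have h1 := (one_sub_sq_pos hm).ne'
  have hp := (ellK_pos hm).ne'
  let a : ℝ → ℝ := fun k => 1 / k - ellE k / ellK k / (k * (1 - k ^ 2))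
  let F' : ℝ → ℝ → ℝ := fun k x =>
    2 * zetaInc k x * (a k * zetaInc k x - k * Real.sin x * Real.cos x * delta k x ^ (-3 : ℤ))
        * delta k x ^ (-1 : ℤ)
      + zetaInc k x ^ 2 * (k * Real.sin x ^ 2 * delta k x ^ (-3 : ℤ))
  have hsub : Set.Ioo (0 : ℝ) 1 ×ˢ (Set.univ : Set ℝ) ⊆ moduli ×ˢ Set.univ :=
    Set.prod_mono (fun _ h => moduli_of_mem_Ioo h) le_rfl
  have hZ := continuousOn_zetaInc.mono hsub
  have hΔ := fun n => (continuousOn_delta_zpow n).mono hsub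
  have hF' : ContinuousOn F'.uncurry (Set.Ioo (0 : ℝ) 1 ×ˢ Set.univ) := by
    have ha : ContinuousOn a (Set.Ioo (0 : ℝ) 1) := by
      refine ContinuousOn.sub (continuousOn_const.div continuousOn_id fun x hx => hx.1.ne') ?_
      refine ContinuousOn.div (ContinuousOn.div
        (continuousOn_ellE.mono fun _ h => moduli_of_mem_Ioo h)
        (continuousOn_ellK.mono fun _ h => moduli_of_mem_Ioo h)
        fun x hx => (ellK_pos (moduli_of_mem_Ioo hx)).ne') (by fun_prop)
        fun x hx => mul_ne_zero hx.1.ne' (one_sub_sq_pos (moduli_of_mem_Ioo hx)).ne'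
    have ha' := ha.comp (continuousOn_fst (s := Set.Ioo (0 : ℝ) 1 ×ˢ (Set.univ : Set ℝ)))
      fun p hp => hp.1
    have hsc : ContinuousOn (fun p : ℝ × ℝ => p.1 * Real.sin p.2 * Real.cos p.2)
      (Set.Ioo (0 : ℝ) 1 ×ˢ Set.univ) := by fun_prop
    have hss : ContinuousOn (fun p : ℝ × ℝ => p.1 * Real.sin p.2 ^ 2)
      (Set.Ioo (0 : ℝ) 1 ×ˢ Set.univ) := by fun_prop
    exact (((continuousOn_const.mul hZ).mul ((ha'.mul hZ).sub (hsc.mul (hΔ (-3))))).mul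
      (hΔ (-1))).add ((hZ.pow 2).mul (hss.mul (hΔ (-3))))
  have hd := hasDerivAt_parametric_integral (F := fun k x => zetaInc k x ^ 2 * delta k x ^ (-1 : ℤ))
    (F' := F') isOpen_Ioo (continuousOn_zetaInc_sq_mul.mono hsub) hF' (fun y hy x => by
      refine (((hasDerivAt_zetaInc_fst hy x).pow 2).mul
        (hasDerivAt_delta_zpow_fst (moduli_of_mem_Ioo hy) (-1) x)).congr_deriv ?_
      simp only [F', a]
      norm_num) 0 (Real.pi / 2) hk
  refine hd.congr_deriv ?_
  have hI : ∀ n : ℤ, IntervalIntegrable (fun t => delta k t ^ n) MeasureTheory.volume 0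
      (Real.pi / 2) := fun m => (continuous_delta_zpow hm m).intervalIntegrable _ _
  have hZk : Continuous (zetaInc k) := continuous_section hZ hk
  -- The cubic term accounts for the part of the integrand quadratic in `Z`, the term `Z Δ⁻²` for
  -- the cross term with `sin x cos x`. Both vanish at `0` and `π / 2` because `Z` does.
  have hprim : ∀ x, HasDerivAt (fun x => zetaInc k x ^ 3 / (3 * k * (1 - k ^ 2))
      - zetaInc k x * delta k x ^ (-2 : ℤ) / k)
      (F' k x - (a k * (zetaInc k x ^ 2 * delta k x ^ (-1 : ℤ))
        + 1 / k * ((1 - k ^ 2) * delta k x ^ (-5 : ℤ)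
          - ellE k / ellK k * delta k x ^ (-3 : ℤ)))) x := by
    intro x
    have hz := hasDerivAt_zetaInc_snd hm x
    refine (((hz.pow 3).div_const _).sub
      ((hz.mul (hasDerivAt_delta_zpow_snd hm (-2) x)).div_const k)).congr_deriv ?_
    have hδ := delta_ne_zero hm x
    have hsq := delta_sq hm x
    have hz1 : ∀ n : ℕ, delta k x ^ (-(n : ℤ)) = (delta k x)⁻¹ ^ n := fun n => by
      rw [zpow_neg, zpow_natCast, inv_pow]
    have e1 : delta k x ^ (-1 : ℤ) = (delta k x)⁻¹ ^ 1 := by exact_mod_cast hz1 1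
    have e2 : delta k x ^ (-2 : ℤ) = (delta k x)⁻¹ ^ 2 := by exact_mod_cast hz1 2
    have e3 : delta k x ^ (-3 : ℤ) = (delta k x)⁻¹ ^ 3 := by exact_mod_cast hz1 3
    have e4 : delta k x ^ (-2 - 2 : ℤ) = (delta k x)⁻¹ ^ 4 := by exact_mod_cast hz1 4
    have e5 : delta k x ^ (-5 : ℤ) = (delta k x)⁻¹ ^ 5 := by exact_mod_cast hz1 5
    simp only [F', a, e1, e2, e3, e4, e5]
    have hs : k ^ 2 * Real.sin x ^ 2 = 1 - delta k x ^ 2 := by rw [hsq]; ring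
    have hs' : k * Real.sin x ^ 2 = (1 - delta k x ^ 2) / k := by
      rw [← hs]; field_simp
    rw [hs']
    set d := delta k x
    push_cast
    field_simp
    ring
  have hFc : Continuous (F' k) := continuous_section hF' hk
  have hZc : IntervalIntegrable (fun x => zetaInc k x ^ 2 * delta k x ^ (-1 : ℤ))
    MeasureTheory.volume 0 (Real.pi / 2) :=
    ((hZk.pow 2).mul (continuous_delta_zpow hm (-1))).intervalIntegrable _ _
  have hrest := (hZc.const_mul (a k)).add
    ((((hI (-5)).const_mul (1 - k ^ 2)).sub ((hI (-3)).const_mul (ellE k / ellK k))).const_mul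
      (1 / k))
  have hint := intervalIntegral.integral_eq_sub_of_hasDerivAt (a := 0) (b := Real.pi / 2)
    (fun x _ => hprim x) ((hFc.intervalIntegrable _ _).sub hrest)
  rw [intervalIntegral.integral_sub (hFc.intervalIntegrable _ _) hrest,
    intervalIntegral.integral_add (hZc.const_mul (a k))
    ((((hI (-5)).const_mul (1 - k ^ 2)).sub ((hI (-3)).const_mul (ellE k / ellK k))).const_mul
      (1 / k)), intervalIntegral.integral_const_mul, intervalIntegral.integral_const_mul,
    intervalIntegral.integral_sub ((hI (-5)).const_mul (1 - k ^ 2))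
      ((hI (-3)).const_mul (ellE k / ellK k)), intervalIntegral.integral_const_mul,
    intervalIntegral.integral_const_mul, zetaInc_zero, zetaInc_pi_div_two hm] at hint
  simp only [ne_eq, OfNat.ofNat_ne_zero, not_false_eq_true, zero_pow, zero_div, zero_mul,
    sub_zero] at hint
  exact sub_eq_zero.1 hint

/-- The mean square of the zeta function in terms of complete elliptic integrals. -/
theorem ellK_mul_zetaSq {k : ℝ} (hk : k ∈ Set.Ioo (0 : ℝ) 1) :
    ellK k * zetaSq k =
      Real.pi ^ 2 / 12 - ellE k * ellK k + (2 - k ^ 2) * ellK k ^ 2 / 3 := by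
  have key := eq_of_hasDerivAt_zero_of_tendsto (f := fun k => ellK k * zetaSq k -
    (Real.pi ^ 2 / 12 - ellE k * ellK k + (2 - k ^ 2) * ellK k ^ 2 / 3)) (c := 0) ?_ ?_ hk
  · simpa [sub_eq_zero] using key
  · intro k hk
    have hm := moduli_of_mem_Ioo hk
    have h0 := hk.1.ne'
    have h1 := (one_sub_sq_pos hm).ne'
    have hp := (ellK_pos hm).ne'
    have hE := hasDerivAt_ellE hm h0
    have hK := hasDerivAt_ellK hm h0
    have hq : HasDerivAt (fun y : ℝ => 2 - y ^ 2) (-(2 * k)) k := by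
      simpa using ((hasDerivAt_id k).pow 2).const_sub 2
    refine ((hK.mul (hasDerivAt_zetaSq hk)).sub (((hE.mul hK).const_sub _).add
      ((hq.mul (hK.pow 2)).div_const 3))).congr_deriv ?_
    have h3 := ellInc_pi_div_two_neg_three hm
    rw [mul_comm, ← eq_div_iff h1] at h3
    have h5' : ellInc (-5) k (Real.pi / 2) = (2 * (2 - k ^ 2) * ellE k - (1 - k ^ 2) * ellK k)
      / (3 * (1 - k ^ 2) ^ 2) := by
      have := ellInc_pi_div_two_neg_five hm
      field_simp
      linarith
    rw [h3, h5']
    norm_num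
    field_simp
    ring
  · have h0 : (0 : ℝ) ∈ moduli := mem_moduli le_rfl one_pos
    have hc : ContinuousOn (fun k => ellK k * zetaSq k -
      (Real.pi ^ 2 / 12 - ellE k * ellK k + (2 - k ^ 2) * ellK k ^ 2 / 3)) moduli := by
      have h1 := continuousOn_ellK
      have h2 := continuousOn_zetaSq
      have h3 := continuousOn_ellE
      fun_prop
    have := (hc.continuousAt (isOpen_moduli.mem_nhds h0)).tendsto.mono_left
      (nhdsWithin_le_nhds (s := Set.Ioi 0))
    -- For `k = 0` one has `Δ = 1` and `E = K`, so the zeta function vanishes identically. The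
    -- constant `π² / 12` is the one that balances `-E K + 2 K² / 3` there.
    have hz : zetaSq 0 = 0 := by
      have : ∀ x, zetaInc 0 x = 0 := fun x => by
        have : Real.pi / 2 ≠ 0 := by positivity
        simp [zetaInc, ellInc, delta, ellK_zero, ellE_zero, this]
      simp [zetaSq, this]
    rw [hz, ellK_zero, ellE_zero] at this
    convert! this using 2
    ring

/-! ### Landen's transformation -/

theorem delta_pi_sub (k t : ℝ) : delta k (Real.pi - t) = delta k t := by
  simp [delta]

theorem ellInc_pi {k : ℝ} (hk : k ∈ moduli) (n : ℤ) :
    ellInc n k Real.pi = 2 * ellInc n k (Real.pi / 2) := by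
  have hI : ∀ a b, IntervalIntegrable (fun t => delta k t ^ n) MeasureTheory.volume a b :=
    fun a b => (continuous_delta_zpow hk n).intervalIntegrable _ _
  have h := intervalIntegral.integral_comp_sub_left (a := 0) (b := Real.pi / 2)
    (fun t => delta k t ^ n) Real.pi
  simp only [delta_pi_sub, sub_zero] at h
  rw [show Real.pi - Real.pi / 2 = Real.pi / 2 by ring] at h
  unfold ellInc
  rw [← intervalIntegral.integral_add_adjacent_intervals (hI 0 (Real.pi / 2))
    (hI (Real.pi / 2) Real.pi), ← h, two_mul]

/-- Landen's substitution for the complementary modulus `b`. -/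
def landenAngle (b x : ℝ) : ℝ :=
  2 * x - Real.arctan ((1 - b) * (Real.sin x * Real.cos x) / (Real.cos x ^ 2 + b * Real.sin x ^ 2))

/-- This is the denominator inside `landenAngle`. On `(-π/2, π/2)` the Landen angle is `x + arctan
(b tan x)`; the form used here has no pole and is differentiable at `π / 2` too. -/
theorem cos_sq_add_mul_sin_sq_pos {b : ℝ} (hb : 0 < b) (x : ℝ) :
    0 < Real.cos x ^ 2 + b * Real.sin x ^ 2 := by
  rcases eq_or_ne (Real.cos x) 0 with h | h
  · have := Real.sin_sq_add_cos_sq x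
    rw [h] at this ⊢
    nlinarith
  · have : 0 < Real.cos x ^ 2 := by positivity
    have : 0 ≤ b * Real.sin x ^ 2 := by positivity
    linarith

theorem delta_compl_sq {b : ℝ} (hb : b ∈ Set.Ioo (0 : ℝ) 1) (x : ℝ) :
    delta (compl b) x ^ 2 = Real.cos x ^ 2 + b ^ 2 * Real.sin x ^ 2 := by
  rw [delta_sq (moduli_of_mem_Ioo (compl_mem_Ioo hb)), compl_sq (moduli_of_mem_Ioo hb),
    Real.cos_sq']
  ring

theorem landen_sq {b : ℝ} (x : ℝ) :
    (Real.cos x ^ 2 + b * Real.sin x ^ 2) ^ 2 + ((1 - b) * (Real.sin x * Real.cos x)) ^ 2 =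
      Real.cos x ^ 2 + b ^ 2 * Real.sin x ^ 2 := by
  have := Real.sin_sq_add_cos_sq x
  linear_combination (Real.cos x ^ 2 + b ^ 2 * Real.sin x ^ 2) * this

theorem hasDerivAt_landenAngle {b : ℝ} (hb : b ∈ Set.Ioo (0 : ℝ) 1) (x : ℝ) :
    HasDerivAt (landenAngle b) ((1 + b) * (Real.cos x ^ 2 + b * Real.sin x ^ 2) /
      delta (compl b) x ^ 2) x := by
  have hc := cos_sq_add_mul_sin_sq_pos hb.1 x
  have hδ := delta_pos (moduli_of_mem_Ioo (compl_mem_Ioo hb)) x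
  have hn : HasDerivAt (fun x => (1 - b) * (Real.sin x * Real.cos x))
      ((1 - b) * (Real.cos x ^ 2 - Real.sin x ^ 2)) x := by
    refine (((Real.hasDerivAt_sin x).mul (Real.hasDerivAt_cos x)).const_mul _).congr_deriv ?_
    ring
  have hd : HasDerivAt (fun x => Real.cos x ^ 2 + b * Real.sin x ^ 2)
      (-(2 * (1 - b) * (Real.sin x * Real.cos x))) x := by
    refine (((Real.hasDerivAt_cos x).pow 2).add
      (((Real.hasDerivAt_sin x).pow 2).const_mul b)).congr_deriv ?_
    norm_num
    ring
  have h := ((hasDerivAt_id x).const_mul 2).sub (hn.div hd hc.ne').arctan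
  refine h.congr_deriv ?_
  have h1 := landen_sq (b := b) x
  have h2 := delta_compl_sq hb x
  rw [← h2] at h1
  have e : 1 + ((1 - b) * (Real.sin x * Real.cos x) / (Real.cos x ^ 2 + b * Real.sin x ^ 2)) ^ 2 =
      delta (compl b) x ^ 2 / (Real.cos x ^ 2 + b * Real.sin x ^ 2) ^ 2 := by
    rw [← h1]; field_simp
  simp only [Pi.div_apply]
  rw [e]
  field_simp
  rw [h2]
  have h3 := Real.sin_sq_add_cos_sq x
  have h4 : Real.sin x ^ 2 = 1 - Real.cos x ^ 2 := by rw [← h3]; ring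
  have h5 : Real.sin x ^ 4 = (1 - Real.cos x ^ 2) ^ 2 := by rw [← h4]; ring
  ring_nf
  rw [h5, h4]
  ring

/-- The transformed complementary modulus. -/
def landenMod (b : ℝ) : ℝ := (1 - b) / (1 + b)

theorem landenMod_mem {b : ℝ} (hb : b ∈ Set.Ioo (0 : ℝ) 1) : landenMod b ∈ Set.Ioo (0 : ℝ) 1 := by
  obtain ⟨h0, h1⟩ := hb
  have : 0 < 1 + b := by linarith
  refine ⟨div_pos (by linarith) this, ?_⟩
  rw [landenMod, div_lt_one this]
  linarith

/-- Combined with the derivative of the angle `φ`, this gives `dφ / Δ(φ) = (1 + b) dx / Δ(x)`, with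
modulus `(1 - b)/(1 + b)` on the left and `√(1 - b²)` on the right. -/
theorem delta_landenAngle {b : ℝ} (hb : b ∈ Set.Ioo (0 : ℝ) 1) (x : ℝ) :
    delta (landenMod b) (landenAngle b x) =
      (Real.cos x ^ 2 + b * Real.sin x ^ 2) / delta (compl b) x := by
  have hc := cos_sq_add_mul_sin_sq_pos hb.1 x
  have hδ := delta_pos (moduli_of_mem_Ioo (compl_mem_Ioo hb)) x
  have h1 := landen_sq (b := b) x
  have h2 := delta_compl_sq hb x
  rw [← h2] at h1
  have hb1 : 0 < 1 + b := by linarith [hb.1]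
  have e : √(1 + ((1 - b) * (Real.sin x * Real.cos x) /
      (Real.cos x ^ 2 + b * Real.sin x ^ 2)) ^ 2) =
      delta (compl b) x / (Real.cos x ^ 2 + b * Real.sin x ^ 2) := by
    rw [Real.sqrt_eq_iff_mul_self_eq (by positivity) (by positivity), ← sq, div_pow, div_pow (delta _ _), ← h1]
    field_simp
  have h3 := Real.sin_sq_add_cos_sq x
  have hsin : Real.sin (landenAngle b x) =
      (1 + b) * (Real.sin x * Real.cos x) / delta (compl b) x := by
    rw [landenAngle, Real.sin_sub, Real.cos_arctan, Real.sin_arctan, e, Real.sin_two_mul,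
      Real.cos_two_mul']
    set N := Real.cos x ^ 2 + b * Real.sin x ^ 2 with hN
    field_simp
    rw [hN]
    linear_combination (Real.sin x * Real.cos x * (1 + b)) * h3
  rw [delta, Real.sqrt_eq_iff_mul_self_eq, hsin, landenMod]
  · rw [div_pow, div_pow, ← sq, div_pow]
    field_simp
    rw [h2]
    linear_combination -(Real.cos x ^ 2 + b ^ 2 * Real.sin x ^ 2) * h3
  · exact (delta_arg_pos (moduli_of_mem_Ioo (landenMod_mem hb)) _).le
  · positivity

theorem landenAngle_zero (b : ℝ) : landenAngle b 0 = 0 := by simp [landenAngle]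

theorem landenAngle_pi_div_two (b : ℝ) : landenAngle b (Real.pi / 2) = Real.pi := by
  simp [landenAngle]
  ring

/-- Landen's transformation of the complete elliptic integral of the first kind. -/
theorem ellK_landen {b : ℝ} (hb : b ∈ Set.Ioo (0 : ℝ) 1) :
    2 * ellK (landenMod b) = (1 + b) * ellK (compl b) := by
  have hm := moduli_of_mem_Ioo (landenMod_mem hb)
  have hc := moduli_of_mem_Ioo (compl_mem_Ioo hb)
  have hcont : Continuous fun x => (1 + b) * (Real.cos x ^ 2 + b * Real.sin x ^ 2) /
      delta (compl b) x ^ 2 := by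
    refine Continuous.div (by fun_prop) ?_ fun x => pow_ne_zero 2 (delta_ne_zero hc x)
    have := continuous_delta_zpow hc 2
    exact_mod_cast this
  -- The angle maps `[0, π/2]` to `[0, π]`, two quarter periods: hence the factor `2` in front of
  -- `K`.
  have h := intervalIntegral.integral_comp_mul_deriv (a := 0) (b := Real.pi / 2)
    (g := fun t => delta (landenMod b) t ^ (-1 : ℤ))
    (fun x _ => hasDerivAt_landenAngle hb x) hcont.continuousOn (continuous_delta_zpow hm (-1))
  rw [landenAngle_zero, landenAngle_pi_div_two] at h
  rw [ellK_eq, ellK_eq, ← ellInc_pi hm, ellInc, ← h, ellInc,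
    ← intervalIntegral.integral_const_mul]
  refine intervalIntegral.integral_congr fun x _ => ?_
  have h1 := (cos_sq_add_mul_sin_sq_pos hb.1 x).ne'
  have h2 := delta_ne_zero hc x
  simp only [Function.comp, delta_landenAngle hb, zpow_neg_one]
  field_simp

/-! ### Theta functions: duplication formulas and inversion -/

/-- `∑ q^{n²}`. -/
def thetaThree (q : ℝ) : ℝ := ∑' n : ℤ, q ^ (n ^ 2)

/-- `∑ (-1)ⁿ q^{n²}`. -/
def thetaFour (q : ℝ) : ℝ := ∑' n : ℤ, (-1) ^ n * q ^ (n ^ 2)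

/-- `∑ q^{n(n+1)}`. -/
def thetaTwo (q : ℝ) : ℝ := ∑' n : ℤ, q ^ (n ^ 2 + n)

theorem summable_zpow_abs {q : ℝ} (hq : q ∈ Set.Ioo (0 : ℝ) 1) :
    Summable fun n : ℤ => q ^ |n| := by
  refine Summable.of_nat_of_neg ?_ ?_ <;>
  · simp only [abs_neg, Nat.abs_cast, zpow_natCast]
    exact summable_geometric_of_lt_one hq.1.le hq.2

theorem summable_zpow_of_le {q : ℝ} (hq : q ∈ Set.Ioo (0 : ℝ) 1) {e : ℤ → ℤ}
    (he : ∀ n, |n| - 1 ≤ e n) : Summable fun n : ℤ => q ^ e n := by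
  refine Summable.of_nonneg_of_le (fun n => (zpow_pos hq.1 _).le) (fun n => ?_)
    ((summable_zpow_abs hq).mul_left q⁻¹)
  rw [← zpow_neg_one, ← zpow_add₀ hq.1.ne']
  exact zpow_le_zpow_right_of_le_one₀ hq.1 hq.2.le (by linarith [he n])

theorem abs_sub_one_le_sq (n : ℤ) : |n| - 1 ≤ n ^ 2 := by
  rcases abs_cases n with h | h <;> nlinarith

theorem abs_sub_one_le_sq_add (n : ℤ) : |n| - 1 ≤ n ^ 2 + n := by
  rcases abs_cases n with h | h <;> nlinarith

theorem summable_thetaThree {q : ℝ} (hq : q ∈ Set.Ioo (0 : ℝ) 1) :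
    Summable fun n : ℤ => q ^ (n ^ 2) := summable_zpow_of_le hq abs_sub_one_le_sq

theorem summable_thetaTwo {q : ℝ} (hq : q ∈ Set.Ioo (0 : ℝ) 1) :
    Summable fun n : ℤ => q ^ (n ^ 2 + n) := summable_zpow_of_le hq abs_sub_one_le_sq_add

theorem abs_thetaFour_term {q : ℝ} (hq : q ∈ Set.Ioo (0 : ℝ) 1) (n : ℤ) :
    ‖(-1 : ℝ) ^ n * q ^ (n ^ 2)‖ = q ^ (n ^ 2) := by
  rw [norm_mul, norm_zpow, norm_neg, norm_one, one_zpow, one_mul, Real.norm_of_nonneg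
    (zpow_pos hq.1 _).le]

theorem summable_thetaFour {q : ℝ} (hq : q ∈ Set.Ioo (0 : ℝ) 1) :
    Summable fun n : ℤ => (-1 : ℝ) ^ n * q ^ (n ^ 2) :=
  Summable.of_norm ((summable_thetaThree hq).congr fun n => (abs_thetaFour_term hq n).symm)

/-- Splitting a sum over `ℤ × ℤ` according to the parity of the coordinate sum. -/
theorem hasSum_prod_parity {f : ℤ × ℤ → ℝ} {a b : ℝ}
    (ha : HasSum (fun p : ℤ × ℤ => f (p.1 + p.2, p.1 - p.2)) a)
    (hb : HasSum (fun p : ℤ × ℤ => f (p.1 + p.2 + 1, p.1 - p.2)) b) : HasSum f (a + b) := by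
  have i1 : Function.Injective fun p : ℤ × ℤ => (p.1 + p.2, p.1 - p.2) := by
    rintro ⟨a, b⟩ ⟨c, d⟩ h
    simp only [Prod.mk.injEq] at h ⊢
    omega
  have i2 : Function.Injective fun p : ℤ × ℤ => (p.1 + p.2 + 1, p.1 - p.2) := by
    rintro ⟨a, b⟩ ⟨c, d⟩ h
    simp only [Prod.mk.injEq] at h ⊢
    omega
  refine (i1.hasSum_range_iff.2 ha).add_isCompl ⟨?_, ?_⟩ (i2.hasSum_range_iff.2 hb)
  · rw [Set.disjoint_left]
    rintro _ ⟨⟨a, b⟩, rfl⟩ ⟨⟨c, d⟩, h⟩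
    simp only [Prod.mk.injEq] at h
    omega
  · rw [codisjoint_iff_le_sup]
    rintro ⟨m, n⟩ -
    rcases Int.even_or_odd' (m + n) with ⟨c, h | h⟩
    · exact Or.inl ⟨(c, m - c), by simp only [Prod.mk.injEq]; omega⟩
    · exact Or.inr ⟨(c, m - 1 - c), by simp only [Prod.mk.injEq]; omega⟩

theorem hasSum_mul {f g : ℤ → ℝ} (hf : Summable f) (hg : Summable g) :
    HasSum (fun p : ℤ × ℤ => f p.1 * g p.2) ((∑' n, f n) * ∑' n, g n) := by
  rw [tsum_mul_tsum_of_summable_norm hf.norm hg.norm]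
  exact (summable_mul_of_summable_norm hf.norm hg.norm).hasSum

theorem sq_mem_Ioo {q : ℝ} (hq : q ∈ Set.Ioo (0 : ℝ) 1) : q ^ 2 ∈ Set.Ioo (0 : ℝ) 1 :=
  ⟨pow_pos hq.1 2, pow_lt_one₀ hq.1.le hq.2 two_ne_zero⟩

theorem neg_one_zpow_add_self (n : ℤ) : (-1 : ℝ) ^ (n + n) = 1 := by
  rw [← two_mul, zpow_mul]; simp

/-- A pair with even sum is `(a + b, a - b)`, whose squares add up to `2(a² + b²)`; a pair with odd
sum is `(a + b + 1, a - b)`, giving `2(a² + a + b² + b) + 1`. -/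
theorem thetaThree_sq {q : ℝ} (hq : q ∈ Set.Ioo (0 : ℝ) 1) : thetaThree q ^ 2 =
    thetaThree (q ^ 2) ^ 2 + q * thetaTwo (q ^ 2) ^ 2 := by
  have h := hasSum_mul (summable_thetaThree hq) (summable_thetaThree hq)
  have h3 := summable_thetaThree (sq_mem_Ioo hq)
  have h2 := summable_thetaTwo (sq_mem_Ioo hq)
  have h' := hasSum_prod_parity (f := fun p : ℤ × ℤ => q ^ (p.1 ^ 2) * q ^ (p.2 ^ 2))
    (a := thetaThree (q ^ 2) ^ 2) (b := q * thetaTwo (q ^ 2) ^ 2)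
    (by
      rw [sq (thetaThree _)]
      refine (hasSum_mul h3 h3).congr_fun fun p => ?_
      simp only [← zpow_natCast q, ← zpow_mul, ← zpow_add₀ hq.1.ne']
      congr 1; push_cast; ring)
    (by
      rw [sq (thetaTwo _)]
      refine ((hasSum_mul h2 h2).mul_left q).congr_fun fun p => ?_
      simp only [← zpow_natCast q, ← zpow_mul, ← zpow_add₀ hq.1.ne', ← zpow_one_add₀ hq.1.ne']
      congr 1; push_cast; ring)
  exact (sq (thetaThree q)).trans (h'.unique h).symm

theorem neg_one_zpow_add_mul_sub (a b : ℤ) : (-1 : ℝ) ^ (a + b) * (-1) ^ (a - b) = 1 := by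
  rw [← zpow_add₀ (by norm_num), show a + b + (a - b) = a + a by ring, neg_one_zpow_add_self]

theorem neg_one_zpow_sub (a b : ℤ) : (-1 : ℝ) ^ (a - b) = (-1) ^ (a + b) := by
  rw [show a - b = a + b - (b + b) by ring, zpow_sub₀ (by norm_num), neg_one_zpow_add_self, div_one]

theorem neg_one_zpow_add_one (a : ℤ) : (-1 : ℝ) ^ (a + 1) = -(-1) ^ a := by
  rw [zpow_add_one₀ (by norm_num)]; ring

/-- The splitting is that of `thetaThree_sq`; the sign `(-1)^(m+n)` is `+1` on the even class and
`-1` on the odd class. -/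
theorem thetaFour_sq {q : ℝ} (hq : q ∈ Set.Ioo (0 : ℝ) 1) : thetaFour q ^ 2 =
    thetaThree (q ^ 2) ^ 2 - q * thetaTwo (q ^ 2) ^ 2 := by
  have h := hasSum_mul (summable_thetaFour hq) (summable_thetaFour hq)
  have h3 := summable_thetaThree (sq_mem_Ioo hq)
  have h2 := summable_thetaTwo (sq_mem_Ioo hq)
  have h' := hasSum_prod_parity
    (f := fun p : ℤ × ℤ => (-1) ^ p.1 * q ^ (p.1 ^ 2) * ((-1) ^ p.2 * q ^ (p.2 ^ 2)))
    (a := thetaThree (q ^ 2) ^ 2) (b := -(q * thetaTwo (q ^ 2) ^ 2))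
    (by
      rw [sq (thetaThree _)]
      refine (hasSum_mul h3 h3).congr_fun fun p => ?_
      rw [mul_mul_mul_comm, neg_one_zpow_add_mul_sub, one_mul]
      simp only [← zpow_natCast q, ← zpow_mul, ← zpow_add₀ hq.1.ne']
      congr 1; push_cast; ring)
    (by
      rw [sq (thetaTwo _)]
      refine (((hasSum_mul h2 h2).mul_left q).neg).congr_fun fun p => ?_
      rw [mul_mul_mul_comm, neg_one_zpow_add_one, neg_mul, neg_one_zpow_add_mul_sub, neg_mul,
        one_mul]
      simp only [← zpow_natCast q, ← zpow_mul, ← zpow_add₀ hq.1.ne', ← zpow_one_add₀ hq.1.ne']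
      congr 2; push_cast; ring)
  rw [sub_eq_add_neg]
  exact (sq (thetaFour q)).trans (h'.unique h).symm

/-- The product is symmetrised first: `(-1)^m + (-1)^n` vanishes when `m + n` is odd and is `2
(-1)^(a+b)` on `(a + b, a - b)`. -/
theorem thetaThree_mul_thetaFour {q : ℝ} (hq : q ∈ Set.Ioo (0 : ℝ) 1) :
    thetaThree q * thetaFour q = thetaFour (q ^ 2) ^ 2 := by
  have h := (hasSum_mul (summable_thetaThree hq) (summable_thetaFour hq)).add
    (hasSum_mul (summable_thetaFour hq) (summable_thetaThree hq))
  have h4 := summable_thetaFour (sq_mem_Ioo hq)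
  have h' := hasSum_prod_parity
    (f := fun p : ℤ × ℤ => q ^ (p.1 ^ 2) * ((-1) ^ p.2 * q ^ (p.2 ^ 2)) +
      (-1) ^ p.1 * q ^ (p.1 ^ 2) * q ^ (p.2 ^ 2))
    (a := 2 * thetaFour (q ^ 2) ^ 2) (b := 0)
    (by
      rw [sq (thetaFour _)]
      refine ((hasSum_mul h4 h4).mul_left 2).congr_fun fun p => ?_
      have e : q ^ ((p.1 + p.2) ^ 2) * q ^ ((p.1 - p.2) ^ 2) =
          (q ^ 2) ^ (p.1 ^ 2) * (q ^ 2) ^ (p.2 ^ 2) := by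
        simp only [← zpow_natCast q, ← zpow_mul, ← zpow_add₀ hq.1.ne']
        congr 1; push_cast; ring
      have e' : (-1 : ℝ) ^ (p.1 + p.2) = (-1) ^ p.1 * (-1) ^ p.2 := zpow_add₀ (by norm_num) _ _
      rw [neg_one_zpow_sub]
      linear_combination 2 * (-1) ^ (p.1 + p.2) * e +
        2 * (q ^ 2) ^ (p.1 ^ 2) * (q ^ 2) ^ (p.2 ^ 2) * e')
    (by
      refine hasSum_zero.congr_fun fun p => ?_
      rw [neg_one_zpow_add_one, neg_one_zpow_sub]
      ring)
  have := h'.unique h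
  change _ = thetaThree q * thetaFour q + thetaFour q * thetaThree q at this
  linarith

/-- The exponent becomes `2(a² + a) + 2b²` on the even class and `2(a + 1)² + 2(b² + b)` on the odd
class, so after a shift of `a` the two classes contribute equally. -/
theorem thetaTwo_sq {q : ℝ} (hq : q ∈ Set.Ioo (0 : ℝ) 1) :
    thetaTwo q ^ 2 = 2 * (thetaTwo (q ^ 2) * thetaThree (q ^ 2)) := by
  have h := hasSum_mul (summable_thetaTwo hq) (summable_thetaTwo hq)
  have h3 := summable_thetaThree (sq_mem_Ioo hq)
  have h2 := summable_thetaTwo (sq_mem_Ioo hq)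
  have h3' : Summable fun n : ℤ => (q ^ 2) ^ ((n + 1) ^ 2) :=
    (Equiv.addRight (1 : ℤ)).summable_iff (f := fun n : ℤ => (q ^ 2) ^ (n ^ 2)) |>.2 h3
  have e3 : ∑' n : ℤ, (q ^ 2) ^ ((n + 1) ^ 2) = thetaThree (q ^ 2) :=
    (Equiv.addRight (1 : ℤ)).tsum_eq fun n => (q ^ 2) ^ (n ^ 2)
  have h' := hasSum_prod_parity
    (f := fun p : ℤ × ℤ => q ^ (p.1 ^ 2 + p.1) * q ^ (p.2 ^ 2 + p.2))
    (a := thetaTwo (q ^ 2) * thetaThree (q ^ 2)) (b := thetaThree (q ^ 2) * thetaTwo (q ^ 2))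
    (by
      refine (hasSum_mul h2 h3).congr_fun fun p => ?_
      simp only [← zpow_natCast q, ← zpow_mul, ← zpow_add₀ hq.1.ne']
      congr 1; push_cast; ring)
    (by
      rw [← e3]
      refine (hasSum_mul h3' h2).congr_fun fun p => ?_
      simp only [← zpow_natCast q, ← zpow_mul, ← zpow_add₀ hq.1.ne']
      congr 1; push_cast; ring)
  rw [sq, two_mul]
  exact (h'.unique h).symm.trans (by rw [mul_comm (thetaThree (q ^ 2))])

/-- With `A = θ₃(q²)²` and `B = q θ₂(q²)²` this is `(A + B)² - (A - B)² = 4AB`. It makes `thetaMod`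
and `thetaCompl` complementary moduli. -/
theorem thetaThree_pow_four {q : ℝ} (hq : q ∈ Set.Ioo (0 : ℝ) 1) :
    thetaThree q ^ 4 = thetaFour q ^ 4 + q * thetaTwo q ^ 4 := by
  have h1 := thetaThree_sq hq
  have h2 := thetaFour_sq hq
  have h3 := thetaTwo_sq hq
  rw [show thetaThree q ^ 4 = (thetaThree q ^ 2) ^ 2 by ring,
    show thetaFour q ^ 4 = (thetaFour q ^ 2) ^ 2 by ring,
    show thetaTwo q ^ 4 = (thetaTwo q ^ 2) ^ 2 by ring, h1, h2, h3]
  ring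

theorem one_le_thetaThree {q : ℝ} (hq : q ∈ Set.Ioo (0 : ℝ) 1) : 1 ≤ thetaThree q := by
  have := (summable_thetaThree hq).le_tsum 0 fun n _ => (zpow_pos hq.1 _).le
  simpa [thetaThree] using this

theorem one_le_thetaTwo {q : ℝ} (hq : q ∈ Set.Ioo (0 : ℝ) 1) : 1 ≤ thetaTwo q := by
  have := (summable_thetaTwo hq).le_tsum 0 fun n _ => (zpow_pos hq.1 _).le
  simpa [thetaTwo] using this

theorem exp_zpow (t : ℝ) (m : ℤ) :
    Real.exp (-Real.pi * t) ^ m = Real.exp (-Real.pi * t * m) := by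
  rw [mul_comm _ (m : ℝ), ← Real.rpow_intCast, ← Real.exp_mul, mul_comm]

theorem exp_neg_pi_mem {t : ℝ} (ht : 0 < t) : Real.exp (-Real.pi * t) ∈ Set.Ioo (0 : ℝ) 1 :=
  ⟨Real.exp_pos _, Real.exp_lt_one_iff.2 (by nlinarith [Real.pi_pos])⟩

theorem thetaThree_inversion {t : ℝ} (ht : 0 < t) :
    √t * thetaThree (Real.exp (-Real.pi * t)) = thetaThree (Real.exp (-Real.pi * t⁻¹)) := by
  have h := Real.tsum_exp_neg_mul_int_sq ht
  rw [← Real.sqrt_eq_rpow] at h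
  have h0 := (Real.sqrt_pos.2 ht).ne'
  unfold thetaThree
  simp only [exp_zpow]
  push_cast
  rw [h]
  simp only [div_eq_mul_inv]
  field_simp

theorem thetaTwo_inversion {t : ℝ} (ht : 0 < t) :
    √t * thetaTwo (Real.exp (-Real.pi * t)) =
      Real.exp (Real.pi * t / 4) * thetaFour (Real.exp (-Real.pi * t⁻¹)) := by
  -- The linear parameter `-t/2` produces the exponent `n² + n`. In the Poisson dual it is an
  -- imaginary shift, whose square gives `exp (πt/4)` and whose cross term gives `(-1)^n`.
  have h := Complex.tsum_exp_neg_quadratic (a := t) (by simpa using ht) (-t / 2)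
  have hc : (t : ℂ) ^ (1 / 2 : ℂ) = (√t : ℝ) := by
    rw [Real.sqrt_eq_rpow, Complex.ofReal_cpow ht.le]; norm_num
  have h0 := (Real.sqrt_pos.2 ht).ne'
  have h0' : ((√t : ℝ) : ℂ) ≠ 0 := by exact_mod_cast h0
  have ht' : (t : ℂ) ≠ 0 := by exact_mod_cast ht.ne'
  rw [hc] at h
  have e1 : ∀ n : ℤ, Complex.exp (-Real.pi * t * (n : ℂ) ^ 2 + 2 * Real.pi * (-t / 2) * n) =
      ((Real.exp (-Real.pi * t) ^ (n ^ 2 + n) : ℝ) : ℂ) := by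
    intro n
    rw [exp_zpow]
    push_cast
    congr 1
    ring
  have e2 : ∀ n : ℤ, Complex.exp (-Real.pi / t * ((n : ℂ) + Complex.I * (-t / 2)) ^ 2) =
      ((Real.exp (Real.pi * t / 4) * ((-1) ^ n * Real.exp (-Real.pi * t⁻¹) ^ (n ^ 2)) : ℝ) : ℂ) := by
    intro n
    rw [exp_zpow]
    push_cast
    rw [← Complex.exp_pi_mul_I, ← Complex.exp_int_mul, ← Complex.exp_add, ← Complex.exp_add]
    congr 1
    field_simp
    linear_combination -4 * (t : ℂ) ^ 2 * Complex.I_sq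
  simp only [e1, e2, ← Complex.ofReal_tsum] at h
  have h' : thetaTwo (Real.exp (-Real.pi * t)) = 1 / √t *
      (Real.exp (Real.pi * t / 4) * thetaFour (Real.exp (-Real.pi * t⁻¹))) := by
    rw [thetaFour, ← tsum_mul_left]
    exact_mod_cast h
  rw [h']
  field_simp

theorem exists_exp_neg_pi {q : ℝ} (hq : q ∈ Set.Ioo (0 : ℝ) 1) :
    ∃ t, 0 < t ∧ q = Real.exp (-Real.pi * t) := by
  refine ⟨-Real.log q / Real.pi, div_pos (neg_pos.2 (Real.log_neg hq.1 hq.2)) Real.pi_pos, ?_⟩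
  have := Real.pi_ne_zero
  rw [show -Real.pi * (-Real.log q / Real.pi) = Real.log q by field_simp, Real.exp_log hq.1]

/-- Positivity is not visible on the alternating series; inversion relates it to `thetaTwo` at the
dual nome, a series with positive terms. -/
theorem thetaFour_pos {q : ℝ} (hq : q ∈ Set.Ioo (0 : ℝ) 1) : 0 < thetaFour q := by
  obtain ⟨t, ht, rfl⟩ := exists_exp_neg_pi hq
  have h := thetaTwo_inversion (inv_pos.2 ht)
  rw [inv_inv] at h
  have h1 : 0 < √t⁻¹ * thetaTwo (Real.exp (-Real.pi * t⁻¹)) :=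
    mul_pos (Real.sqrt_pos.2 (inv_pos.2 ht))
      (one_pos.trans_le (one_le_thetaTwo (exp_neg_pi_mem (inv_pos.2 ht))))
  rw [h] at h1
  exact pos_of_mul_pos_right h1 (Real.exp_pos _).le

/-! ### The modulus and `K` as theta quotients -/

/-- The modulus `θ₂²/θ₃²`. -/
def thetaMod (q : ℝ) : ℝ := √q * thetaTwo q ^ 2 / thetaThree q ^ 2

/-- The complementary modulus `θ₄²/θ₃²`. -/
def thetaCompl (q : ℝ) : ℝ := thetaFour q ^ 2 / thetaThree q ^ 2

theorem thetaMod_sq_add {q : ℝ} (hq : q ∈ Set.Ioo (0 : ℝ) 1) :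
    thetaMod q ^ 2 + thetaCompl q ^ 2 = 1 := by
  have h := thetaThree_pow_four hq
  have h3 := (one_pos.trans_le (one_le_thetaThree hq)).ne'
  rw [thetaMod, thetaCompl, div_pow, div_pow, mul_pow, Real.sq_sqrt hq.1.le]
  field_simp
  linarith

theorem thetaMod_pos {q : ℝ} (hq : q ∈ Set.Ioo (0 : ℝ) 1) : 0 < thetaMod q := by
  have h2 := one_pos.trans_le (one_le_thetaTwo hq)
  have h3 := one_pos.trans_le (one_le_thetaThree hq)
  have := Real.sqrt_pos.2 hq.1
  unfold thetaMod
  positivity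

theorem thetaCompl_pos {q : ℝ} (hq : q ∈ Set.Ioo (0 : ℝ) 1) : 0 < thetaCompl q := by
  have h2 := thetaFour_pos hq
  have h3 := one_pos.trans_le (one_le_thetaThree hq)
  unfold thetaCompl
  positivity

theorem thetaMod_mem {q : ℝ} (hq : q ∈ Set.Ioo (0 : ℝ) 1) : thetaMod q ∈ Set.Ioo (0 : ℝ) 1 :=
  ⟨thetaMod_pos hq, by nlinarith [thetaMod_sq_add hq, thetaCompl_pos hq, thetaMod_pos hq]⟩

theorem thetaCompl_mem {q : ℝ} (hq : q ∈ Set.Ioo (0 : ℝ) 1) :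
    thetaCompl q ∈ Set.Ioo (0 : ℝ) 1 :=
  ⟨thetaCompl_pos hq, by nlinarith [thetaMod_sq_add hq, thetaCompl_pos hq, thetaMod_pos hq]⟩

theorem compl_thetaMod {q : ℝ} (hq : q ∈ Set.Ioo (0 : ℝ) 1) :
    compl (thetaMod q) = thetaCompl q := by
  rw [compl, show 1 - thetaMod q ^ 2 = thetaCompl q ^ 2 by linarith [thetaMod_sq_add hq],
    Real.sqrt_sq (thetaCompl_pos hq).le]

theorem compl_thetaCompl {q : ℝ} (hq : q ∈ Set.Ioo (0 : ℝ) 1) :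
    compl (thetaCompl q) = thetaMod q := by
  rw [compl, show 1 - thetaCompl q ^ 2 = thetaMod q ^ 2 by linarith [thetaMod_sq_add hq],
    Real.sqrt_sq (thetaMod_pos hq).le]

theorem landenMod_thetaCompl {q : ℝ} (hq : q ∈ Set.Ioo (0 : ℝ) 1) :
    landenMod (thetaCompl q) = thetaMod (q ^ 2) := by
  have h1 := thetaThree_sq hq
  have h2 := thetaFour_sq hq
  have h3 := (one_pos.trans_le (one_le_thetaThree hq)).ne'
  have h4 := (one_pos.trans_le (one_le_thetaThree (sq_mem_Ioo hq))).ne'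
  rw [landenMod, thetaCompl, thetaMod, Real.sqrt_sq hq.1.le, one_sub_div (pow_ne_zero 2 h3),
    one_add_div (pow_ne_zero 2 h3), div_div_div_cancel_right₀ (pow_ne_zero 2 h3), h1, h2]
  field_simp
  ring

/-- Landen's transformation with `b = θ₄²/θ₃²` is `q ↦ q²`, and the factor `(1 + b)/2` is the
quotient of the values of `θ₃²`. -/
theorem ellK_thetaMod_sq {q : ℝ} (hq : q ∈ Set.Ioo (0 : ℝ) 1) :
    ellK (thetaMod (q ^ 2)) / thetaThree (q ^ 2) ^ 2 = ellK (thetaMod q) / thetaThree q ^ 2 := by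
  have h := ellK_landen (thetaCompl_mem hq)
  rw [landenMod_thetaCompl hq, compl_thetaCompl hq] at h
  have h3 := (one_pos.trans_le (one_le_thetaThree hq)).ne'
  have h4 := (one_pos.trans_le (one_le_thetaThree (sq_mem_Ioo hq))).ne'
  have h5 : (1 + thetaCompl q) * thetaThree q ^ 2 = 2 * thetaThree (q ^ 2) ^ 2 := by
    rw [thetaCompl, one_add_div (pow_ne_zero 2 h3), div_mul_cancel₀ _ (pow_ne_zero 2 h3)]
    linarith [thetaThree_sq hq, thetaFour_sq hq]
  rw [div_eq_div_iff (pow_ne_zero 2 h4) (pow_ne_zero 2 h3)]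
  linear_combination (thetaThree q ^ 2 / 2) * h + ellK (thetaMod q) / 2 * h5

theorem tendsto_tsum_zpow_zero {e : ℤ → ℤ} {q : ℝ} (hq : q ∈ Set.Ioo (0 : ℝ) 1)
    (hs : Summable fun n : ℤ => q ^ e n) (he : ∀ n, 0 ≤ e n) :
    Tendsto (fun x : ℝ => ∑' n : ℤ, x ^ e n) (𝓝[>] 0)
      (𝓝 (∑' n : ℤ, if e n = 0 then 1 else 0)) := by
  refine tendsto_tsum_of_dominated_convergence hs (fun n => ?_) ?_
  · split_ifs with h
    · simp [h]
    · obtain ⟨m, hm⟩ := Int.eq_ofNat_of_zero_le (he n)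
      have hm0 : m ≠ 0 := by rintro rfl; exact h (by simpa using hm)
      simp only [hm, zpow_natCast]
      have := (continuous_pow (M := ℝ) m).tendsto 0
      rw [zero_pow hm0] at this
      exact this.mono_left nhdsWithin_le_nhds
  · filter_upwards [Ioo_mem_nhdsGT hq.1] with x hx n
    rw [Real.norm_of_nonneg (zpow_pos hx.1 _).le]
    exact zpow_le_zpow_left₀ (he n) hx.1.le hx.2.le

theorem tendsto_thetaThree : Tendsto thetaThree (𝓝[>] 0) (𝓝 1) := by
  have hq : (1 / 2 : ℝ) ∈ Set.Ioo (0 : ℝ) 1 := by norm_num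
  have h := tendsto_tsum_zpow_zero hq (summable_thetaThree hq) fun n => sq_nonneg n
  have e : (∑' n : ℤ, if n ^ 2 = 0 then (1 : ℝ) else 0) = 1 := by
    rw [tsum_eq_single 0 fun n hn => if_neg (pow_ne_zero 2 hn)]
    simp
  rw [e] at h
  exact h

theorem tendsto_thetaMod : Tendsto thetaMod (𝓝[>] 0) (𝓝 0) := by
  have hq : (1 / 2 : ℝ) ∈ Set.Ioo (0 : ℝ) 1 := by norm_num
  have h2 := tendsto_tsum_zpow_zero hq (summable_thetaTwo hq) fun n => by
    rcases le_or_gt 0 n with h | h <;> nlinarith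
  have hs : Tendsto (fun q : ℝ => √q) (𝓝[>] 0) (𝓝 0) := by
    have := Real.continuous_sqrt.tendsto 0
    rw [Real.sqrt_zero] at this
    exact this.mono_left nhdsWithin_le_nhds
  have := (hs.mul (h2.pow 2)).div (tendsto_thetaThree.pow 2) (by norm_num)
  rw [zero_mul, zero_div] at this
  exact this

/-- `K = (π / 2) θ₃²`. -/
theorem ellK_thetaMod {q : ℝ} (hq : q ∈ Set.Ioo (0 : ℝ) 1) :
    ellK (thetaMod q) = Real.pi / 2 * thetaThree q ^ 2 := by
  have hmem : ∀ n : ℕ, q ^ 2 ^ n ∈ Set.Ioo (0 : ℝ) 1 := fun n =>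
    ⟨pow_pos hq.1 _, pow_lt_one₀ hq.1.le hq.2 (by positivity)⟩
  have hconst : ∀ n : ℕ, ellK (thetaMod (q ^ 2 ^ n)) / thetaThree (q ^ 2 ^ n) ^ 2 =
      ellK (thetaMod q) / thetaThree q ^ 2 := by
    intro n
    induction n with
    | zero => simp
    | succ n ih => rw [pow_succ, pow_mul, ellK_thetaMod_sq (hmem n), ih]
  -- `K / θ₃²` is invariant under squaring the nome, and iterated squaring drives the nome to `0`,
  -- where the modulus tends to `0` and the quotient to `π / 2`.
  have hlim : Tendsto (fun n : ℕ => q ^ 2 ^ n) atTop (𝓝[>] 0) := by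
    refine tendsto_nhdsWithin_iff.2 ⟨?_, Eventually.of_forall fun n => (hmem n).1⟩
    exact (tendsto_pow_atTop_nhds_zero_of_lt_one hq.1.le hq.2).comp
      (tendsto_pow_atTop_atTop_of_one_lt one_lt_two)
  have hK : Tendsto ellK (𝓝 0) (𝓝 (Real.pi / 2)) := by
    rw [← ellK_zero]
    exact continuousOn_ellK.continuousAt (isOpen_moduli.mem_nhds (mem_moduli le_rfl one_pos))
  have h := ((hK.comp tendsto_thetaMod).div (tendsto_thetaThree.pow 2) (by norm_num)).comp hlim
  have h' := h.congr hconst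
  have := tendsto_nhds_unique tendsto_const_nhds h'
  have h3 := (one_pos.trans_le (one_le_thetaThree hq)).ne'
  rw [div_eq_iff (pow_ne_zero 2 h3)] at this
  simpa using this

theorem thetaMod_inversion {t : ℝ} (ht : 0 < t) :
    thetaMod (Real.exp (-Real.pi * t)) = thetaCompl (Real.exp (-Real.pi * t⁻¹)) := by
  have h2 := thetaTwo_inversion ht
  have h3 := thetaThree_inversion ht
  have h30 := (one_pos.trans_le (one_le_thetaThree (exp_neg_pi_mem ht))).ne'
  have hs := (Real.sqrt_pos.2 ht).ne'
  have he : √(Real.exp (-Real.pi * t)) * Real.exp (Real.pi * t / 4) ^ 2 = 1 := by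
    rw [← Real.exp_half, ← Real.exp_nat_mul, ← Real.exp_add, ← Real.exp_zero]
    congr 1
    push_cast
    ring
  have h4 : thetaFour (Real.exp (-Real.pi * t⁻¹)) =
      √t * thetaTwo (Real.exp (-Real.pi * t)) / Real.exp (Real.pi * t / 4) := by
    rw [h2]; field_simp
  rw [thetaMod, thetaCompl, ← h3, h4]
  generalize Real.exp (-Real.pi * t) = q at *
  field_simp
  linear_combination (thetaTwo q ^ 2) * he

/-- Replacing `t` by `t⁻¹` exchanges the modulus and its complement, so `K'/K` is the quotient of
`θ₃²` at the nomes for `t⁻¹` and `t`, which inversion evaluates. -/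
theorem ellK_compl_thetaMod {t : ℝ} (ht : 0 < t) :
    ellK (compl (thetaMod (Real.exp (-Real.pi * t)))) / ellK (thetaMod (Real.exp (-Real.pi * t))) =
      t := by
  have hq := exp_neg_pi_mem ht
  have hq' := exp_neg_pi_mem (inv_pos.2 ht)
  have h := thetaMod_inversion (inv_pos.2 ht)
  rw [inv_inv] at h
  have h30 := (one_pos.trans_le (one_le_thetaThree hq)).ne'
  rw [compl_thetaMod hq, ← h, ellK_thetaMod hq, ellK_thetaMod hq', ← thetaThree_inversion ht,
    mul_pow, Real.sq_sqrt ht.le]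
  generalize Real.exp (-Real.pi * t) = q at *
  have := Real.pi_ne_zero
  field_simp

/-- The modulus is recovered from its nome by theta functions. -/
theorem thetaMod_nome {k : ℝ} (hk : k ∈ Set.Ioo (0 : ℝ) 1) : thetaMod (nome k) = k := by
  have ht : 0 < ellK (compl k) / ellK k := div_pos (ellK_pos (moduli_of_mem_Ioo (compl_mem_Ioo hk)))
    (ellK_pos (moduli_of_mem_Ioo hk))
  -- Both moduli have the same period ratio, and the ratio is injective on `(0, 1)`.
  refine ellK_div_injOn (thetaMod_mem (nome_mem_Ioo hk)) hk ?_
  rw [nome_eq hk.1.ne']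
  exact ellK_compl_thetaMod ht

/-! ### Gaussian binomials and the finite triple product -/

/-- The Gaussian binomial coefficients. -/
def qBinom (x : ℝ) : ℕ → ℕ → ℝ
  | _, 0 => 1
  | 0, _ + 1 => 0
  | n + 1, m + 1 => qBinom x n m + x ^ (m + 1) * qBinom x n (m + 1)

/-- The finite Euler product `∏_{i ≤ n} (1 - xⁱ)`. -/
def eulerProd (x : ℝ) (n : ℕ) : ℝ := ∏ i ∈ Finset.range n, (1 - x ^ (i + 1))

theorem qBinom_zero_right (x : ℝ) (n : ℕ) : qBinom x n 0 = 1 := by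
  cases n <;> rfl

theorem qBinom_eq_zero (x : ℝ) {n m : ℕ} (h : n < m) : qBinom x n m = 0 := by
  induction n generalizing m with
  | zero =>
    obtain ⟨m, rfl⟩ := Nat.exists_eq_succ_of_ne_zero h.ne'
    rfl
  | succ n ih =>
    obtain ⟨m, rfl⟩ := Nat.exists_eq_succ_of_ne_zero (Nat.ne_zero_of_lt h)
    rw [Nat.succ_eq_add_one, qBinom, ih (by omega), ih (by omega)]
    ring

/-- A division-free factorial formula for the Gaussian binomial. The induction is Pascal's rule
together with `1 - x^(a+b) = (1 - x^a) + x^a (1 - x^b)`. -/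
theorem qBinom_mul_eulerProd (x : ℝ) (m r : ℕ) :
    qBinom x (m + r) m * (eulerProd x m * eulerProd x r) = eulerProd x (m + r) := by
  induction h : m + r generalizing m r with
  | zero =>
    obtain ⟨rfl, rfl⟩ : m = 0 ∧ r = 0 := by omega
    simp [eulerProd, qBinom_zero_right]
  | succ n ih =>
    cases m with
    | zero =>
      obtain rfl : r = n + 1 := by omega
      simp [qBinom_zero_right, eulerProd]
    | succ m =>
      have h1 := ih m r (by omega)
      cases r with
      | zero =>
        obtain rfl : m = n := by omega
        rw [qBinom, qBinom_eq_zero x (Nat.lt_succ_self m)]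
        have : qBinom x m m * eulerProd x m = eulerProd x m := by simpa [eulerProd] using h1
        simp only [eulerProd, Finset.prod_range_succ, Finset.prod_range_zero] at this ⊢
        linear_combination (1 - x ^ (m + 1)) * this
      | succ r =>
        have h2 := ih (m + 1) r (by omega)
        obtain rfl : n = m + 1 + r := by omega
        rw [qBinom]
        simp only [eulerProd, Finset.prod_range_succ _ m, Finset.prod_range_succ _ r,
          Finset.prod_range_succ _ (m + 1 + r)] at h1 h2 ⊢
        linear_combination (1 - x ^ (m + 1)) * h1 + x ^ (m + 1) * (1 - x ^ (r + 1)) * h2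

/-- Cauchy's binomial theorem. -/
theorem prod_one_add_mul_pow (x w : ℝ) (n : ℕ) :
    ∏ i ∈ Finset.range n, (1 + w * x ^ i) =
      ∑ m ∈ Finset.range (n + 1), x ^ (m.choose 2) * qBinom x n m * w ^ m := by
  induction n generalizing w with
  | zero => simp [qBinom_zero_right]
  | succ n ih =>
    -- The factor with index `0` is split off; the remaining factors are the induction hypothesis at
    -- `w * x`.
    have h : ∏ i ∈ Finset.range n, (1 + w * x ^ (i + 1)) =
        ∑ m ∈ Finset.range (n + 1), x ^ (m.choose 2) * qBinom x n m * (w * x) ^ m := by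
      rw [← ih]
      exact Finset.prod_congr rfl fun i _ => by ring
    rw [Finset.prod_range_succ', h, pow_zero, mul_one, mul_add, mul_one, Finset.sum_range_succ' _
      (n + 1)]
    have h2 : ∑ m ∈ Finset.range (n + 1), x ^ (m.choose 2) * qBinom x n m * (w * x) ^ m =
        ∑ m ∈ Finset.range (n + 1), x ^ ((m + 1).choose 2) * qBinom x n (m + 1) *
          (w * x) ^ (m + 1) + 1 := by
      rw [Finset.sum_range_succ', Finset.sum_range_succ _ n, qBinom_eq_zero x (Nat.lt_succ_self n)]
      simp [qBinom_zero_right]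
    nth_rw 1 [h2]
    rw [Finset.sum_mul, add_right_comm, ← Finset.sum_add_distrib]
    congr 1
    · refine Finset.sum_congr rfl fun m _ => ?_
      have e : (m + 1).choose 2 = m + m.choose 2 := by
        rw [Nat.choose_succ_succ' m 1, Nat.choose_one_right]
      rw [qBinom, e]
      ring
    · simp [qBinom_zero_right]

/-- The finite form of Jacobi's triple product. -/
theorem finite_triple_product {q z : ℝ} (hq : q ≠ 0) (hz : z ≠ 0) (n : ℕ) :
    ∏ i ∈ Finset.range n, ((1 + z * q ^ (2 * i + 1)) * (1 + z⁻¹ * q ^ (2 * i + 1))) =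
      ∑ m ∈ Finset.range (2 * n + 1), qBinom (q ^ 2) (2 * n) m *
        (q ^ (((m : ℤ) - n) ^ 2) * z ^ ((m : ℤ) - n)) := by
  -- With `w = z q^(1-2n)` the `2n` factors carry the odd exponents from `1 - 2n` to `2n - 1`. The
  -- upper half gives the factors in `z`; the lower half, reversed and cleared of `z q^(-(2i+1))`,
  -- gives those in `z⁻¹`.
  have h := prod_one_add_mul_pow (q ^ 2) (z * q ^ (1 - 2 * n : ℤ)) (2 * n)
  have h1 : ∏ i ∈ Finset.range n, (1 + z * q ^ (1 - 2 * n : ℤ) * (q ^ 2) ^ i) =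
      z ^ n * q ^ (-(n : ℤ) ^ 2) * ∏ i ∈ Finset.range n, (1 + z⁻¹ * q ^ (2 * i + 1)) := by
    have e : ∀ i ∈ Finset.range n, 1 + z * q ^ (1 - 2 * n : ℤ) * (q ^ 2) ^ (n - 1 - i) =
        z * q ^ (-(2 * i + 1 : ℤ)) * (1 + z⁻¹ * q ^ (2 * i + 1)) := by
      intro i hi
      have hi' := Finset.mem_range.1 hi
      have e1 : q ^ (1 - 2 * n : ℤ) * (q ^ 2) ^ (n - 1 - i) = q ^ (-(2 * i + 1 : ℤ)) := by
        rw [← zpow_natCast, ← zpow_natCast, ← zpow_mul, ← zpow_add₀ hq]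
        congr 1
        push_cast [Nat.sub_sub, Nat.cast_sub (show 1 + i ≤ n by omega)]
        ring
      have e2 : q ^ (-(2 * i + 1 : ℤ)) * q ^ (2 * i + 1) = 1 := by
        rw [zpow_neg, ← zpow_natCast]
        push_cast
        exact inv_mul_cancel₀ (zpow_ne_zero _ hq)
      rw [mul_assoc, e1]
      have e3 := mul_inv_cancel₀ hz
      linear_combination (-z * z⁻¹) * e2 - e3
    have e0 : ∏ i ∈ Finset.range n, (z * q ^ (-(2 * i + 1 : ℤ))) =
        z ^ n * q ^ (-(n : ℤ) ^ 2) := by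
      clear e h
      induction n with
      | zero => simp
      | succ n ih =>
        rw [Finset.prod_range_succ, ih, pow_succ, mul_mul_mul_comm, ← zpow_add₀ hq]
        congr 2
        push_cast
        ring
    rw [← Finset.prod_range_reflect, Finset.prod_congr rfl e, Finset.prod_mul_distrib, e0]
  have h2 : ∏ i ∈ Finset.range n, (1 + z * q ^ (1 - 2 * n : ℤ) * (q ^ 2) ^ (n + i)) =
      ∏ i ∈ Finset.range n, (1 + z * q ^ (2 * i + 1)) := by
    refine Finset.prod_congr rfl fun i _ => ?_
    rw [mul_assoc, ← pow_mul, ← zpow_natCast, ← zpow_natCast, ← zpow_add₀ hq]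
    congr 3
    push_cast
    ring
  rw [show 2 * n = n + n by ring, Finset.prod_range_add, ← show 2 * n = n + n by ring, h1, h2] at h
  have h3 : z ^ n * q ^ (-(n : ℤ) ^ 2) ≠ 0 := mul_ne_zero (pow_ne_zero _ hz) (zpow_ne_zero _ hq)
  refine mul_left_cancel₀ h3 ?_
  rw [Finset.prod_mul_distrib, mul_comm (∏ i ∈ Finset.range n, (1 + z * q ^ (2 * i + 1))),
    ← mul_assoc, h, Finset.mul_sum]
  refine Finset.sum_congr rfl fun m _ => ?_
  have e : ((m.choose 2 : ℕ) : ℤ) * 2 = m * (m - 1) := by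
    rcases m with _ | m
    · simp
    · rw [Nat.choose_two_right]
      have h4 := Nat.div_mul_cancel (Nat.even_mul_pred_self (m + 1)).two_dvd
      have : (((m + 1) * (m + 1 - 1) / 2 * 2 : ℕ) : ℤ) = ((m + 1) * (m + 1 - 1) : ℕ) := by
        rw [h4]
      push_cast at this ⊢
      simpa using this
  have e1 : (q ^ 2) ^ m.choose 2 * (q ^ (1 - 2 * n : ℤ)) ^ m =
      q ^ (-(n : ℤ) ^ 2) * q ^ (((m : ℤ) - n) ^ 2) := by
    rw [← zpow_natCast, ← zpow_natCast, ← zpow_natCast, ← zpow_mul, ← zpow_mul, ← zpow_add₀ hq,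
      ← zpow_add₀ hq]
    congr 1
    push_cast
    linear_combination e
  have e2 : z ^ m = z ^ n * z ^ ((m : ℤ) - n) := by
    rw [← zpow_natCast, ← zpow_natCast, ← zpow_add₀ hz]
    congr 1
    ring
  rw [mul_pow, e2]
  linear_combination (qBinom (q ^ 2) (2 * n) m * z ^ n * z ^ ((m : ℤ) - n)) * e1

/-! ### Euler products, Lambert series and the triple product -/

/-- The logarithm of Euler's product `∏ (1 - xⁱ)`. -/
def eulerLog (x : ℝ) : ℝ := ∑' m : ℕ, -(x ^ (m + 1) / (1 - x ^ (m + 1)) / (m + 1))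

/-- The Lambert series `∑ xᵐ / (1 - xᵐ)²`. -/
def lambertSq (x : ℝ) : ℝ := ∑' m : ℕ, x ^ (m + 1) / (1 - x ^ (m + 1)) ^ 2

theorem one_sub_le_one_sub_pow {x : ℝ} (hx : x ∈ Set.Ioo (0 : ℝ) 1) (m : ℕ) :
    1 - x ≤ 1 - x ^ (m + 1) := by
  have : x ^ (m + 1) ≤ x := pow_le_of_le_one hx.1.le hx.2.le (Nat.succ_ne_zero m)
  linarith

theorem one_sub_pow_pos {x : ℝ} (hx : x ∈ Set.Ioo (0 : ℝ) 1) (m : ℕ) : 0 < 1 - x ^ (m + 1) :=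
  (sub_pos.2 hx.2).trans_le (one_sub_le_one_sub_pow hx m)

/-- Expanding each logarithm gives an absolutely convergent double series in `x^((i+1)(m+1)) /
(m+1)`; summing over `i` first yields `eulerLog`. This order of summation is the one whose termwise
derivative is the Lambert series. -/
theorem hasSum_double_log {x : ℝ} (hx : x ∈ Set.Ioo (0 : ℝ) 1) :
    HasSum (fun i : ℕ => Real.log (1 - x ^ (i + 1))) (eulerLog x) := by
  let f : ℕ × ℕ → ℝ := fun p => x ^ ((p.1 + 1) * (p.2 + 1)) / (p.2 + 1)
  have hg : Summable fun n : ℕ => x ^ n := summable_geometric_of_lt_one hx.1.le hx.2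
  have hs : Summable f := by
    have hb := (hg.mul_of_nonneg hg (fun n => (pow_pos hx.1 n).le)
      fun n => (pow_pos hx.1 n).le).mul_left x
    refine Summable.of_nonneg_of_le (fun p => by have := hx.1; positivity) (fun p => ?_) hb
    have h1 : x ^ ((p.1 + 1) * (p.2 + 1)) ≤ x * (x ^ p.1 * x ^ p.2) := by
      rw [← pow_add, ← pow_succ']
      exact pow_le_pow_of_le_one hx.1.le hx.2.le (by nlinarith)
    refine (div_le_self (pow_pos hx.1 _).le ?_).trans h1
    linarith [p.2.cast_nonneg (α := ℝ)]
  have hrow : ∀ i : ℕ, HasSum (fun m => f (i, m)) (-Real.log (1 - x ^ (i + 1))) := fun i => by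
    have h1 : |x ^ (i + 1)| < 1 := by
      rw [abs_of_pos (pow_pos hx.1 _)]
      exact pow_lt_one₀ hx.1.le hx.2 (Nat.succ_ne_zero i)
    have := Real.hasSum_pow_div_log_of_abs_lt_one h1
    simpa only [← pow_mul] using this
  have hcol : ∀ m : ℕ, HasSum (fun i => f (i, m)) (x ^ (m + 1) / (1 - x ^ (m + 1)) / (m + 1)) := by
    intro m
    have h1 := hasSum_geometric_of_lt_one (pow_pos hx.1 (m + 1)).le
      (pow_lt_one₀ hx.1.le hx.2 (Nat.succ_ne_zero m))
    have h2 := (h1.mul_left (x ^ (m + 1))).div_const (m + 1 : ℝ)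
    rw [← div_eq_mul_inv] at h2
    refine h2.congr_fun fun i => ?_
    simp only [f]
    rw [← pow_mul, ← pow_add]
    congr 2
    ring
  have h1 := hs.hasSum.prod_fiberwise hrow
  have h2 := ((Equiv.prodComm ℕ ℕ).hasSum_iff.2 hs.hasSum).prod_fiberwise hcol
  have h3 := h1.neg
  simp only [neg_neg] at h3
  rwa [eulerLog, tsum_neg, h2.tsum_eq]

theorem eulerProd_pos {x : ℝ} (hx : x ∈ Set.Ioo (0 : ℝ) 1) (n : ℕ) : 0 < eulerProd x n :=
  Finset.prod_pos fun i _ => one_sub_pow_pos hx i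

theorem eulerProd_le_one {x : ℝ} (hx : x ∈ Set.Ioo (0 : ℝ) 1) (n : ℕ) : eulerProd x n ≤ 1 :=
  Finset.prod_le_one (fun i _ => (one_sub_pow_pos hx i).le) fun i _ => by
    linarith [pow_pos hx.1 (i + 1)]

theorem tendsto_eulerProd {x : ℝ} (hx : x ∈ Set.Ioo (0 : ℝ) 1) :
    Tendsto (eulerProd x) atTop (𝓝 (Real.exp (eulerLog x))) := by
  have h := (Real.continuous_exp.tendsto _).comp (hasSum_double_log hx).tendsto_sum_nat
  refine h.congr fun n => ?_
  rw [Function.comp, Real.exp_sum]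
  exact Finset.prod_congr rfl fun i _ => Real.exp_log (one_sub_pow_pos hx i)

theorem exp_eulerLog_le {x : ℝ} (hx : x ∈ Set.Ioo (0 : ℝ) 1) (n : ℕ) :
    Real.exp (eulerLog x) ≤ eulerProd x n := by
  have ha : Antitone (eulerProd x) := antitone_nat_of_succ_le fun n => by
    rw [eulerProd, Finset.prod_range_succ]
    exact mul_le_of_le_one_right (eulerProd_pos hx n).le (by linarith [pow_pos hx.1 (n + 1)])
  exact ha.le_of_tendsto (tendsto_eulerProd hx) n

/-- The coefficients of the finite triple product, indexed by the integers. -/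
def tripleCoeff (x : ℝ) (n : ℕ) (j : ℤ) : ℝ :=
  if j.natAbs ≤ n then qBinom x (2 * n) (j + n).toNat else 0

theorem tripleCoeff_eq {x : ℝ} (hx : x ∈ Set.Ioo (0 : ℝ) 1) {n : ℕ} {j : ℤ} (hj : j.natAbs ≤ n) :
    tripleCoeff x n j =
      eulerProd x (2 * n) / (eulerProd x (n + j).toNat * eulerProd x (n - j).toNat) := by
  have h := qBinom_mul_eulerProd x (n + j).toNat (n - j).toNat
  rw [show (n + j).toNat + (n - j).toNat = 2 * n by omega] at h
  rw [tripleCoeff, if_pos hj, eq_div_iff (mul_pos (eulerProd_pos hx _) (eulerProd_pos hx _)).ne',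
    add_comm j, h]

theorem tendsto_tripleCoeff {x : ℝ} (hx : x ∈ Set.Ioo (0 : ℝ) 1) (j : ℤ) :
    Tendsto (fun n => tripleCoeff x n j) atTop (𝓝 (Real.exp (eulerLog x))⁻¹) := by
  have h := tendsto_eulerProd hx
  have h1 : Tendsto (fun n : ℕ => 2 * n) atTop atTop :=
    tendsto_atTop_mono (fun n => by simp only [id]; omega) tendsto_id
  have h2 : ∀ i : ℤ, Tendsto (fun n : ℕ => (n + i).toNat) atTop atTop := fun i =>
    tendsto_atTop_atTop.2 fun b => ⟨b + i.natAbs, fun n hn => by omega⟩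
  have h3 := (h.comp h1).div ((h.comp (h2 j)).mul (h.comp (h2 (-j))))
    (mul_pos (Real.exp_pos _) (Real.exp_pos _)).ne'
  rw [div_mul_cancel_left₀ (Real.exp_pos _).ne'] at h3
  refine h3.congr' ?_
  filter_upwards [eventually_ge_atTop j.natAbs] with n hn
  rw [tripleCoeff_eq hx hn]
  rfl

/-- Uniformity in `n` and `j` is what dominated convergence needs: the numerator is at most `1` and
each denominator is at least the infinite product. -/
theorem tripleCoeff_bound {x : ℝ} (hx : x ∈ Set.Ioo (0 : ℝ) 1) (n : ℕ) (j : ℤ) :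
    |tripleCoeff x n j| ≤ (Real.exp (eulerLog x) * Real.exp (eulerLog x))⁻¹ := by
  have h0 := Real.exp_pos (eulerLog x)
  by_cases hj : j.natAbs ≤ n
  · rw [tripleCoeff_eq hx hj, abs_of_pos (div_pos (eulerProd_pos hx _)
      (mul_pos (eulerProd_pos hx _) (eulerProd_pos hx _))), ← one_div]
    exact div_le_div₀ zero_le_one (eulerProd_le_one hx _) (by positivity)
      (mul_le_mul (exp_eulerLog_le hx _) (exp_eulerLog_le hx _) h0.le (eulerProd_pos hx _).le)
  · rw [tripleCoeff, if_neg hj, abs_zero]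
    positivity

/-- Jacobi's triple product. -/
theorem tendsto_triple_product {q z : ℝ} (hq : q ∈ Set.Ioo (0 : ℝ) 1) (hz : z ≠ 0)
    (hs : Summable fun j : ℤ => |q ^ (j ^ 2) * z ^ j|) :
    Tendsto (fun n => ∏ i ∈ Finset.range n,
      ((1 + z * q ^ (2 * i + 1)) * (1 + z⁻¹ * q ^ (2 * i + 1)))) atTop
      (𝓝 ((Real.exp (eulerLog (q ^ 2)))⁻¹ * ∑' j : ℤ, q ^ (j ^ 2) * z ^ j)) := by
  have hx := sq_mem_Ioo hq
  have h : Tendsto (fun n => ∑' j : ℤ, tripleCoeff (q ^ 2) n j * (q ^ (j ^ 2) * z ^ j)) atTop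
      (𝓝 (∑' j : ℤ, (Real.exp (eulerLog (q ^ 2)))⁻¹ * (q ^ (j ^ 2) * z ^ j))) := by
    refine tendsto_tsum_of_dominated_convergence (hs.mul_left
      (Real.exp (eulerLog (q ^ 2)) * Real.exp (eulerLog (q ^ 2)))⁻¹)
      (fun j => (tendsto_tripleCoeff hx j).mul_const _) (Eventually.of_forall fun n j => ?_)
    rw [Real.norm_eq_abs, abs_mul]
    exact mul_le_mul_of_nonneg_right (tripleCoeff_bound hx n j) (abs_nonneg _)
  rw [tsum_mul_left] at h
  refine h.congr fun n => ?_
  rw [finite_triple_product hq.1.ne' hz, tsum_eq_sum (s := Finset.Icc (-n : ℤ) n) fun j hj => ?_]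
  · refine Finset.sum_nbij' (fun j => (j + n).toNat) (fun m => (m : ℤ) - n) ?_ ?_ ?_ ?_ ?_
    · intro j hj
      simp only [Finset.mem_Icc, Finset.mem_range] at hj ⊢
      omega
    · intro m hm
      simp only [Finset.mem_Icc, Finset.mem_range] at hm ⊢
      omega
    · intro j hj
      simp only [Finset.mem_Icc] at hj
      omega
    · intro m _
      simp
    · intro j hj
      simp only [Finset.mem_Icc] at hj
      have e : (((j + n).toNat : ℕ) : ℤ) - n = j := by omega
      rw [e, tripleCoeff, if_pos (by omega)]
  · rw [Finset.mem_Icc] at hj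
    rw [tripleCoeff, if_neg (by omega), zero_mul]

theorem eulerProd_two_mul (x : ℝ) (n : ℕ) :
    eulerProd x (2 * n) = (∏ i ∈ Finset.range n, (1 - x ^ (2 * i + 1))) * eulerProd (x ^ 2) n := by
  induction n with
  | zero => simp [eulerProd]
  | succ n ih =>
    rw [show 2 * (n + 1) = 2 * n + 1 + 1 by ring]
    simp only [eulerProd, Finset.prod_range_succ] at ih ⊢
    rw [ih]
    ring

theorem eulerProd_sq (x : ℝ) (n : ℕ) :
    eulerProd (x ^ 2) n = eulerProd x n * ∏ i ∈ Finset.range n, (1 + x ^ (i + 1)) := by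
  rw [eulerProd, eulerProd, ← Finset.prod_mul_distrib]
  exact Finset.prod_congr rfl fun i _ => by ring

theorem tendsto_prod_odd {x : ℝ} (hx : x ∈ Set.Ioo (0 : ℝ) 1) :
    Tendsto (fun n => ∏ i ∈ Finset.range n, (1 - x ^ (2 * i + 1))) atTop
      (𝓝 (Real.exp (eulerLog x) / Real.exp (eulerLog (x ^ 2)))) := by
  have h1 : Tendsto (fun n : ℕ => 2 * n) atTop atTop :=
    tendsto_atTop_mono (fun n => by simp only [id]; omega) tendsto_id
  refine (((tendsto_eulerProd hx).comp h1).div (tendsto_eulerProd (sq_mem_Ioo hx))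
    (Real.exp_pos _).ne').congr fun n => ?_
  simp only [Pi.div_apply, Function.comp]
  rw [eulerProd_two_mul, mul_div_cancel_right₀ _ (eulerProd_pos (sq_mem_Ioo hx) n).ne']

theorem tendsto_prod_one_add {x : ℝ} (hx : x ∈ Set.Ioo (0 : ℝ) 1) :
    Tendsto (fun n => ∏ i ∈ Finset.range n, (1 + x ^ (i + 1))) atTop
      (𝓝 (Real.exp (eulerLog (x ^ 2)) / Real.exp (eulerLog x))) := by
  refine ((tendsto_eulerProd (sq_mem_Ioo hx)).div (tendsto_eulerProd hx)
    (Real.exp_pos _).ne').congr fun n => ?_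
  simp only [Pi.div_apply]
  rw [eulerProd_sq, mul_div_cancel_left₀ _ (eulerProd_pos hx n).ne']

/-- Gauss's product for `θ₄`. -/
theorem thetaFour_eq {q : ℝ} (hq : q ∈ Set.Ioo (0 : ℝ) 1) :
    thetaFour q = Real.exp (2 * eulerLog q - eulerLog (q ^ 2)) := by
  have hs : Summable fun j : ℤ => |q ^ (j ^ 2) * (-1 : ℝ) ^ j| :=
    (summable_thetaThree hq).congr fun j => by
      rw [mul_comm, ← Real.norm_eq_abs, abs_thetaFour_term hq]
  -- Here `z = -1`, so both families of factors are `1 - q^(2i+1)`.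
  have h := tendsto_triple_product hq (by norm_num) hs
  have h2 := (tendsto_prod_odd hq).pow 2
  have h3 : (Real.exp (eulerLog (q ^ 2)))⁻¹ * thetaFour q =
      (Real.exp (eulerLog q) / Real.exp (eulerLog (q ^ 2))) ^ 2 := by
    have e : ∑' j : ℤ, q ^ (j ^ 2) * (-1 : ℝ) ^ j = thetaFour q :=
      tsum_congr fun j => mul_comm _ _
    rw [e] at h
    refine tendsto_nhds_unique h (h2.congr fun n => ?_)
    rw [← Finset.prod_pow]
    exact Finset.prod_congr rfl fun i _ => by norm_num; ring
  rw [Real.exp_sub, two_mul, Real.exp_add]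
  have := Real.exp_ne_zero (eulerLog (q ^ 2))
  field_simp at h3 ⊢
  exact h3

/-- Gauss's product for `θ₂`. -/
theorem thetaTwo_eq {q : ℝ} (hq : q ∈ Set.Ioo (0 : ℝ) 1) :
    thetaTwo q = 2 * Real.exp (2 * eulerLog (q ^ 4) - eulerLog (q ^ 2)) := by
  have hx := sq_mem_Ioo hq
  have e0 : ∀ j : ℤ, q ^ (j ^ 2) * q ^ j = q ^ (j ^ 2 + j) := fun j =>
    (zpow_add₀ hq.1.ne' _ _).symm
  have hs : Summable fun j : ℤ => |q ^ (j ^ 2) * q ^ j| :=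
    (summable_thetaTwo hq).congr fun j => by rw [e0, abs_of_pos (zpow_pos hq.1 _)]
  have h := tendsto_triple_product hq hq.1.ne' hs
  simp only [e0] at h
  have h1 := tendsto_prod_one_add hx
  have hp : Tendsto (fun n : ℕ => (2 : ℝ) / (1 + (q ^ 2) ^ n)) atTop (𝓝 2) := by
    have := (tendsto_pow_atTop_nhds_zero_of_lt_one hx.1.le hx.2).const_add 1
    have h := (tendsto_const_nhds (x := (2 : ℝ))).div this (by norm_num)
    rwa [add_zero, div_one] at h
  have h2 := (h1.pow 2).mul hp
  -- For `z = q` the factors in `z⁻¹` start at `1 + 1 = 2`. Shifting the index compensates this by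
  -- `2 / (1 + q^(2n))`, which tends to the factor `2` in front.
  have e1 : ∀ n : ℕ, ∏ i ∈ Finset.range n, (1 + (q ^ 2) ^ i) =
      (∏ i ∈ Finset.range n, (1 + (q ^ 2) ^ (i + 1))) * (2 / (1 + (q ^ 2) ^ n)) := by
    intro n
    have hpos : 1 + (q ^ 2) ^ n ≠ 0 := by have := pow_pos hx.1 n; positivity
    rw [mul_div_assoc', eq_div_iff hpos, ← Finset.prod_range_succ, Finset.prod_range_succ']
    norm_num
  have h3 : (Real.exp (eulerLog (q ^ 2)))⁻¹ * thetaTwo q =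
      (Real.exp (eulerLog ((q ^ 2) ^ 2)) / Real.exp (eulerLog (q ^ 2))) ^ 2 * 2 := by
    refine tendsto_nhds_unique h (h2.congr fun n => ?_)
    rw [sq, mul_assoc, ← e1, ← Finset.prod_mul_distrib]
    refine Finset.prod_congr rfl fun i _ => ?_
    have e2 : q⁻¹ * q ^ (2 * i + 1) = (q ^ 2) ^ i := by
      rw [pow_succ, ← pow_mul]
      have := hq.1.ne'
      field_simp
    rw [e2]
    ring
  rw [← pow_mul] at h3
  rw [Real.exp_sub, two_mul (eulerLog _), Real.exp_add]
  have := Real.exp_ne_zero (eulerLog (q ^ 2))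
  field_simp at h3 ⊢
  linarith

/-- Termwise differentiation cancels the `1/(m+1)`; on `(0, r)` with `x < r < 1` the derivatives are
dominated by `rᵐ / (1 - r)²`. -/
theorem hasDerivAt_eulerLog {x : ℝ} (hx : x ∈ Set.Ioo (0 : ℝ) 1) :
    HasDerivAt eulerLog (-lambertSq x / x) x := by
  obtain ⟨r, hxr, hr1⟩ := exists_between hx.2
  have hr : r ∈ Set.Ioo (0 : ℝ) 1 := ⟨hx.1.trans hxr, hr1⟩
  have hg : Summable fun n : ℕ => r ^ n / (1 - r) ^ 2 :=
    (summable_geometric_of_lt_one hr.1.le hr.2).div_const _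
  have hsum : Summable fun m : ℕ => -(x ^ (m + 1) / (1 - x ^ (m + 1)) / (m + 1 : ℝ)) := by
    have hg : Summable fun n : ℕ => x * x ^ n / (1 - x) :=
      ((summable_geometric_of_lt_one hx.1.le hx.2).mul_left x).div_const _
    refine (Summable.of_nonneg_of_le (fun m => ?_) (fun m => ?_) hg).neg
    · exact div_nonneg (div_nonneg (pow_pos hx.1 _).le (one_sub_pow_pos hx m).le) (by positivity)
    · refine (div_le_self (div_nonneg (pow_pos hx.1 _).le (one_sub_pow_pos hx m).le)
        (by linarith [m.cast_nonneg (α := ℝ)])).trans ?_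
      rw [← pow_succ']
      exact div_le_div_of_nonneg_left (pow_pos hx.1 _).le (sub_pos.2 hx.2)
        (one_sub_le_one_sub_pow hx m)
  have h := hasDerivAt_tsum_of_isPreconnected (u := fun n : ℕ => r ^ n / (1 - r) ^ 2)
    (g := fun (m : ℕ) (y : ℝ) => -(y ^ (m + 1) / (1 - y ^ (m + 1)) / (m + 1 : ℝ)))
    (g' := fun m y => -(y ^ m / (1 - y ^ (m + 1)) ^ 2)) hg isOpen_Ioo isPreconnected_Ioo
    (t := Set.Ioo 0 r) (y₀ := x) (y := x) ?_ ?_ ⟨hx.1, hxr⟩ hsum ⟨hx.1, hxr⟩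
  · refine h.congr_deriv ?_
    rw [tsum_neg, lambertSq, neg_div, ← tsum_div_const]
    congr 1
    refine tsum_congr fun m => ?_
    have := hx.1.ne'
    have e : x ^ (m + 1) / x = x ^ m := by rw [pow_succ, mul_div_cancel_right₀ _ this]
    rw [div_right_comm, e]
  · intro m y hy
    have hy1 : y ∈ Set.Ioo (0 : ℝ) 1 := ⟨hy.1, hy.2.trans hr1⟩
    have h0 := (one_sub_pow_pos hy1 m).ne'
    have h1 := hasDerivAt_pow (m + 1) y
    refine (((h1.div (h1.const_sub 1) h0).div_const (m + 1 : ℝ)).neg).congr_deriv ?_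
    have h2 : (m + 1 : ℝ) ≠ 0 := by positivity
    push_cast
    field_simp
    ring
  · intro m y hy
    have hy1 : y ∈ Set.Ioo (0 : ℝ) 1 := ⟨hy.1, hy.2.trans hr1⟩
    have h0 := one_sub_pow_pos hy1 m
    rw [norm_neg, Real.norm_of_nonneg (div_nonneg (pow_pos hy.1 _).le (sq_nonneg _))]
    have h1 : 1 - r ≤ 1 - y ^ (m + 1) :=
      (by linarith [hy.2] : 1 - r ≤ 1 - y).trans (one_sub_le_one_sub_pow hy1 m)
    exact div_le_div₀ (pow_pos hr.1 _).le (pow_le_pow_left₀ hy.1.le hy.2.le _)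
      (pow_pos (sub_pos.2 hr1) 2) (pow_le_pow_left₀ (sub_pos.2 hr1).le h1 2)

theorem summable_lambertSq {x : ℝ} (hx : x ∈ Set.Ioo (0 : ℝ) 1) :
    Summable fun m : ℕ => x ^ (m + 1) / (1 - x ^ (m + 1)) ^ 2 := by
  have hg : Summable fun n : ℕ => x * x ^ n / (1 - x) ^ 2 :=
    ((summable_geometric_of_lt_one hx.1.le hx.2).mul_left x).div_const _
  refine Summable.of_nonneg_of_le (fun m => div_nonneg (pow_pos hx.1 _).le (sq_nonneg _))
    (fun m => ?_) hg
  rw [← pow_succ']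
  exact div_le_div_of_nonneg_left (pow_pos hx.1 _).le (pow_pos (sub_pos.2 hx.2) 2)
    (pow_le_pow_left₀ (sub_pos.2 hx.2).le (one_sub_le_one_sub_pow hx m) 2)

theorem evenTerm_eq (q : ℝ) (i : ℕ) :
    evenTerm q i = (q ^ 4) ^ (i + 1) / (1 - (q ^ 4) ^ (i + 1)) ^ 2 := by
  rw [evenTerm, div_pow]
  ring_nf

theorem evenTerm_eq' (q : ℝ) (i : ℕ) :
    evenTerm q i = (q ^ 2) ^ (2 * i + 1 + 1) / (1 - (q ^ 2) ^ (2 * i + 1 + 1)) ^ 2 := by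
  rw [evenTerm, div_pow]
  ring_nf

theorem oddTerm_eq (q : ℝ) (i : ℕ) :
    oddTerm q i = (q ^ 2) ^ (2 * i + 1) / (1 - (q ^ 2) ^ (2 * i + 1)) ^ 2 := by
  rw [oddTerm, div_pow]
  ring_nf

theorem pow_four_mem_Ioo {q : ℝ} (hq : q ∈ Set.Ioo (0 : ℝ) 1) : q ^ 4 ∈ Set.Ioo (0 : ℝ) 1 :=
  ⟨pow_pos hq.1 4, pow_lt_one₀ hq.1.le hq.2 four_ne_zero⟩

theorem hasSum_evenTerm {q : ℝ} (hq : q ∈ Set.Ioo (0 : ℝ) 1) :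
    HasSum (evenTerm q) (lambertSq (q ^ 4)) :=
  (summable_lambertSq (pow_four_mem_Ioo hq)).hasSum.congr_fun (evenTerm_eq q)

/-- The terms of the Lambert series at `q²` with even exponent index form the Lambert series at
`q⁴`; removing them leaves the odd ones. -/
theorem hasSum_oddTerm {q : ℝ} (hq : q ∈ Set.Ioo (0 : ℝ) 1) :
    HasSum (oddTerm q) (lambertSq (q ^ 2) - lambertSq (q ^ 4)) := by
  have hs := summable_lambertSq (sq_mem_Ioo hq)
  have ho : Summable (oddTerm q) :=
    (hs.comp_injective (i := fun i => 2 * i) (fun a b h => by simpa using h)).congr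
      fun i => (oddTerm_eq q i).symm
  have h := HasSum.even_add_odd (f := fun m : ℕ => (q ^ 2) ^ (m + 1) / (1 - (q ^ 2) ^ (m + 1)) ^ 2)
    (ho.hasSum.congr_fun fun i => (oddTerm_eq q i).symm)
    ((hasSum_evenTerm hq).congr_fun fun i => (evenTerm_eq' q i).symm)
  have := hs.hasSum.unique h
  rw [lambertSq, this, add_sub_cancel_right]
  exact ho.hasSum

/-! ### The Lambert series in terms of `K` and `E` -/

theorem ellK_eq_thetaThree {k : ℝ} (hk : k ∈ Set.Ioo (0 : ℝ) 1) :
    2 * ellK k / Real.pi = thetaThree (nome k) ^ 2 := by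
  have h := ellK_thetaMod (nome_mem_Ioo hk)
  rw [thetaMod_nome hk] at h
  have := Real.pi_ne_zero
  rw [h]
  field_simp

theorem compl_eq_thetaCompl {k : ℝ} (hk : k ∈ Set.Ioo (0 : ℝ) 1) :
    compl k = thetaCompl (nome k) := by
  rw [← compl_thetaMod (nome_mem_Ioo hk), thetaMod_nome hk]

/-- The product formula `√k' (2K/π) = ∏ (1 - q^{2n})⁴ / ∏ (1 - q^{4n})²`, in logarithmic form. -/
theorem log_compl_mul_ellK {k : ℝ} (hk : k ∈ Set.Ioo (0 : ℝ) 1) :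
    Real.log (1 - k ^ 2) / 4 + Real.log (2 * ellK k / Real.pi) =
      4 * eulerLog (nome k ^ 2) - 2 * eulerLog (nome k ^ 4) := by
  have hm := moduli_of_mem_Ioo hk
  have hq := nome_mem_Ioo hk
  have h3 := one_pos.trans_le (one_le_thetaThree hq)
  have h4 := thetaFour_pos hq
  have hc := compl_eq_thetaCompl hk
  have h1 : Real.log (1 - k ^ 2) = 2 * Real.log (compl k) := by
    rw [← compl_sq hm, Real.log_pow]; norm_num
  rw [h1, hc, ellK_eq_thetaThree hk, thetaCompl, Real.log_div (by positivity) (by positivity),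
    Real.log_pow, Real.log_pow]
  -- The left side is the logarithm of `θ₃ θ₄`, that is, of `θ₄(q²)²`, to which Gauss's product
  -- applies.
  have h5 := congrArg Real.log (thetaThree_mul_thetaFour hq)
  rw [Real.log_mul h3.ne' h4.ne', Real.log_pow, thetaFour_eq (sq_mem_Ioo hq), Real.log_exp,
    ← pow_mul] at h5
  push_cast at h5 ⊢
  linarith

/-- The product formula `k k' (2K/π)³ = 4 √q ∏ (1 - q^{2n})⁶`, in logarithmic form. -/
theorem log_mod_mul_compl_mul_ellK {k : ℝ} (hk : k ∈ Set.Ioo (0 : ℝ) 1) :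
    Real.log k + Real.log (1 - k ^ 2) / 2 + 3 * Real.log (2 * ellK k / Real.pi) =
      Real.log 4 + Real.log (nome k) / 2 + 6 * eulerLog (nome k ^ 2) := by
  have hm := moduli_of_mem_Ioo hk
  have hq := nome_mem_Ioo hk
  have h3 := one_pos.trans_le (one_le_thetaThree hq)
  have h2 := one_pos.trans_le (one_le_thetaTwo hq)
  have h0 := log_compl_mul_ellK hk
  have hk' : k = √(nome k) * thetaTwo (nome k) ^ 2 / thetaThree (nome k) ^ 2 :=
    (thetaMod_nome hk).symm
  -- This is `k (2K/π) = √q θ₂²`. Adding twice the previous product formula cancels the terms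
  -- `eulerLog (q⁴)`.
  have hl : Real.log k = Real.log (nome k) / 2 + 2 * Real.log (thetaTwo (nome k))
      - Real.log (2 * ellK k / Real.pi) := by
    rw [ellK_eq_thetaThree hk]
    nth_rw 1 [hk']
    have := Real.sqrt_pos.2 hq.1
    rw [Real.log_div (by positivity) (by positivity), Real.log_mul (by positivity) (by positivity),
      Real.log_sqrt hq.1.le, Real.log_pow, Real.log_pow]
    push_cast
    ring
  rw [thetaTwo_eq hq, Real.log_mul two_ne_zero (Real.exp_ne_zero _), Real.log_exp] at hl
  rw [hl, show (4 : ℝ) = 2 ^ 2 by norm_num, Real.log_pow]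
  push_cast
  linarith

section Derivatives

variable {k : ℝ}

theorem hasDerivAt_eulerLog_nome_pow (hk : k ∈ Set.Ioo (0 : ℝ) 1) {n : ℕ} (hn : n ≠ 0) :
    HasDerivAt (fun k => eulerLog (nome k ^ n))
      (-(n * lambertSq (nome k ^ n) * (Real.pi ^ 2 / (2 * k * (1 - k ^ 2) * ellK k ^ 2)))) k := by
  have hq := nome_mem_Ioo hk
  have hqn : nome k ^ n ∈ Set.Ioo (0 : ℝ) 1 := ⟨pow_pos hq.1 n, pow_lt_one₀ hq.1.le hq.2 hn⟩
  have h := (hasDerivAt_eulerLog hqn).comp k ((hasDerivAt_nome hk).pow n)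
  refine h.congr_deriv ?_
  have h0 := hq.1.ne'
  have e : nome k ^ n = nome k ^ (n - 1) * nome k := by
    rw [← pow_succ, Nat.sub_add_cancel (Nat.one_le_iff_ne_zero.2 hn)]
  have e' := pow_ne_zero (n - 1) h0
  generalize Real.pi ^ 2 / (2 * k * (1 - k ^ 2) * ellK k ^ 2) = d
  generalize lambertSq (nome k ^ n) = l
  rw [e]
  field_simp

theorem hasDerivAt_log_ellK (hk : k ∈ Set.Ioo (0 : ℝ) 1) :
    HasDerivAt (fun k => Real.log (2 * ellK k / Real.pi))
      ((ellE k / (1 - k ^ 2) - ellK k) / k / ellK k) k := by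
  have hm := moduli_of_mem_Ioo hk
  have hp := ellK_pos hm
  have hpi := Real.pi_pos
  refine ((((hasDerivAt_ellK hm hk.1.ne').const_mul 2).div_const Real.pi).log
    (by positivity)).congr_deriv ?_
  have := hk.1.ne'
  field_simp

theorem hasDerivAt_log_one_sub_sq (hk : k ∈ moduli) :
    HasDerivAt (fun k : ℝ => Real.log (1 - k ^ 2)) (-(2 * k) / (1 - k ^ 2)) k := by
  have h : HasDerivAt (fun y : ℝ => 1 - y ^ 2) (-(2 * k)) k := by
    simpa using ((hasDerivAt_id k).pow 2).const_sub 1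
  exact h.log (one_sub_sq_pos hk).ne'

/-- This is the `k`-derivative of `log_compl_mul_ellK`, with `K'(k)` and `dq/dk` inserted. -/
theorem lambertSq_sub (hk : k ∈ Set.Ioo (0 : ℝ) 1) :
    8 * Real.pi ^ 2 * (lambertSq (nome k ^ 2) - lambertSq (nome k ^ 4)) =
      (2 - k ^ 2) * ellK k ^ 2 - 2 * ellK k * ellE k := by
  have hm := moduli_of_mem_Ioo hk
  have h1 := ((hasDerivAt_log_one_sub_sq hm).div_const 4).add (hasDerivAt_log_ellK hk)
  have h2 := ((hasDerivAt_eulerLog_nome_pow hk two_ne_zero).const_mul 4).sub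
    ((hasDerivAt_eulerLog_nome_pow hk four_ne_zero).const_mul 2)
  have he := h1.unique (h2.congr_of_eventuallyEq (by
    filter_upwards [isOpen_Ioo.mem_nhds hk] with y hy
    exact log_compl_mul_ellK hy))
  have h3 := (one_sub_sq_pos hm).ne'
  have h4 := hk.1.ne'
  have h5 := (ellK_pos hm).ne'
  push_cast at he
  field_simp at he
  linarith

/-- This is the `k`-derivative of `log_mod_mul_compl_mul_ellK`; the term `log q / 2` on its right
side is the origin of the isolated `π² / 2`. -/
theorem lambertSq_nome_sq (hk : k ∈ Set.Ioo (0 : ℝ) 1) :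
    12 * Real.pi ^ 2 * lambertSq (nome k ^ 2) =
      Real.pi ^ 2 / 2 + (4 - 2 * k ^ 2) * ellK k ^ 2 - 6 * ellK k * ellE k := by
  have hm := moduli_of_mem_Ioo hk
  have hq := nome_mem_Ioo hk
  have h1 := (((Real.hasDerivAt_log hk.1.ne').add ((hasDerivAt_log_one_sub_sq hm).div_const 2))).add
    ((hasDerivAt_log_ellK hk).const_mul 3)
  have h2 := ((((hasDerivAt_nome hk).log hq.1.ne').div_const 2).const_add (Real.log 4)).add
    ((hasDerivAt_eulerLog_nome_pow hk two_ne_zero).const_mul 6)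
  have he := h1.unique (h2.congr_of_eventuallyEq (by
    filter_upwards [isOpen_Ioo.mem_nhds hk] with y hy
    exact log_mod_mul_compl_mul_ellK hy))
  have h3 := (one_sub_sq_pos hm).ne'
  have h4 := hk.1.ne'
  have h5 := (ellK_pos hm).ne'
  have h6 := hq.1.ne'
  rw [mul_div_cancel_left₀ _ h6] at he
  push_cast at he
  field_simp at he
  linarith

end Derivatives

theorem summable_evenTerm {k : ℝ} (hk0 : 0 ≤ k) (hk1 : k < 1) : Summable (evenTerm (nome k)) := by
  rcases hk0.eq_or_lt with rfl | h
  · refine summable_zero.congr fun i => ?_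
    simp [evenTerm, nome]
  · exact (hasSum_evenTerm (nome_mem_Ioo ⟨h, hk1⟩)).summable

theorem summable_oddTerm {k : ℝ} (hk0 : 0 ≤ k) (hk1 : k < 1) : Summable (oddTerm (nome k)) := by
  rcases hk0.eq_or_lt with rfl | h
  · refine summable_zero.congr fun i => ?_
    simp [oddTerm, nome]
  · exact (hasSum_oddTerm (nome_mem_Ioo ⟨h, hk1⟩)).summable

/-- The second-order coefficient expressed through Lambert series in the nome. -/
theorem zetaSq_eq_lambert {k : ℝ} (hk0 : 0 ≤ k) (hk1 : k < 1) :
    ellE k / ellK k - 1 + zetaSq k / ellK k =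
      1 - k ^ 2 - ellE k / ellK k
        + 2 * Real.pi ^ 2 / ellK k ^ 2 * ∑' i : ℕ, evenTerm (nome k) i
        - 6 * Real.pi ^ 2 / ellK k ^ 2 * ∑' i : ℕ, oddTerm (nome k) i := by
  rcases hk0.eq_or_lt with rfl | h
  -- At `k = 0` the nome is `0`, so both series vanish, and `E = K` makes both sides `0`.
  · have hz : ∀ x, zetaInc 0 x = 0 := fun x => by
      have : Real.pi / 2 ≠ 0 := by positivity
      simp [zetaInc, ellInc, delta, ellK_zero, ellE_zero, this]
    have := Real.pi_ne_zero
    simp [zetaSq, hz, evenTerm, oddTerm, nome, ellK_zero, ellE_zero, this]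
  · have hk : k ∈ Set.Ioo (0 : ℝ) 1 := ⟨h, hk1⟩
    have hp := (ellK_pos (moduli_of_mem_Ioo hk)).ne'
    rw [(hasSum_evenTerm (nome_mem_Ioo hk)).tsum_eq, (hasSum_oddTerm (nome_mem_Ioo hk)).tsum_eq]
    have h1 := lambertSq_sub hk
    have h2 := lambertSq_nome_sq hk
    have h3 := ellK_mul_zetaSq hk
    field_simp
    linear_combination h3 + h1 - h2 / 6

/-! ### Analytic branch of a quadratic equation -/

section InverseFunction

variable {X : Type*} [NormedCommRing X] [NormedAlgebra ℝ X] [CompleteSpace X]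

/-- Analytic solution branch of the quadratic equation `ρ = -T (ε v + ρ²)` in a Banach algebra. -/
theorem exists_analytic_quadratic_branch (T : X →L[ℝ] X) (v : X) :
    ∃ ρ : ℝ → X, AnalyticAt ℝ ρ 0 ∧ ρ 0 = 0 ∧ HasDerivAt ρ (-(T v)) 0 ∧
      ∀ᶠ ε in 𝓝 (0 : ℝ), ρ ε = -T (ε • v + ρ ε * ρ ε) := by
  -- The equation reads `Φ ρ = -ε T v`. Since the derivative of `Φ` at `0` is the identity, an
  -- analytic local inverse exists.
  set Φ : X → X := fun x => x + T (x * x) with hΦ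
  have hΦs : ContDiff ℝ ω Φ := contDiff_id.add (T.contDiff.comp (contDiff_id.mul contDiff_id))
  have hd : HasFDerivAt Φ ((ContinuousLinearEquiv.refl ℝ X : X ≃L[ℝ] X) : X →L[ℝ] X) 0 := by
    have h1 : HasFDerivAt (fun x : X => x * x) (0 : X →L[ℝ] X) 0 := by
      have := (hasFDerivAt_id (𝕜 := ℝ) (0 : X)).mul (hasFDerivAt_id (𝕜 := ℝ) (0 : X))
      refine this.congr_fderiv ?_
      ext; simp
    have h2 := (hasFDerivAt_id (𝕜 := ℝ) (0 : X)).add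
      (HasFDerivAt.comp (g := T) (0 : X) T.hasFDerivAt h1)
    refine h2.congr_fderiv ?_
    ext; simp
  have hn : (ω : WithTop ℕ∞) ≠ 0 := by simp
  have hΦ0 : Φ 0 = 0 := by simp [hΦ]
  set Ψ := (hΦs.contDiffAt (x := (0 : X))).localInverse hd hn with hΨ
  have hΨs : ContDiffAt ℝ ω Ψ 0 := by
    have := (hΦs.contDiffAt (x := (0 : X))).to_localInverse hd hn
    rwa [hΦ0] at this
  have hΨ0 : Ψ 0 = 0 := by
    have := (hΦs.contDiffAt (x := (0 : X))).localInverse_apply_image hd hn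
    rwa [hΦ0] at this
  have hright : ∀ᶠ y in 𝓝 (0 : X), Φ (Ψ y) = y := by
    have := ((hΦs.contDiffAt (x := (0 : X))).hasStrictFDerivAt' hd hn).eventually_right_inverse
    rwa [hΦ0] at this
  set ρ : ℝ → X := fun ε => Ψ (-(ε • T v)) with hρ
  have hlin : ContDiffAt ℝ ω (fun ε : ℝ => -(ε • T v)) 0 :=
    (contDiff_id.smul contDiff_const).neg.contDiffAt
  have hρs : ContDiffAt ℝ ω ρ 0 := by
    refine ContDiffAt.comp (0 : ℝ) ?_ hlin
    rwa [zero_smul, neg_zero]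
  have hρ0 : ρ 0 = 0 := by simp [hρ, hΨ0]
  have heq : ∀ᶠ ε in 𝓝 (0 : ℝ), ρ ε = -T (ε • v + ρ ε * ρ ε) := by
    have hc : Tendsto (fun ε : ℝ => -(ε • T v)) (𝓝 0) (𝓝 0) := by
      have := hlin.continuousAt.tendsto
      simpa using this
    filter_upwards [hc.eventually hright] with ε hε
    have : ρ ε + T (ρ ε * ρ ε) = -(ε • T v) := hε
    rw [map_add, map_smul, neg_add, ← this]
    abel
  have hρa : AnalyticAt ℝ ρ 0 := contDiffWithinAt_omega_iff_analyticWithinAt.1 hρs |> analyticWithinAt_univ.1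
  refine ⟨ρ, hρa, hρ0, ?_, heq⟩
  have hρd := hρa.differentiableAt.hasDerivAt
  -- The derivative is read off the fixed point equation: the quadratic term contributes nothing
  -- because `ρ 0 = 0`.
  have h1 : HasDerivAt (fun ε : ℝ => -T (ε • v + ρ ε * ρ ε)) (-(T v)) 0 := by
    have h2 := ((hasDerivAt_id (0 : ℝ)).smul_const v).add (hρd.mul hρd)
    have h3 := (T.hasFDerivAt.comp_hasDerivAt (0 : ℝ) h2).neg
    refine h3.congr_deriv ?_
    simp [hρ0]
  exact h1.congr_of_eventuallyEq heq

end InverseFunction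

/-! ### Primitives and weighted means on the circle -/

section Circle

variable {P : ℝ}

theorem continuous_circle_comp (f : C(AddCircle P, ℝ)) : Continuous fun x : ℝ => f (x : AddCircle P) :=
  f.continuous.comp (AddCircle.continuous_mk' P)

theorem periodic_circle_comp (f : C(AddCircle P, ℝ)) :
    Function.Periodic (fun x : ℝ => f (x : AddCircle P)) P := fun x => by simp

/-- The continuous function on the circle given by a continuous periodic function. -/
def circleLift {f : ℝ → ℝ} (hf : Continuous f) (hp : Function.Periodic f P) : C(AddCircle P, ℝ) where
  toFun := hp.lift
  continuous_toFun := continuous_coinduced_dom.2 hf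

@[simp]
theorem circleLift_coe {f : ℝ → ℝ} (hf : Continuous f) (hp : Function.Periodic f P) (x : ℝ) :
    circleLift hf hp (x : AddCircle P) = f x := rfl

theorem intervalIntegrable_circle (w f : C(AddCircle P, ℝ)) (a b : ℝ) :
    IntervalIntegrable (fun t : ℝ => w t * f t) MeasureTheory.volume a b :=
  ((continuous_circle_comp w).mul (continuous_circle_comp f)).intervalIntegrable _ _

theorem continuous_circlePrim {w f : C(AddCircle P, ℝ)} :
    Continuous fun x : ℝ => ∫ t in (0 : ℝ)..x, w t * f t :=
  intervalIntegral.continuous_primitive (fun a b => intervalIntegrable_circle w f a b) 0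

variable [hP : Fact (0 < P)]

theorem abs_integral_circle_le (w f : C(AddCircle P, ℝ)) {x : ℝ} (h0 : 0 ≤ x) (h1 : x ≤ P) :
    |∫ t in (0 : ℝ)..x, w t * f t| ≤ ‖w‖ * ‖f‖ * P := by
  have h := intervalIntegral.norm_integral_le_of_norm_le_const (a := (0 : ℝ)) (b := x)
    (C := ‖w‖ * ‖f‖) (f := fun t : ℝ => w t * f t) (fun t _ => by
      rw [norm_mul]
      exact mul_le_mul (w.norm_coe_le_norm _) (f.norm_coe_le_norm _) (norm_nonneg _) (norm_nonneg _))
  rw [Real.norm_eq_abs, sub_zero, abs_of_nonneg h0] at h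
  exact h.trans (by gcongr)

/-- The integral over a period, with weight `w`. -/
def circleInt (w : C(AddCircle P, ℝ)) : C(AddCircle P, ℝ) →L[ℝ] ℝ :=
  LinearMap.mkContinuous
    { toFun := fun f => ∫ t in (0 : ℝ)..P, w t * f t
      map_add' := fun f g => by
        rw [← intervalIntegral.integral_add (intervalIntegrable_circle w f 0 P)
          (intervalIntegrable_circle w g 0 P)]
        simp [mul_add]
      map_smul' := fun c f => by
        rw [RingHom.id_apply, smul_eq_mul, ← intervalIntegral.integral_const_mul]
        simp [mul_left_comm] }
    (‖w‖ * P) (fun f => by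
      have := abs_integral_circle_le w f hP.out.le le_rfl
      simp only [LinearMap.coe_mk, AddHom.coe_mk, Real.norm_eq_abs]
      linarith)

theorem circleInt_apply (w f : C(AddCircle P, ℝ)) :
    circleInt w f = ∫ t in (0 : ℝ)..P, w t * f t := rfl

/-- The weighted mean over a period. -/
def circleAvg (w : C(AddCircle P, ℝ)) : C(AddCircle P, ℝ) →L[ℝ] ℝ := (circleInt w 1)⁻¹ • circleInt w

variable (w : C(AddCircle P, ℝ))

theorem circleAvg_mul {w : C(AddCircle P, ℝ)} (hw : circleInt w 1 ≠ 0) (f : C(AddCircle P, ℝ)) :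
    circleInt w 1 * circleAvg w f = circleInt w f := by
  simp [circleAvg, mul_inv_cancel_left₀ hw]

/-- The deviation from the weighted mean. -/
def circleDev : C(AddCircle P, ℝ) →L[ℝ] C(AddCircle P, ℝ) :=
  ContinuousLinearMap.id ℝ _ - (circleAvg w).smulRight 1

theorem circleDev_apply (f : C(AddCircle P, ℝ)) (x : AddCircle P) :
    circleDev w f x = f x - circleAvg w f := by simp [circleDev]

theorem circleInt_circleDev {w : C(AddCircle P, ℝ)} (hw : circleInt w 1 ≠ 0) (f : C(AddCircle P, ℝ)) :
    circleInt w (circleDev w f) = 0 := by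
  have := circleAvg_mul hw f
  simp only [circleDev, sub_apply, ContinuousLinearMap.id_apply,
    ContinuousLinearMap.smulRight_apply, map_sub, map_smul, smul_eq_mul]
  linarith

variable {w} (hw : circleInt w 1 ≠ 0)

/-- The increment over one period is the weighted integral of `f`, which is assumed to vanish. -/
theorem periodic_circlePrim {f : C(AddCircle P, ℝ)} (hf : circleInt w f = 0) :
    Function.Periodic (fun x : ℝ => ∫ t in (0 : ℝ)..x, w t * f t) P := fun x => by
  have hp : Function.Periodic (fun t : ℝ => w t * f t) P :=
    (periodic_circle_comp w).mul (periodic_circle_comp f)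
  have h := hp.intervalIntegral_add_eq x 0
  rw [zero_add, ← circleInt_apply, hf] at h
  dsimp only
  rw [← intervalIntegral.integral_add_adjacent_intervals (intervalIntegrable_circle w f 0 x)
    (intervalIntegrable_circle w f x (x + P)), h, add_zero]

/-- The primitive, vanishing at `0`, of `w (f - ⟨f⟩)`. -/
def circlePrim : C(AddCircle P, ℝ) →L[ℝ] C(AddCircle P, ℝ) :=
  LinearMap.mkContinuous
    { toFun := fun f => circleLift continuous_circlePrim
        (periodic_circlePrim (circleInt_circleDev hw f))
      map_add' := fun f g => by
        ext x
        induction x using QuotientAddGroup.induction_on with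
        | H x =>
          simp only [ContinuousMap.add_apply, circleLift_coe, map_add, mul_add]
          exact intervalIntegral.integral_add (intervalIntegrable_circle w _ 0 x)
            (intervalIntegrable_circle w _ 0 x)
      map_smul' := fun c f => by
        ext x
        induction x using QuotientAddGroup.induction_on with
        | H x =>
          simp only [ContinuousMap.smul_apply, circleLift_coe, map_smul, smul_eq_mul,
            RingHom.id_apply, ← intervalIntegral.integral_const_mul, mul_left_comm] }
    (‖w‖ * ‖circleDev w‖ * P) (fun f => by
      refine (ContinuousMap.norm_le _ (by have := hP.out.le; positivity)).2 fun x => ?_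
      obtain ⟨y, hy, rfl⟩ : ∃ y ∈ Set.Icc (0 : ℝ) (0 + P), (y : AddCircle P) = x := by
        have : x ∈ ((↑) : ℝ → AddCircle P) '' Set.Icc 0 (0 + P) := by
          rw [AddCircle.coe_image_Icc_eq]; trivial
        exact this
      rw [zero_add] at hy
      refine (abs_integral_circle_le w (circleDev w f) hy.1 hy.2).trans ?_
      have h := (circleDev w).le_opNorm f
      have hP' := hP.out.le
      calc ‖w‖ * ‖circleDev w f‖ * P ≤ ‖w‖ * (‖circleDev w‖ * ‖f‖) * P := by gcongr
        _ = ‖w‖ * ‖circleDev w‖ * P * ‖f‖ := by ring)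

theorem circlePrim_apply (f : C(AddCircle P, ℝ)) (x : ℝ) :
    circlePrim hw f x = ∫ t in (0 : ℝ)..x, w t * circleDev w f t := rfl

/-- The periodic primitive of `w (f - ⟨f⟩)` with weighted mean zero. -/
def circleSolve : C(AddCircle P, ℝ) →L[ℝ] C(AddCircle P, ℝ) := (circleDev w).comp (circlePrim hw)

/-- `circleSolve` inverts `w⁻¹ d/dx` modulo the weighted mean. A solution of `r = -circleSolve (ε V
+ r²)` thus solves the Riccati equation with `m` equal to the weighted mean of `ε V + r²`. -/
theorem hasDerivAt_circleSolve (f : C(AddCircle P, ℝ)) (x : ℝ) :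
    HasDerivAt (fun y : ℝ => circleSolve hw f y) (w x * (f x - circleAvg w f)) x := by
  have hc := (continuous_circle_comp w).mul (continuous_circle_comp (circleDev w f))
  have h : HasDerivAt (fun y : ℝ => ∫ t in (0 : ℝ)..y, w t * circleDev w f t)
      (w x * circleDev w f x) x :=
    intervalIntegral.integral_hasDerivAt_right (hc.intervalIntegrable _ _)
      (hc.stronglyMeasurableAtFilter _ _) hc.continuousAt
  simp only [circleSolve, ContinuousLinearMap.comp_apply, circleDev_apply, circlePrim_apply]
  simpa only [circleDev_apply] using h.sub_const _

theorem circleInt_circleSolve (f : C(AddCircle P, ℝ)) : circleInt w (circleSolve hw f) = 0 :=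
  circleInt_circleDev hw _

end Circle

/-- The branch of periodic solutions of the Riccati equation `r' = w (m - ε V - r²)` bifurcating
from `r = 0`, `m = 0` at `ε = 0`, and the second order expansion of `m`. -/
theorem exists_riccati_branch {P : ℝ} (hP : 0 < P) {w V Z : ℝ → ℝ} (hw : Continuous w)
    (hV : Continuous V) (hwp : Function.Periodic w P) (hVp : Function.Periodic V P)
    (hw0 : ∀ x, 0 < w x) {v : ℝ}
    (hv : ∫ x in (0 : ℝ)..P, w x * V x = v * ∫ x in (0 : ℝ)..P, w x)
    (hZ : ∀ x, HasDerivAt Z (w x * (V x - v)) x) (hZ0 : ∫ x in (0 : ℝ)..P, w x * Z x = 0) :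
    ∃ m : ℝ → ℝ, AnalyticAt ℝ m 0 ∧ m 0 = 0 ∧ deriv m 0 = v ∧
      (∫ x in (0 : ℝ)..P, w x) * iteratedDeriv 2 m 0 = 2 * ∫ x in (0 : ℝ)..P, w x * Z x ^ 2 ∧
      ∀ᶠ ε in 𝓝 (0 : ℝ), ∃ r : ℝ → ℝ, Function.Periodic r P ∧
        (∀ x, HasDerivAt r (w x * (m ε - ε * V x - r x ^ 2)) x) ∧
        ∫ x in (0 : ℝ)..P, w x * r x = 0 := by
  have : Fact (0 < P) := ⟨hP⟩
  set W : C(AddCircle P, ℝ) := circleLift hw hwp with hW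
  set U : C(AddCircle P, ℝ) := circleLift hV hVp with hU
  have hint : circleInt W 1 = ∫ x in (0 : ℝ)..P, w x := by simp [circleInt_apply, hW]
  have hpos : 0 < ∫ x in (0 : ℝ)..P, w x :=
    intervalIntegral.intervalIntegral_pos_of_pos (hw.intervalIntegrable _ _) hw0 hP
  have hne : circleInt W 1 ≠ 0 := by rw [hint]; exact hpos.ne'
  have hUavg : circleAvg W U = v := by
    have h := circleAvg_mul hne U
    rw [hint, circleInt_apply] at h
    simp only [hW, hU, circleLift_coe, hv] at h
    exact mul_left_cancel₀ hpos.ne' (by rw [h]; ring)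
  obtain ⟨ρ, hρa, hρ0, hρd, hρe⟩ := exists_analytic_quadratic_branch (circleSolve hne) U
  -- Both sides are primitives of `w (V - v)` with weighted mean zero, hence equal.
  have hTV : ∀ x : ℝ, circleSolve hne U x = Z x := by
    have hd : ∀ x : ℝ, HasDerivAt (fun y : ℝ => circleSolve hne U y - Z y) 0 x := fun x => by
      have h := (hasDerivAt_circleSolve hne U x).sub (hZ x)
      refine h.congr_deriv ?_
      rw [hUavg]
      simp [hW, hU]
    have hconst : ∀ x : ℝ, circleSolve hne U x = Z x + (circleSolve hne U (0 : ℝ) - Z 0) := fun x => by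
      have := is_const_of_deriv_eq_zero (fun y => (hd y).differentiableAt) (fun y => (hd y).deriv) x 0
      linarith
    have hZc : Continuous Z := continuous_iff_continuousAt.2 fun x => (hZ x).continuousAt
    have h0 := circleInt_circleSolve hne U
    rw [circleInt_apply] at h0
    have h1 : ∀ x : ℝ, W x * circleSolve hne U x =
        w x * Z x + w x * (circleSolve hne U (0 : ℝ) - Z 0) := fun x => by
      rw [hconst x, mul_add]; rfl
    simp only [h1] at h0
    rw [intervalIntegral.integral_add (f := fun x => w x * Z x)
      ((hw.mul hZc).intervalIntegrable _ _) ((hw.mul_const _).intervalIntegrable _ _), hZ0, intervalIntegral.integral_mul_const,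
      zero_add] at h0
    have hc := (mul_eq_zero.1 h0).resolve_left hpos.ne'
    intro x
    rw [hconst x, hc, add_zero]
  set m : ℝ → ℝ := fun ε => circleAvg W (ε • U + ρ ε * ρ ε) with hm
  have hma : AnalyticAt ℝ m 0 :=
    ((circleAvg W).analyticAt _).fun_comp_of_eq ((analyticAt_id.smul analyticAt_const).add (hρa.mul hρa)) rfl
  have hmd : ∀ᶠ ε in 𝓝 (0 : ℝ), HasDerivAt m (v + 2 * circleAvg W (ρ ε * deriv ρ ε)) ε := by
    filter_upwards [hρa.eventually_analyticAt] with ε hε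
    have h1 := hε.differentiableAt.hasDerivAt
    have h2 := ((hasDerivAt_id ε).smul_const U).add (h1.mul h1)
    refine ((circleAvg W).hasFDerivAt.comp_hasDerivAt ε h2).congr_deriv ?_
    simp only [map_add, one_smul, hUavg, mul_comm (deriv ρ ε)]
    ring
  refine ⟨m, hma, by simp [hm, hρ0], ?_, ?_, ?_⟩
  · rw [hmd.self_of_nhds.deriv, hρ0]
    simp
  · have h1 : deriv m =ᶠ[𝓝 0] fun ε => v + 2 * circleAvg W (ρ ε * deriv ρ ε) := by
      filter_upwards [hmd] with ε hε using hε.deriv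
    -- In the derivative of `⟨ρ ρ'⟩` the term with `ρ''` drops out because `ρ 0 = 0`; what remains
    -- is the mean of `ρ'(0)²`, and `ρ'(0) = -Z`.
    have h2 : HasDerivAt (deriv m) (2 * circleAvg W (deriv ρ 0 * deriv ρ 0)) 0 := by
      have h3 := hρa.deriv.differentiableAt.hasDerivAt
      have h4 := hρa.differentiableAt.hasDerivAt.mul h3
      have h5 := (((circleAvg W).hasFDerivAt.comp_hasDerivAt (0 : ℝ) h4).const_mul 2).const_add v
      refine (h5.congr_of_eventuallyEq h1).congr_deriv ?_
      simp [hρ0]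
    rw [iteratedDeriv_succ, iteratedDeriv_one, h2.deriv, ← hint, mul_left_comm, circleAvg_mul hne,
      hρd.deriv, neg_mul_neg, circleInt_apply]
    simp only [ContinuousMap.mul_apply, hTV, hW, circleLift_coe, sq]
  · filter_upwards [hρe] with ε hε
    refine ⟨fun x => ρ ε x, periodic_circle_comp _, fun x => ?_, ?_⟩
    · have h := (hasDerivAt_circleSolve hne (ε • U + ρ ε * ρ ε) x).neg
      have hfun : (fun y : ℝ => ρ ε y) = -fun y : ℝ => circleSolve hne (ε • U + ρ ε * ρ ε) y := by
        ext y
        conv_lhs => rw [hε]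
        rfl
      rw [hfun]
      refine h.congr_deriv ?_
      have hx := congrFun hfun x
      simp only [Pi.neg_apply] at hx ⊢
      rw [← hx]
      simp only [hm, hW, hU, ContinuousMap.add_apply, ContinuousMap.smul_apply,
        ContinuousMap.mul_apply, circleLift_coe, smul_eq_mul]
      ring
    · have h := circleInt_circleSolve hne (ε • U + ρ ε * ρ ε)
      have h' : circleInt W (ρ ε) = 0 := by rw [hε, map_neg, h, neg_zero]
      simpa [circleInt_apply, hW] using h'

/-! ### Homogeneous functions -/

section Homogeneous

variable {d : ℕ} {ℓ : ℝ} {u v : (Fin d → ℝ) → ℂ}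

theorem differentiableAt_of_mem_V (hv : v ∈ V d ℓ) {x : Fin d → ℝ} (hx : x ≠ 0) :
    DifferentiableAt ℝ v x :=
  (hv.1.contDiffAt (isOpen_compl_singleton.mem_nhds hx)).differentiableAt (by simp)

theorem sub_mem_V (hu : u ∈ V d ℓ) (hv : v ∈ V d ℓ) : (fun x => u x - v x) ∈ V d ℓ :=
  ⟨hu.1.sub hv.1, fun r hr x hx => by simp only [hu.2 r hr x hx, hv.2 r hr x hx, mul_sub]⟩

theorem add_mem_V (hu : u ∈ V d ℓ) (hv : v ∈ V d ℓ) : (fun x => u x + v x) ∈ V d ℓ :=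
  ⟨hu.1.add hv.1, fun r hr x hx => by simp only [hu.2 r hr x hx, hv.2 r hr x hx, mul_add]⟩

theorem const_mul_mem_V (hv : v ∈ V d ℓ) (c : ℂ) : (fun x => c * v x) ∈ V d ℓ :=
  ⟨contDiffOn_const.mul hv.1, fun r hr x hx => by simp only [hv.2 r hr x hx, mul_left_comm]⟩

theorem contDiffOn_pd (hv : ContDiffOn ℝ ∞ v {0}ᶜ) (j : Fin d) : ContDiffOn ℝ ∞ (pd j v) {0}ᶜ :=
  (hv.fderiv_of_isOpen isOpen_compl_singleton (by simp)).clm_apply contDiffOn_const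

theorem pd_smul (hv : v ∈ V d ℓ) (j : Fin d) {r : ℝ} (hr : r ≠ 0) {x : Fin d → ℝ} (hx : x ≠ 0) :
    (r : ℂ) * pd j v (r • x) = ((|r| ^ ℓ : ℝ) : ℂ) * pd j v x := by
  have h1 : HasFDerivAt (fun y : Fin d → ℝ => v (r • y)) _ x :=
    HasFDerivAt.comp (g := v) x (differentiableAt_of_mem_V hv (smul_ne_zero hr hx)).hasFDerivAt
      ((hasFDerivAt_id x).const_smul r)
  have h2 := (differentiableAt_of_mem_V hv hx).hasFDerivAt.const_mul ((|r| ^ ℓ : ℝ) : ℂ)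
  have h3 : (fun y : Fin d → ℝ => v (r • y)) =ᶠ[𝓝 x] fun y => ((|r| ^ ℓ : ℝ) : ℂ) * v y := by
    filter_upwards [isOpen_compl_singleton.mem_nhds hx] with y hy using hv.2 r hr y hy
  have h4 := congrArg (fun L => L (Pi.single j 1)) (h1.unique (h2.congr_of_eventuallyEq h3))
  simpa [pd] using h4

theorem genN_mem_V (hv : v ∈ V d ℓ) (i j : Fin d) : genN i j v ∈ V d ℓ := by
  refine ⟨?_, fun r hr x hx => ?_⟩
  · refine ContDiffOn.mul ?_ (contDiffOn_pd hv.1 j)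
    exact (Complex.ofRealCLM.contDiff.comp (contDiff_apply ℝ ℝ i)).contDiffOn
  · have := pd_smul hv j hr hx
    simp only [genN, Pi.smul_apply, smul_eq_mul, Complex.ofReal_mul]
    linear_combination (x i : ℂ) * this

theorem genK_mem_V (hv : v ∈ V d ℓ) (i j : Fin d) : genK i j v ∈ V d ℓ :=
  sub_mem_V (genN_mem_V hv i j) (genN_mem_V hv j i)

theorem genA_mem_V (hv : v ∈ V d ℓ) (i j : Fin d) : genA i j v ∈ V d ℓ :=
  sub_mem_V (genN_mem_V hv i i) (genN_mem_V hv j j)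

/-- Euler's identity. -/
theorem fderiv_apply_self_of_mem_V (hv : v ∈ V d ℓ) {x : Fin d → ℝ} (hx : x ≠ 0) :
    fderiv ℝ v x x = (ℓ : ℂ) * v x := by
  have hx' : (1 : ℝ) • x ≠ 0 := by rwa [one_smul]
  have h1 : HasDerivAt (fun r : ℝ => v (r • x)) _ 1 :=
    (differentiableAt_of_mem_V hv hx').hasFDerivAt.comp_hasDerivAt (1 : ℝ)
      ((hasDerivAt_id (1 : ℝ)).smul_const x)
  have h2 : HasDerivAt (fun r : ℝ => ((r ^ ℓ : ℝ) : ℂ) * v x) _ 1 :=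
    ((Real.hasDerivAt_rpow_const (p := ℓ) (Or.inl one_ne_zero)).ofReal_comp).mul_const (v x)
  have h3 : (fun r : ℝ => v (r • x)) =ᶠ[𝓝 1] fun r => ((r ^ ℓ : ℝ) : ℂ) * v x := by
    filter_upwards [lt_mem_nhds (zero_lt_one (α := ℝ))] with r hr
    rw [hv.2 r hr.ne' x hx, abs_of_pos hr]
  have h4 := h1.unique (h2.congr_of_eventuallyEq h3)
  simpa using h4

end Homogeneous

/-! ### Polar coordinates and the angular form of the operators -/

/-- The point of the unit circle at angle `θ`. -/
def circ (θ : ℝ) : Fin 2 → ℝ := ![Real.cos θ, Real.sin θ]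

@[simp] theorem circ_apply_zero (θ : ℝ) : circ θ 0 = Real.cos θ := rfl

@[simp] theorem circ_apply_one (θ : ℝ) : circ θ 1 = Real.sin θ := rfl

theorem circ_ne_zero (θ : ℝ) : circ θ ≠ 0 := fun h => by
  have h0 : Real.cos θ = 0 := congrFun h 0
  have h1 : Real.sin θ = 0 := congrFun h 1
  have := Real.sin_sq_add_cos_sq θ
  simp [h0, h1] at this

theorem circ_add_pi (θ : ℝ) : circ (θ + Real.pi) = (-1 : ℝ) • circ θ := by
  ext i; fin_cases i <;> simp [circ]

theorem contDiff_circ : ContDiff ℝ ∞ circ := by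
  refine contDiff_pi.2 fun i => ?_
  fin_cases i
  · exact Real.contDiff_cos
  · exact Real.contDiff_sin

theorem hasDerivAt_circ (θ : ℝ) : HasDerivAt circ ![-Real.sin θ, Real.cos θ] θ := by
  refine hasDerivAt_pi.2 fun i => ?_
  fin_cases i
  · exact Real.hasDerivAt_cos θ
  · exact Real.hasDerivAt_sin θ

theorem fderiv_apply_fin_two (v : (Fin 2 → ℝ) → ℂ) (x y : Fin 2 → ℝ) :
    fderiv ℝ v x y = (y 0 : ℂ) * pd 0 v x + (y 1 : ℂ) * pd 1 v x := by
  have hy : y = y 0 • Pi.single (0 : Fin 2) (1 : ℝ) + y 1 • Pi.single (1 : Fin 2) (1 : ℝ) := by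
    ext i; fin_cases i <;> simp
  conv_lhs => rw [hy]
  simp [pd]

/-- The complex number with coordinates `x`. -/
def toComplex (x : Fin 2 → ℝ) : ℂ := ⟨x 0, x 1⟩

theorem contDiff_toComplex : ContDiff ℝ ∞ toComplex := by
  have : toComplex = fun x : Fin 2 → ℝ => (x 0 : ℂ) + (x 1 : ℂ) * Complex.I := by
    ext x; apply Complex.ext <;> simp [toComplex]
  rw [this]
  exact (Complex.ofRealCLM.contDiff.comp (contDiff_apply ℝ ℝ 0)).add
    ((Complex.ofRealCLM.contDiff.comp (contDiff_apply ℝ ℝ 1)).mul contDiff_const)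

theorem toComplex_ne_zero {x : Fin 2 → ℝ} (hx : x ≠ 0) : toComplex x ≠ 0 := fun h => hx (by
  ext i; fin_cases i
  · exact congrArg Complex.re h
  · exact congrArg Complex.im h)

theorem toComplex_smul_circ (r θ : ℝ) :
    toComplex (r • circ θ) = r * Complex.exp (θ * Complex.I) := by
  apply Complex.ext <;>
    simp [toComplex, Complex.exp_ofReal_mul_I_re, Complex.exp_ofReal_mul_I_im]

theorem toComplex_injective : Function.Injective toComplex := fun x y h => by
  ext i; fin_cases i
  · exact congrArg Complex.re h
  · exact congrArg Complex.im h

/-- Polar coordinates, with the angle measured from `θ₀`. -/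
theorem eq_norm_smul_circ (x : Fin 2 → ℝ) (θ₀ : ℝ) :
    x = ‖toComplex x‖ • circ (θ₀ + (toComplex x * Complex.exp (-(θ₀ * Complex.I))).arg) := by
  apply toComplex_injective
  rw [toComplex_smul_circ]
  set z := toComplex x
  have h := Complex.norm_mul_exp_arg_mul_I (z * Complex.exp (-(θ₀ * Complex.I)))
  have hn : ‖z * Complex.exp (-(θ₀ * Complex.I))‖ = ‖z‖ := by
    rw [norm_mul, ← neg_mul, ← Complex.ofReal_neg, Complex.norm_exp_ofReal_mul_I, mul_one]
  rw [hn] at h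
  rw [Complex.ofReal_add, add_mul, Complex.exp_add, mul_left_comm, h, mul_left_comm,
    ← Complex.exp_add, add_neg_cancel, Complex.exp_zero, mul_one]

theorem exists_eq_smul_circ {x : Fin 2 → ℝ} (hx : x ≠ 0) : ∃ r : ℝ, 0 < r ∧ ∃ θ : ℝ, x = r • circ θ :=
  ⟨_, norm_pos_iff.2 (toComplex_ne_zero hx), _, by simpa using eq_norm_smul_circ x 0⟩

section Plane

variable {ℓ : ℝ} {u v : (Fin 2 → ℝ) → ℂ}

theorem eq_of_eq_on_circ (hu : u ∈ V 2 ℓ) (hv : v ∈ V 2 ℓ) (h : ∀ θ, u (circ θ) = v (circ θ))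
    {x : Fin 2 → ℝ} (hx : x ≠ 0) : u x = v x := by
  obtain ⟨r, hr, θ, rfl⟩ := exists_eq_smul_circ hx
  rw [hu.2 r hr.ne' _ (circ_ne_zero θ), hv.2 r hr.ne' _ (circ_ne_zero θ), h]

theorem contDiff_comp_circ (hv : v ∈ V 2 ℓ) : ContDiff ℝ ∞ fun θ => v (circ θ) :=
  hv.1.comp_contDiff contDiff_circ circ_ne_zero

theorem periodic_comp_circ (hv : v ∈ V 2 ℓ) : Function.Periodic (fun θ => v (circ θ)) Real.pi :=
  fun θ => by
    simp only [circ_add_pi]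
    rw [hv.2 (-1) (by simp) _ (circ_ne_zero θ)]
    simp

theorem genK_circ (hv : v ∈ V 2 ℓ) (θ : ℝ) :
    genK 0 1 v (circ θ) = deriv (fun θ => v (circ θ)) θ := by
  have h := (differentiableAt_of_mem_V hv (circ_ne_zero θ)).hasFDerivAt.comp_hasDerivAt θ
    (hasDerivAt_circ θ)
  have h' : deriv (fun θ => v (circ θ)) θ = _ := h.deriv
  rw [h', fderiv_apply_fin_two, genK]
  simp
  ring

/-- Euler's identity gives the radial derivative and `genK` the angular one; rotating this frame
back gives the Cartesian partial derivatives. -/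
theorem pd_zero_circ (hv : v ∈ V 2 ℓ) (θ : ℝ) : pd 0 v (circ θ) =
    (Real.cos θ : ℂ) * (ℓ * v (circ θ)) - (Real.sin θ : ℂ) * deriv (fun θ => v (circ θ)) θ := by
  have h1 := fderiv_apply_self_of_mem_V hv (circ_ne_zero θ)
  have h2 := genK_circ hv θ
  have h3 : (Real.sin θ : ℂ) ^ 2 + (Real.cos θ : ℂ) ^ 2 = 1 := by
    exact_mod_cast Real.sin_sq_add_cos_sq θ
  rw [fderiv_apply_fin_two] at h1
  rw [← h1, ← h2, genK]
  simp only [circ_apply_zero, circ_apply_one]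
  linear_combination -(pd 0 v (circ θ)) * h3

theorem pd_one_circ (hv : v ∈ V 2 ℓ) (θ : ℝ) : pd 1 v (circ θ) =
    (Real.sin θ : ℂ) * (ℓ * v (circ θ)) + (Real.cos θ : ℂ) * deriv (fun θ => v (circ θ)) θ := by
  have h1 := fderiv_apply_self_of_mem_V hv (circ_ne_zero θ)
  have h2 := genK_circ hv θ
  have h3 : (Real.sin θ : ℂ) ^ 2 + (Real.cos θ : ℂ) ^ 2 = 1 := by
    exact_mod_cast Real.sin_sq_add_cos_sq θ
  rw [fderiv_apply_fin_two] at h1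
  rw [← h1, ← h2, genK]
  simp only [circ_apply_zero, circ_apply_one]
  linear_combination -(pd 1 v (circ θ)) * h3

theorem deriv_circ (hv : v ∈ V 2 ℓ) (θ : ℝ) :
    HasDerivAt (fun θ => v (circ θ)) (deriv (fun θ => v (circ θ)) θ) θ :=
  ((contDiff_comp_circ hv).differentiable (by simp) θ).hasDerivAt

theorem deriv_deriv_circ (hv : v ∈ V 2 ℓ) (θ : ℝ) :
    HasDerivAt (deriv fun θ => v (circ θ)) (deriv (deriv fun θ => v (circ θ)) θ) θ := by
  have h : deriv (fun θ => v (circ θ)) = fun θ => genK 0 1 v (circ θ) :=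
    funext fun t => (genK_circ hv t).symm
  rw [h]
  exact deriv_circ (genK_mem_V hv 0 1) θ

theorem hasDerivAt_ofReal_cos (θ : ℝ) :
    HasDerivAt (fun θ : ℝ => (Real.cos θ : ℂ)) (-(Real.sin θ : ℂ)) θ := by
  simpa using (Real.hasDerivAt_cos θ).ofReal_comp

theorem hasDerivAt_ofReal_sin (θ : ℝ) :
    HasDerivAt (fun θ : ℝ => (Real.sin θ : ℂ)) (Real.cos θ : ℂ) θ :=
  (Real.hasDerivAt_sin θ).ofReal_comp

theorem companion_eq (k : ℝ) (v : (Fin 2 → ℝ) → ℂ) : companion 2 k v =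
    fun x => genK 0 1 (genK 0 1 v) x - (k : ℂ) ^ 2 * genA 0 1 (genA 0 1 v) x := by
  have : ltPairs 2 = {(0, 1)} := by decide
  ext x
  simp [companion, casimirK, sumASq, this]

theorem transfer_eq (τ : ℝ) (v : (Fin 2 → ℝ) → ℂ) : transfer 2 τ v =
    fun x => v x + (τ : ℂ) ^ 2 * (genN 0 1 (genN 0 1 v) x + genN 1 0 (genN 1 0 v) x) := by
  have : nePairs 2 = {(0, 1), (1, 0)} := by decide
  ext x
  simp [transfer, sumNSq, this]

theorem genA_circ (hv : v ∈ V 2 ℓ) (θ : ℝ) : genA 0 1 v (circ θ) =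
    (Real.cos (2 * θ) : ℂ) * (ℓ * v (circ θ)) -
      (Real.sin (2 * θ) : ℂ) * deriv (fun θ => v (circ θ)) θ := by
  rw [genA, pd_zero_circ hv, pd_one_circ hv, Real.cos_two_mul', Real.sin_two_mul]
  simp only [circ_apply_zero, circ_apply_one]
  push_cast
  ring

theorem hasDerivAt_ofReal_cos_two_mul (θ : ℝ) :
    HasDerivAt (fun θ : ℝ => (Real.cos (2 * θ) : ℂ)) (-2 * (Real.sin (2 * θ) : ℂ)) θ := by
  have h := (((hasDerivAt_id θ).const_mul 2).cos).ofReal_comp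
  refine h.congr_deriv ?_
  simp
  ring

theorem hasDerivAt_ofReal_sin_two_mul (θ : ℝ) :
    HasDerivAt (fun θ : ℝ => (Real.sin (2 * θ) : ℂ)) (2 * (Real.cos (2 * θ) : ℂ)) θ := by
  have h := (((hasDerivAt_id θ).const_mul 2).sin).ofReal_comp
  refine h.congr_deriv ?_
  simp
  ring

/-- The companion operator in the angular variable. -/
theorem companion_circ (hv : v ∈ V 2 ℓ) (k θ : ℝ) : companion 2 k v (circ θ) =
    (1 - (k : ℂ) ^ 2 * (Real.sin (2 * θ) : ℂ) ^ 2) * deriv (deriv fun θ => v (circ θ)) θ +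
      2 * (k : ℂ) ^ 2 * (ℓ - 1) * (Real.sin (2 * θ) : ℂ) * (Real.cos (2 * θ) : ℂ) *
        deriv (fun θ => v (circ θ)) θ -
      (k : ℂ) ^ 2 * ((ℓ : ℂ) ^ 2 * (Real.cos (2 * θ) : ℂ) ^ 2 +
        2 * ℓ * (Real.sin (2 * θ) : ℂ) ^ 2) * v (circ θ) := by
  have hK : (fun θ => genK 0 1 v (circ θ)) = deriv fun θ => v (circ θ) :=
    funext fun t => genK_circ hv t
  have hA : HasDerivAt (fun θ => genA 0 1 v (circ θ)) _ θ :=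
    (((hasDerivAt_ofReal_cos_two_mul θ).mul ((deriv_circ hv θ).const_mul (ℓ : ℂ))).sub
      ((hasDerivAt_ofReal_sin_two_mul θ).mul (deriv_deriv_circ hv θ))).congr_of_eventuallyEq
      (Eventually.of_forall fun t => genA_circ hv t)
  rw [companion_eq]
  dsimp only
  rw [genK_circ (genK_mem_V hv 0 1), genA_circ (genA_mem_V hv 0 1), hA.deriv, hK, genA_circ hv]
  ring

theorem genN_zero_one_circ (hv : v ∈ V 2 ℓ) (θ : ℝ) : genN 0 1 v (circ θ) =
    (Real.cos θ : ℂ) * ((Real.sin θ : ℂ) * (ℓ * v (circ θ)) +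
      (Real.cos θ : ℂ) * deriv (fun θ => v (circ θ)) θ) := by
  rw [genN, pd_one_circ hv, circ_apply_zero]

theorem genN_one_zero_circ (hv : v ∈ V 2 ℓ) (θ : ℝ) : genN 1 0 v (circ θ) =
    (Real.sin θ : ℂ) * ((Real.cos θ : ℂ) * (ℓ * v (circ θ)) -
      (Real.sin θ : ℂ) * deriv (fun θ => v (circ θ)) θ) := by
  rw [genN, pd_zero_circ hv, circ_apply_one]

theorem companion_mem_V (hv : v ∈ V 2 ℓ) (k : ℝ) : companion 2 k v ∈ V 2 ℓ := by
  rw [companion_eq]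
  exact sub_mem_V (genK_mem_V (genK_mem_V hv 0 1) 0 1)
    (const_mul_mem_V (genA_mem_V (genA_mem_V hv 0 1) 0 1) _)

theorem transfer_mem_V (hv : v ∈ V 2 ℓ) (τ : ℝ) : transfer 2 τ v ∈ V 2 ℓ := by
  rw [transfer_eq]
  exact add_mem_V hv (const_mul_mem_V (add_mem_V (genN_mem_V (genN_mem_V hv 0 1) 0 1)
    (genN_mem_V (genN_mem_V hv 1 0) 1 0)) _)

/-- On homogeneous functions, the transfer operator is an affine function of the companion
operator with `k² = 1 / 2`. -/
theorem transfer_eq_companion (hv : v ∈ V 2 ℓ) {k : ℝ} (hk : k ^ 2 = 1 / 2) (τ : ℝ)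
    {x : Fin 2 → ℝ} (hx : x ≠ 0) : transfer 2 τ v x =
      (1 + (τ : ℂ) ^ 2 * (ℓ + (ℓ : ℂ) ^ 2 / 2)) * v x + (τ : ℂ) ^ 2 * companion 2 k v x := by
  refine eq_of_eq_on_circ (transfer_mem_V hv τ) (add_mem_V (const_mul_mem_V hv _)
    (const_mul_mem_V (companion_mem_V hv k) _)) (fun θ => ?_) hx
  have h1 : HasDerivAt (fun θ => genN 0 1 v (circ θ)) _ θ :=
    ((hasDerivAt_ofReal_cos θ).mul (((hasDerivAt_ofReal_sin θ).mul
      ((deriv_circ hv θ).const_mul (ℓ : ℂ))).add ((hasDerivAt_ofReal_cos θ).mul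
      (deriv_deriv_circ hv θ)))).congr_of_eventuallyEq
      (Eventually.of_forall fun t => genN_zero_one_circ hv t)
  have h2 : HasDerivAt (fun θ => genN 1 0 v (circ θ)) _ θ :=
    ((hasDerivAt_ofReal_sin θ).mul (((hasDerivAt_ofReal_cos θ).mul
      ((deriv_circ hv θ).const_mul (ℓ : ℂ))).sub ((hasDerivAt_ofReal_sin θ).mul
      (deriv_deriv_circ hv θ)))).congr_of_eventuallyEq
      (Eventually.of_forall fun t => genN_one_zero_circ hv t)
  have h3 : (Real.sin θ : ℂ) ^ 2 + (Real.cos θ : ℂ) ^ 2 = 1 := by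
    exact_mod_cast Real.sin_sq_add_cos_sq θ
  have hk' : (k : ℂ) ^ 2 = 1 / 2 := by rw [← Complex.ofReal_pow, hk]; simp
  rw [companion_circ hv, hk', transfer_eq]
  dsimp only
  rw [genN_zero_one_circ (genN_mem_V hv 0 1), genN_one_zero_circ (genN_mem_V hv 1 0), h1.deriv,
    h2.deriv, genN_zero_one_circ hv, genN_one_zero_circ hv, Real.cos_two_mul', Real.sin_two_mul]
  simp only [Pi.mul_apply, Pi.add_apply, Pi.sub_apply, Complex.ofReal_mul, Complex.ofReal_sub, Complex.ofReal_pow,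
    Complex.ofReal_ofNat]
  generalize deriv (deriv fun θ => v (circ θ)) θ = g2
  generalize deriv (fun θ => v (circ θ)) θ = g1
  -- This is the angular form of `N₁₂² + N₂₁² = K₁₂² - A₁₂²/2 + ℓ + ℓ²/2`. The factor `sin² + cos² +
  -- 1` serves to reduce `(sin² + cos²)²` to `1`.
  linear_combination (τ : ℂ) ^ 2 * (g2 + ((ℓ : ℂ) ^ 2 / 2 + ℓ) * v (circ θ)) *
    ((Real.sin θ : ℂ) ^ 2 + (Real.cos θ : ℂ) ^ 2 + 1) * h3

/-- The homogeneous function of degree `ℓ` with given values on the unit circle. -/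
def homogeneousExt (ℓ : ℝ) (g : ℝ → ℂ) (x : Fin 2 → ℝ) : ℂ :=
  ((‖toComplex x‖ ^ ℓ : ℝ) : ℂ) * g (toComplex x).arg

theorem homogeneousExt_smul_circ (ℓ : ℝ) {g : ℝ → ℂ} (hg : Function.Periodic g Real.pi) {r : ℝ}
    (hr : 0 < r) (θ : ℝ) : homogeneousExt ℓ g (r • circ θ) = ((r ^ ℓ : ℝ) : ℂ) * g θ := by
  have harg : g (toComplex (r • circ θ)).arg = g θ := by
    have h := Complex.arg_mul_cos_add_sin_mul_I_coe_angle hr (θ : Real.Angle)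
    rw [Real.Angle.cos_coe, Real.Angle.sin_coe, Complex.ofReal_cos, Complex.ofReal_sin,
      ← Complex.exp_mul_I, ← toComplex_smul_circ, Real.Angle.angle_eq_iff_two_pi_dvd_sub] at h
    obtain ⟨n, hn⟩ := h
    have h2 : (toComplex (r • circ θ)).arg = θ + ((2 * n : ℤ) : ℝ) * Real.pi := by
      push_cast
      linarith
    rw [h2, hg.int_mul]
  rw [homogeneousExt, harg, toComplex_smul_circ, norm_mul, Complex.norm_exp_ofReal_mul_I, mul_one,
    Complex.norm_real, Real.norm_eq_abs, abs_of_pos hr]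

/-- The argument function jumps across the negative axis. Near the direction `θ` it is replaced by
an angle measured from `θ`, which is smooth there, and periodicity of `g` makes the two expressions
agree. -/
theorem homogeneousExt_mem_V (ℓ : ℝ) {g : ℝ → ℂ} (hs : ContDiff ℝ ∞ g)
    (hg : Function.Periodic g Real.pi) : homogeneousExt ℓ g ∈ V 2 ℓ := by
  refine ⟨fun x hx => ContDiffAt.contDiffWithinAt ?_, fun r hr x hx => ?_⟩
  · obtain ⟨r, hr, θ, rfl⟩ := exists_eq_smul_circ hx
    have hnorm : ContDiffAt ℝ ∞ (fun y => ‖toComplex y‖) (r • circ θ) :=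
      (contDiffAt_norm ℝ (toComplex_ne_zero hx)).comp (r • circ θ) contDiff_toComplex.contDiffAt
    have hangle : ContDiffAt ℝ ∞
        (fun y => (toComplex y * Complex.exp (-(θ * Complex.I))).arg) (r • circ θ) := by
      have hmem : toComplex (r • circ θ) * Complex.exp (-(θ * Complex.I)) ∈ Complex.slitPlane := by
        rw [toComplex_smul_circ, mul_assoc, ← Complex.exp_add, add_neg_cancel, Complex.exp_zero,
          mul_one]
        exact Complex.ofReal_mem_slitPlane.2 hr
      have h1 : ContDiffAt ℝ ∞ Complex.log
          (toComplex (r • circ θ) * Complex.exp (-(θ * Complex.I))) :=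
        (Complex.contDiffAt_log hmem).restrict_scalars ℝ
      have h2 := Complex.imCLM.contDiff.contDiffAt.comp (r • circ θ)
        (h1.comp (r • circ θ) ((contDiff_toComplex.mul contDiff_const).contDiffAt))
      simpa [Function.comp_def, Complex.log_im] using h2
    have h : ContDiffAt ℝ ∞ (fun y => ((‖toComplex y‖ ^ ℓ : ℝ) : ℂ) *
        g (θ + (toComplex y * Complex.exp (-(θ * Complex.I))).arg)) (r • circ θ) :=
      (Complex.ofRealCLM.contDiff.contDiffAt.comp (r • circ θ)
        (hnorm.rpow_const_of_ne (norm_ne_zero_iff.2 (toComplex_ne_zero hx)))).mul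
        (hs.contDiffAt.comp (r • circ θ) (contDiffAt_const.add hangle))
    refine h.congr_of_eventuallyEq ?_
    filter_upwards [isOpen_compl_singleton.mem_nhds hx] with y hy
    conv_lhs => rw [eq_norm_smul_circ y θ]
    exact homogeneousExt_smul_circ ℓ hg (norm_pos_iff.2 (toComplex_ne_zero hy)) _
  · obtain ⟨ρ, hρ, θ, rfl⟩ := exists_eq_smul_circ hx
    rw [homogeneousExt_smul_circ ℓ hg hρ]
    rcases lt_or_gt_of_ne hr with h | h
    · have h2 : r • ρ • circ θ = (-r * ρ) • circ (θ + Real.pi) := by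
        rw [circ_add_pi, smul_smul, smul_smul]
        congr 1
        ring
      rw [h2, homogeneousExt_smul_circ ℓ hg (mul_pos (neg_pos.2 h) hρ), hg, abs_of_neg h,
        Real.mul_rpow (neg_pos.2 h).le hρ.le]
      push_cast
      ring
    · rw [smul_smul, homogeneousExt_smul_circ ℓ hg (mul_pos h hρ), abs_of_pos h,
        Real.mul_rpow h.le hρ.le]
      push_cast
      ring

/-- The eigenvalue equation of the companion problem in the angular variable. -/
def IsAngularEigenfunction (k ℓ : ℝ) (lam : ℂ) (g : ℝ → ℂ) : Prop :=
  ∀ θ : ℝ, (1 - (k : ℂ) ^ 2 * (Real.sin (2 * θ) : ℂ) ^ 2) * deriv (deriv g) θ +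
      2 * (k : ℂ) ^ 2 * (ℓ - 1) * (Real.sin (2 * θ) : ℂ) * (Real.cos (2 * θ) : ℂ) * deriv g θ -
      (k : ℂ) ^ 2 * ((ℓ : ℂ) ^ 2 * (Real.cos (2 * θ) : ℂ) ^ 2 +
        2 * ℓ * (Real.sin (2 * θ) : ℂ) ^ 2) * g θ = lam * g θ

/-- Restriction to the unit circle identifies `V_ℓ` with the smooth functions of period `π`:
evenness is what halves the period `2π`. -/
theorem mem_eigenvalues_companion_iff {k : ℝ} {lam : ℂ} :
    lam ∈ eigenvalues (companion 2 k) ℓ ↔ ∃ g : ℝ → ℂ, ContDiff ℝ ∞ g ∧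
      Function.Periodic g Real.pi ∧ (∃ θ, g θ ≠ 0) ∧ IsAngularEigenfunction k ℓ lam g := by
  constructor
  · rintro ⟨v, hv, ⟨x, hx, hvx⟩, h⟩
    refine ⟨fun θ => v (circ θ), contDiff_comp_circ hv, periodic_comp_circ hv, ?_, fun θ => ?_⟩
    · obtain ⟨r, hr, θ, rfl⟩ := exists_eq_smul_circ hx
      rw [hv.2 r hr.ne' _ (circ_ne_zero θ)] at hvx
      exact ⟨θ, right_ne_zero_of_mul hvx⟩
    · rw [← companion_circ hv, h _ (circ_ne_zero θ)]
  · rintro ⟨g, hs, hg, ⟨θ, hθ⟩, h⟩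
    have hv := homogeneousExt_mem_V ℓ hs hg
    have hvg : (fun θ => homogeneousExt ℓ g (circ θ)) = g := funext fun θ => by
      simpa using homogeneousExt_smul_circ ℓ hg one_pos θ
    refine ⟨_, hv, ⟨circ θ, circ_ne_zero θ, ?_⟩, fun x hx => ?_⟩
    · rwa [congrFun hvg θ]
    · refine eq_of_eq_on_circ (companion_mem_V hv k) (const_mul_mem_V hv lam) (fun t => ?_) hx
      rw [companion_circ hv, hvg, congrFun hvg t, h t]

theorem mem_eigenvalues_transfer_iff {k : ℝ} (hk : k ^ 2 = 1 / 2) {τ : ℝ} (hτ : τ ≠ 0) {lam : ℂ} :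
    1 + (τ : ℂ) ^ 2 * (ℓ + (ℓ : ℂ) ^ 2 / 2 + lam) ∈ eigenvalues (transfer 2 τ) ℓ ↔
      lam ∈ eigenvalues (companion 2 k) ℓ := by
  have hτ' : (τ : ℂ) ^ 2 ≠ 0 := pow_ne_zero 2 (Complex.ofReal_ne_zero.2 hτ)
  refine exists_congr fun v => and_congr_right fun hv => and_congr_right fun _ =>
    forall_congr' fun x => forall_congr' fun hx => ?_
  rw [transfer_eq_companion hv hk τ hx]
  constructor
  · intro h
    apply mul_left_cancel₀ hτ'
    linear_combination h
  · intro h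
    linear_combination (τ : ℂ) ^ 2 * h

end Plane

/-! ### Maximum principle for the leading eigenvalue -/

/-- The second derivative is nonnegative at a local minimum. -/
theorem second_deriv_nonneg_of_isLocalMin {F F' : ℝ → ℝ} {F'' x : ℝ}
    (hF : ∀ y, HasDerivAt F (F' y) y) (hF' : HasDerivAt F' F'' x) (hmin : IsLocalMin F x) :
    0 ≤ F'' := by
  by_contra! hneg
  have hd : deriv F = F' := funext fun y => (hF y).deriv
  -- A negative second derivative makes `x` a local maximum as well, so `F` is constant nearby,
  -- which contradicts the negativity.
  have hmax : IsLocalMax F x := isLocalMax_of_deriv_deriv_neg (by rwa [hd, hF'.deriv])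
    hmin.deriv_eq_zero (hF x).continuousAt
  have hconst : F =ᶠ[𝓝 x] fun _ => F x := by
    filter_upwards [hmin, hmax] with y h1 h2 using le_antisymm h2 h1
  have h0 : F' =ᶠ[𝓝 x] fun _ => 0 := by
    filter_upwards [hconst.eventuallyEq_nhds] with y hy
    exact (hF y).unique ((hasDerivAt_const y (F x)).congr_of_eventuallyEq hy)
  have := hF'.unique ((hasDerivAt_const x (0 : ℝ)).congr_of_eventuallyEq h0)
  exact hneg.ne this

/-- A maximum principle: if the periodic second order equation `p h'' + q h' + s h = m h` has a
positive solution, then no eigenvalue has real part larger than `m`. -/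
theorem re_le_of_pos_solution {P : ℝ} (hP : P ≠ 0) {p q s h h' h'' : ℝ → ℝ} {m : ℝ}
    (hp : ∀ x, 0 < p x) (hh : ∀ x, HasDerivAt h (h' x) x) (hh' : ∀ x, HasDerivAt h' (h'' x) x)
    (hpos : ∀ x, 0 < h x) (hper : Function.Periodic h P)
    (heq : ∀ x, p x * h'' x + q x * h' x + s x * h x = m * h x)
    {g g' g'' : ℝ → ℂ} {lam : ℂ} (hg : ∀ x, HasDerivAt g (g' x) x)
    (hg' : ∀ x, HasDerivAt g' (g'' x) x) (hgper : Function.Periodic g P) (hg0 : ∃ x, g x ≠ 0)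
    (hgeq : ∀ x, (p x : ℂ) * g'' x + (q x : ℂ) * g' x + (s x : ℂ) * g x = lam * g x) :
    lam.re ≤ m := by
  have hcont : Continuous fun x => Complex.normSq (g x) / h x ^ 2 :=
    (Complex.continuous_normSq.comp
      (continuous_iff_continuousAt.2 fun x => (hg x).continuousAt)).div₀
      ((continuous_iff_continuousAt.2 fun x => (hh x).continuousAt).pow 2)
      fun x => (pow_pos (hpos x) 2).ne'
  have hpu : Function.Periodic (fun x => Complex.normSq (g x) / h x ^ 2) P := fun x => by
    simp only [hper x, hgper x]
  -- With `c` the maximum of `|g|² / h²`, the function `c h² - |g|²` is nonnegative and vanishes at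
  -- `x`; its first two derivatives there are compared through the equations.
  obtain ⟨c, ⟨x, hx⟩, hc⟩ :=
    (hpu.compact_of_continuous hP hcont).exists_isGreatest (Set.range_nonempty _)
  dsimp only at hx
  have hle : ∀ y, Complex.normSq (g y) ≤ c * h y ^ 2 := fun y => by
    have : Complex.normSq (g y) / h y ^ 2 ≤ c := hc ⟨y, rfl⟩
    rwa [div_le_iff₀ (pow_pos (hpos y) 2)] at this
  have hxc : Complex.normSq (g x) = c * h x ^ 2 := by
    rw [← hx, div_mul_cancel₀ _ (pow_pos (hpos x) 2).ne']
  have hc0 : 0 < c := by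
    obtain ⟨y, hy⟩ := hg0
    have h1 := Complex.normSq_pos.2 hy
    have h2 := hle y
    have h3 := pow_pos (hpos y) 2
    by_contra! h4
    nlinarith
  have hre : ∀ {f f' : ℝ → ℂ}, (∀ y, HasDerivAt f (f' y) y) →
      ∀ y, HasDerivAt (fun t => (f t).re) (f' y).re y := fun hf y =>
    Complex.reCLM.hasFDerivAt.comp_hasDerivAt y (hf y)
  have him : ∀ {f f' : ℝ → ℂ}, (∀ y, HasDerivAt f (f' y) y) →
      ∀ y, HasDerivAt (fun t => (f t).im) (f' y).im y := fun hf y =>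
    Complex.imCLM.hasFDerivAt.comp_hasDerivAt y (hf y)
  have hF : ∀ y, HasDerivAt (fun t => c * h t ^ 2 - ((g t).re ^ 2 + (g t).im ^ 2))
      (2 * c * (h y * h' y) - 2 * ((g y).re * (g' y).re + (g y).im * (g' y).im)) y := fun y => by
    refine ((((hh y).pow 2).const_mul c).sub
      (((hre hg y).pow 2).add ((him hg y).pow 2))).congr_deriv ?_
    simp
    ring
  have hF' := (((hh x).mul (hh' x)).const_mul (2 * c)).sub
    ((((hre hg x).mul (hre hg' x)).add ((him hg x).mul (him hg' x))).const_mul 2)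
  have hmin : IsLocalMin (fun t => c * h t ^ 2 - ((g t).re ^ 2 + (g t).im ^ 2)) x := by
    refine Eventually.of_forall fun y => ?_
    have h1 := hle y
    rw [Complex.normSq_apply] at h1 hxc
    nlinarith
  have hsecond := second_deriv_nonneg_of_isLocalMin hF hF' hmin
  have hfirst := hmin.hasDerivAt_eq_zero (hF x)
  have e1 := congrArg Complex.re (hgeq x)
  have e2 := congrArg Complex.im (hgeq x)
  have e3 := heq x
  simp only [Complex.add_re, Complex.add_im, Complex.mul_re, Complex.mul_im, Complex.ofReal_re,
    Complex.ofReal_im, zero_mul, sub_zero, add_zero] at e1 e2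
  rw [Complex.normSq_apply] at hxc
  -- The first order condition is `c h h' = Re (conj g · g')`, and `|g|² = c h²` at `x`, so
  -- Cauchy–Schwarz bounds `c h'²` by `|g'|²`.
  have hcs : c * h' x ^ 2 ≤ (g' x).re ^ 2 + (g' x).im ^ 2 := by
    have h1 : c * (h x * h' x) = (g x).re * (g' x).re + (g x).im * (g' x).im := by linarith
    have h2 : 0 < c * h x ^ 2 := mul_pos hc0 (pow_pos (hpos x) 2)
    refine le_of_mul_le_mul_left ?_ h2
    have h3 : c * h x ^ 2 * (c * h' x ^ 2) = (c * (h x * h' x)) ^ 2 := by ring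
    rw [h3, h1, ← hxc]
    nlinarith [sq_nonneg ((g x).re * (g' x).im - (g x).im * (g' x).re)]
  have h4 : 0 < c * h x ^ 2 := mul_pos hc0 (pow_pos (hpos x) 2)
  have key := mul_nonneg (hp x).le hsecond
  have hfinal : 0 ≤ 2 * ((m - lam.re) * (c * h x ^ 2)) := by
    have h5 := mul_nonneg (hp x).le (sub_nonneg.2 hcs)
    -- The equations eliminate `h''` and `g''`; the `q` terms cancel by the first order condition
    -- and the `s` terms by `|g|² = c h²`.
    have h6 : 2 * ((m - lam.re) * (c * h x ^ 2)) = p x * (2 * c * (h' x * h' x + h x * h'' x) -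
        2 * ((g' x).re * (g' x).re + (g x).re * (g'' x).re +
          ((g' x).im * (g' x).im + (g x).im * (g'' x).im))) +
        2 * (p x * ((g' x).re ^ 2 + (g' x).im ^ 2 - c * h' x ^ 2)) := by
      linear_combination -2 * c * h x * e3 + 2 * (g x).re * e1 + 2 * (g x).im * e2 +
        (q x) * hfirst + 2 * (lam.re - s x) * hxc
    rw [h6]
    linarith
  have := (mul_nonneg_iff_of_pos_right h4).1 ((mul_nonneg_iff_of_pos_left two_pos).1 hfinal)
  linarith

/-! ### The Riccati branch of the companion problem -/

section ZetaPeriodic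

variable {k : ℝ}

theorem delta_add_pi (k x : ℝ) : delta k (x + Real.pi) = delta k x := by simp [delta]

theorem delta_neg (k x : ℝ) : delta k (-x) = delta k x := by simp [delta]

theorem zetaInc_add_pi (hk : k ∈ moduli) (x : ℝ) : zetaInc k (x + Real.pi) = zetaInc k x := by
  have hd : ∀ y, HasDerivAt (fun y => zetaInc k (y + Real.pi) - zetaInc k y) 0 y := fun y => by
    have h := ((hasDerivAt_zetaInc_snd hk (y + Real.pi)).comp_add_const y Real.pi).sub
      (hasDerivAt_zetaInc_snd hk y)
    refine h.congr_deriv ?_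
    rw [delta_add_pi, sub_self]
  have h := is_const_of_deriv_eq_zero (fun y => (hd y).differentiableAt) (fun y => (hd y).deriv) x 0
  have hpi : zetaInc k Real.pi = 0 := by
    have := zetaInc_pi_div_two hk
    rw [zetaInc] at this
    rw [zetaInc, ellInc_pi hk, ellInc_pi hk]
    linear_combination 2 * this
  rw [zero_add, hpi, zetaInc_zero] at h
  linarith

theorem zetaInc_neg (hk : k ∈ moduli) (x : ℝ) : zetaInc k (-x) = -zetaInc k x := by
  have hd : ∀ y, HasDerivAt (fun y => zetaInc k (-y) + zetaInc k y) 0 y := fun y => by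
    have h := ((hasDerivAt_zetaInc_snd hk (-y)).scomp y (hasDerivAt_neg y)).add
      (hasDerivAt_zetaInc_snd hk y)
    refine h.congr_deriv ?_
    rw [delta_neg]
    simp
  have h := is_const_of_deriv_eq_zero (fun y => (hd y).differentiableAt) (fun y => (hd y).deriv) x 0
  rw [neg_zero, zetaInc_zero] at h
  linarith

/-- Over `[0, π]` the doubled angle runs through two periods, and evenness folds each period onto
`[0, π/2]`. This brings the weighted means to complete elliptic integrals. -/
theorem integral_comp_two_mul_of_even {F : ℝ → ℝ} (hF : Continuous F)
    (hp : Function.Periodic F Real.pi) (he : ∀ x, F (-x) = F x) :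
    ∫ x in (0 : ℝ)..Real.pi, F (2 * x) = 2 * ∫ x in (0 : ℝ)..(Real.pi / 2), F x := by
  have hI : ∀ a b, IntervalIntegrable F MeasureTheory.volume a b :=
    fun a b => hF.intervalIntegrable a b
  have h1 := intervalIntegral.integral_comp_mul_left (a := 0) (b := Real.pi) F (two_ne_zero)
  have h2 := hp.intervalIntegral_add_eq Real.pi 0
  have h3 := intervalIntegral.integral_comp_sub_left (a := 0) (b := Real.pi / 2) F Real.pi
  have h4 : ∀ x, F (Real.pi - x) = F x := fun x => by
    rw [← he, neg_sub, hp.sub_eq]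
  simp only [h4] at h3
  rw [show Real.pi - Real.pi / 2 = Real.pi / 2 by ring, sub_zero] at h3
  rw [h1, mul_zero, smul_eq_mul,
    ← intervalIntegral.integral_add_adjacent_intervals (hI 0 Real.pi) (hI Real.pi (2 * Real.pi)),
    show 2 * Real.pi = Real.pi + Real.pi by ring, h2, zero_add,
    ← intervalIntegral.integral_add_adjacent_intervals (hI 0 (Real.pi / 2)) (hI (Real.pi / 2) Real.pi),
    ← h3]
  ring

theorem integral_eq_zero_of_odd {F : ℝ → ℝ} {P : ℝ} (hp : Function.Periodic F P)
    (ho : ∀ x, F (-x) = -F x) : ∫ x in (0 : ℝ)..P, F x = 0 := by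
  have h1 := hp.intervalIntegral_add_eq (-P) 0
  have h2 := intervalIntegral.integral_comp_neg (a := 0) (b := P) F
  simp only [ho, intervalIntegral.integral_neg] at h2
  rw [neg_add_cancel, zero_add] at h1
  rw [neg_zero] at h2
  linarith

/-- The integral of `w (V - v)` is the increment of `Z`, so a primitive with equal end values
identifies `v` as the weighted mean of `V`. -/
theorem integral_mul_eq_of_primitive {P v : ℝ} {w V Z : ℝ → ℝ} (hw : Continuous w)
    (hV : Continuous V) (hZ : ∀ x, HasDerivAt Z (w x * (V x - v)) x) (hZP : Z P = Z 0) :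
    ∫ x in (0 : ℝ)..P, w x * V x = v * ∫ x in (0 : ℝ)..P, w x := by
  have h := intervalIntegral.integral_eq_sub_of_hasDerivAt (fun x _ => hZ x)
    ((hw.mul (hV.sub continuous_const)).intervalIntegrable 0 P)
  simp only [mul_sub] at h
  rw [hZP, sub_self, intervalIntegral.integral_sub (f := fun x => w x * V x)
    ((hw.mul hV).intervalIntegrable _ _) ((hw.mul_const v).intervalIntegrable _ _),
    intervalIntegral.integral_mul_const] at h
  linarith

/-- The leading eigenvalue as an analytic function of `ε = 2ℓ + ℓ²`, with the corresponding
logarithmic derivatives of the eigenfunctions. -/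
theorem exists_angular_riccati_branch (hk : k ∈ moduli) :
    ∃ m : ℝ → ℝ, AnalyticAt ℝ m 0 ∧ m 0 = 0 ∧ deriv m 0 = ellE k / ellK k - 1 ∧
      2 * iteratedDeriv 2 m 0 = zetaSq k / ellK k ∧
      ∀ᶠ ε in 𝓝 (0 : ℝ), ∃ r : ℝ → ℝ, Function.Periodic r Real.pi ∧
        (∀ x, HasDerivAt r ((delta k (2 * x))⁻¹ *
          (m ε + ε * (k ^ 2 * Real.cos (2 * x) ^ 2 / delta k (2 * x) ^ 2) - r x ^ 2)) x) ∧
        ∫ x in (0 : ℝ)..Real.pi, (delta k (2 * x))⁻¹ * r x = 0 := by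
  have hD : Continuous fun x => delta k (2 * x) := by
    have := (continuous_delta_zpow hk 1).comp (continuous_const_mul (2 : ℝ))
    simpa [Function.comp_def] using this
  have hD0 : ∀ x, 0 < delta k x := delta_pos hk
  have hDp : ∀ x, delta k (2 * (x + Real.pi)) = delta k (2 * x) := fun x => by
    rw [mul_add, two_mul Real.pi, ← add_assoc, delta_add_pi, delta_add_pi]
  have hZp : ∀ x, zetaInc k (2 * (x + Real.pi)) = zetaInc k (2 * x) := fun x => by
    rw [mul_add, two_mul Real.pi, ← add_assoc, zetaInc_add_pi hk, zetaInc_add_pi hk]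
  -- In this form `Δ⁻¹ (V - (E/K - 1))` is `k'² Δ⁻³ - (E/K) Δ⁻¹`, the integrand of `zetaInc`; the
  -- factor `1/2` in `Z` compensates the doubled angle.
  have hVeq : ∀ x, -(k ^ 2 * Real.cos (2 * x) ^ 2 / delta k (2 * x) ^ 2) =
      (1 - k ^ 2) / delta k (2 * x) ^ 2 - 1 := fun x => by
    have h1 := delta_sq hk (2 * x)
    have h2 := Real.sin_sq_add_cos_sq (2 * x)
    have h3 := (hD0 (2 * x)).ne'
    field_simp
    rw [h1]
    linear_combination -k ^ 2 * h2
  have hZd : ∀ x, HasDerivAt (fun x => 1 / 2 * zetaInc k (2 * x)) ((delta k (2 * x))⁻¹ *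
      (-(k ^ 2 * Real.cos (2 * x) ^ 2 / delta k (2 * x) ^ 2) - (ellE k / ellK k - 1))) x := fun x => by
    have h := ((hasDerivAt_zetaInc_snd hk (2 * x)).comp x ((hasDerivAt_id x).const_mul 2)).const_mul
      (1 / 2 : ℝ)
    refine h.congr_deriv ?_
    have h3 := (hD0 (2 * x)).ne'
    have hz3 : delta k (2 * x) ^ (-3 : ℤ) = (delta k (2 * x) ^ 3)⁻¹ := by
      rw [zpow_neg]; norm_cast
    rw [hVeq, hz3, zpow_neg_one]
    field_simp
    ring
  have hwc : Continuous fun x => (delta k (2 * x))⁻¹ := hD.inv₀ fun x => (hD0 _).ne'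
  have hVc : Continuous fun x => -(k ^ 2 * Real.cos (2 * x) ^ 2 / delta k (2 * x) ^ 2) := by
    refine Continuous.neg (Continuous.div₀ (by fun_prop) (hD.pow 2) fun x => (pow_pos (hD0 _) 2).ne')
  have hwp : Function.Periodic (fun x => (delta k (2 * x))⁻¹) Real.pi := fun x => by
    simp only [hDp]
  have hVp : Function.Periodic (fun x => -(k ^ 2 * Real.cos (2 * x) ^ 2 / delta k (2 * x) ^ 2))
      Real.pi := fun x => by
    simp only [hDp]
    rw [mul_add, Real.cos_add_two_pi]
  have hv : ∫ x in (0 : ℝ)..Real.pi, (delta k (2 * x))⁻¹ *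
      (-(k ^ 2 * Real.cos (2 * x) ^ 2 / delta k (2 * x) ^ 2)) =
      (ellE k / ellK k - 1) * ∫ x in (0 : ℝ)..Real.pi, (delta k (2 * x))⁻¹ := by
    have h0 := hZp 0
    rw [zero_add] at h0
    exact integral_mul_eq_of_primitive hwc hVc hZd (by rw [h0])
  have hZ0 : ∫ x in (0 : ℝ)..Real.pi, (delta k (2 * x))⁻¹ * (1 / 2 * zetaInc k (2 * x)) = 0 := by
    refine integral_eq_zero_of_odd (fun x => ?_) fun x => ?_
    · simp only [hDp, hZp]
    · rw [mul_neg, delta_neg, zetaInc_neg hk]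
      ring
  have hzc : Continuous (zetaInc k) :=
    continuous_iff_continuousAt.2 fun x => (hasDerivAt_zetaInc_snd hk x).continuousAt
  have hwint : ∫ x in (0 : ℝ)..Real.pi, (delta k (2 * x))⁻¹ = 2 * ellK k := by
    rw [integral_comp_two_mul_of_even (F := fun x => (delta k x)⁻¹), ellK_eq, ellInc]
    · simp only [zpow_neg_one]
    · simpa only [zpow_neg_one] using continuous_delta_zpow hk (-1)
    · exact fun x => by simp only [delta_add_pi]
    · exact fun x => by simp only [delta_neg]
  have hzint : ∫ x in (0 : ℝ)..Real.pi, (delta k (2 * x))⁻¹ * (1 / 2 * zetaInc k (2 * x)) ^ 2 =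
      1 / 2 * zetaSq k := by
    rw [integral_comp_two_mul_of_even (F := fun x => (delta k x)⁻¹ * (1 / 2 * zetaInc k x) ^ 2),
      zetaSq, ← intervalIntegral.integral_const_mul, ← intervalIntegral.integral_const_mul]
    · refine intervalIntegral.integral_congr fun x _ => ?_
      simp only [zpow_neg_one]
      ring
    · have := continuous_delta_zpow hk (-1)
      simp only [zpow_neg_one] at this
      exact this.mul ((hzc.const_mul _).pow 2)
    · exact fun x => by simp only [delta_add_pi, zetaInc_add_pi hk]
    · exact fun x => by simp only [delta_neg, zetaInc_neg hk]; ring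
  obtain ⟨m, hm, hm0, hm1, hm2, hr⟩ := exists_riccati_branch Real.pi_pos hwc hVc hwp hVp
    (fun x => inv_pos.2 (hD0 _)) hv hZd hZ0
  refine ⟨m, hm, hm0, hm1, ?_, ?_⟩
  · rw [hwint, hzint] at hm2
    have := (ellK_pos hk).ne'
    field_simp
    linarith
  · filter_upwards [hr] with ε ⟨r, h1, h2, h3⟩
    refine ⟨r, h1, fun x => (h2 x).congr_deriv ?_, h3⟩
    ring

end ZetaPeriodic

/-! ### From Riccati solutions to positive eigenfunctions -/

theorem contDiff_delta {k : ℝ} (hk : k ∈ moduli) : ContDiff ℝ ∞ fun x => delta k (2 * x) := by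
  have h : ContDiff ℝ ∞ fun x : ℝ => 1 - k ^ 2 * Real.sin (2 * x) ^ 2 := by fun_prop
  exact h.sqrt fun x => (delta_arg_pos hk (2 * x)).ne'

theorem hasDerivAt_delta_two_mul {k : ℝ} (hk : k ∈ moduli) (x : ℝ) :
    HasDerivAt (fun x => delta k (2 * x))
      (-2 * k ^ 2 * (Real.sin (2 * x) * Real.cos (2 * x)) / delta k (2 * x)) x := by
  have h := (hasDerivAt_delta_snd hk (2 * x)).comp x ((hasDerivAt_id x).const_mul 2)
  refine h.congr_deriv ?_
  ring

/-- A solution of a Riccati equation with smooth coefficients is smooth. -/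
theorem contDiff_of_riccati {r a b : ℝ → ℝ} (ha : ContDiff ℝ ∞ a) (hb : ContDiff ℝ ∞ b)
    (hr : ∀ x, HasDerivAt r (a x * (b x - r x ^ 2)) x) : ContDiff ℝ ∞ r := by
  refine contDiff_infty.2 fun n => ?_
  -- Bootstrapping: the right side of the equation is as smooth as `r`, so each round gains one
  -- derivative.
  induction n with
  | zero => exact contDiff_zero.2 (continuous_iff_continuousAt.2 fun x => (hr x).continuousAt)
  | succ n ih =>
    push_cast
    refine contDiff_succ_iff_deriv.2 ⟨fun x => (hr x).differentiableAt, by simp, ?_⟩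
    rw [funext fun x => (hr x).deriv]
    exact (ha.of_le (by exact_mod_cast le_top)).mul
      ((hb.of_le (by exact_mod_cast le_top)).sub (ih.pow 2))

/-- The positive eigenfunction obtained from a periodic solution of the Riccati equation. -/
theorem exists_pos_eigenfunction {k : ℝ} (hk : k ∈ moduli) {ℓ m : ℝ} {r : ℝ → ℝ}
    (hrp : Function.Periodic r Real.pi)
    (hr : ∀ x, HasDerivAt r ((delta k (2 * x))⁻¹ * (m + (2 * ℓ + ℓ ^ 2) *
      (k ^ 2 * Real.cos (2 * x) ^ 2 / delta k (2 * x) ^ 2) - r x ^ 2)) x)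
    (hr0 : ∫ x in (0 : ℝ)..Real.pi, (delta k (2 * x))⁻¹ * r x = 0) :
    ∃ h h' h'' : ℝ → ℝ, ContDiff ℝ ∞ h ∧ Function.Periodic h Real.pi ∧ (∀ x, 0 < h x) ∧
      (∀ x, HasDerivAt h (h' x) x) ∧ (∀ x, HasDerivAt h' (h'' x) x) ∧
      ∀ x, (1 - k ^ 2 * Real.sin (2 * x) ^ 2) * h'' x +
        2 * k ^ 2 * (ℓ - 1) * Real.sin (2 * x) * Real.cos (2 * x) * h' x +
        -(k ^ 2 * (ℓ ^ 2 * Real.cos (2 * x) ^ 2 + 2 * ℓ * Real.sin (2 * x) ^ 2)) * h x =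
          m * h x := by
  have hD0 : ∀ x, 0 < delta k x := delta_pos hk
  have hDs := contDiff_delta hk
  have hDi : ContDiff ℝ ∞ fun x => (delta k (2 * x))⁻¹ := hDs.inv fun x => (hD0 _).ne'
  have hb : ContDiff ℝ ∞ fun x => m + (2 * ℓ + ℓ ^ 2) *
      (k ^ 2 * Real.cos (2 * x) ^ 2 / delta k (2 * x) ^ 2) :=
    contDiff_const.add (contDiff_const.mul (ContDiff.div (by fun_prop) (hDs.pow 2)
      fun x => (pow_pos (hD0 _) 2).ne'))
  have hrs : ContDiff ℝ ∞ r := contDiff_of_riccati hDi hb hr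
  have hcont : Continuous fun x => (delta k (2 * x))⁻¹ * r x := hDi.continuous.mul hrs.continuous
  set R : ℝ → ℝ := fun x => ∫ t in (0 : ℝ)..x, (delta k (2 * t))⁻¹ * r t with hR
  have hRd : ∀ x, HasDerivAt R ((delta k (2 * x))⁻¹ * r x) x := fun x =>
    intervalIntegral.integral_hasDerivAt_right (hcont.intervalIntegrable _ _)
      (hcont.stronglyMeasurableAtFilter _ _) hcont.continuousAt
  have hRs : ContDiff ℝ ∞ R := by
    refine contDiff_infty_iff_deriv.2 ⟨fun x => (hRd x).differentiableAt, ?_⟩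
    rw [funext fun x => (hRd x).deriv]
    exact hDi.mul hrs
  have hDp : ∀ x, delta k (2 * (x + Real.pi)) = delta k (2 * x) := fun x => by
    rw [mul_add, two_mul Real.pi, ← add_assoc, delta_add_pi, delta_add_pi]
  -- The condition of weighted mean zero on `r` enters here: it makes the primitive, and so the
  -- eigenfunction, periodic.
  have hRp : Function.Periodic R Real.pi := fun x => by
    have hp : Function.Periodic (fun x => (delta k (2 * x))⁻¹ * r x) Real.pi := fun x => by
      simp only [hDp, hrp x]
    have h1 := hp.intervalIntegral_add_eq x 0
    rw [zero_add, hr0] at h1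
    simp only [hR]
    rw [← intervalIntegral.integral_add_adjacent_intervals (hcont.intervalIntegrable 0 x)
      (hcont.intervalIntegrable x (x + Real.pi)), h1, add_zero]
  -- The exponent `ℓ / 2` removes the first order terms in `r` from the equation and leaves `ℓ` only
  -- in the combination `2ℓ + ℓ²`; `σ` is the logarithmic derivative of `h`.
  set h : ℝ → ℝ := fun x => delta k (2 * x) ^ (ℓ / 2) * Real.exp (R x) with hh
  set σ : ℝ → ℝ := fun x => -ℓ * k ^ 2 * (Real.sin (2 * x) * Real.cos (2 * x)) /
    delta k (2 * x) ^ 2 + (delta k (2 * x))⁻¹ * r x with hσ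
  have hhd : ∀ x, HasDerivAt h (h x * σ x) x := fun x => by
    have hne := (hD0 (2 * x)).ne'
    have h1 := ((hasDerivAt_delta_two_mul hk x).rpow_const (p := ℓ / 2) (Or.inl hne)).mul
      (hRd x).exp
    refine h1.congr_deriv ?_
    simp only [hh, hσ]
    rw [Real.rpow_sub_one hne]
    field_simp
  have hs2 : ∀ x, HasDerivAt (fun x : ℝ => Real.sin (2 * x)) (2 * Real.cos (2 * x)) x := fun x => by
    refine ((hasDerivAt_id x).const_mul 2).sin.congr_deriv ?_
    simp
    ring
  have hc2 : ∀ x, HasDerivAt (fun x : ℝ => Real.cos (2 * x)) (-2 * Real.sin (2 * x)) x := fun x => by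
    refine ((hasDerivAt_id x).const_mul 2).cos.congr_deriv ?_
    simp
    ring
  have hσd := fun x => ((((hs2 x).mul (hc2 x)).const_mul (-ℓ * k ^ 2)).div
    ((hasDerivAt_delta_two_mul hk x).pow 2) (pow_pos (hD0 (2 * x)) 2).ne').add
    (((hasDerivAt_delta_two_mul hk x).inv (hD0 (2 * x)).ne').mul (hr x))
  refine ⟨h, _, _, ?_, fun x => ?_, fun x => ?_, hhd, fun x => (hhd x).mul (hσd x), fun x => ?_⟩
  · exact (hDs.rpow_const_of_ne fun x => (hD0 _).ne').mul hRs.exp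
  · simp only [hh, hDp, hRp x]
  · exact mul_pos (Real.rpow_pos_of_pos (hD0 _) _) (Real.exp_pos _)
  · have hsq := delta_sq hk (2 * x)
    have hne := (hD0 (2 * x)).ne'
    have hk2 : k ^ 2 * Real.sin (2 * x) ^ 2 = 1 - delta k (2 * x) ^ 2 := by rw [hsq]; ring
    rw [← hsq]
    simp only [hσ, Pi.mul_apply, Pi.inv_apply, Pi.pow_apply]
    generalize delta k (2 * x) = D at *
    generalize Real.sin (2 * x) = S at *
    generalize Real.cos (2 * x) = C at *
    generalize h x = H
    generalize r x = ρ
    field_simp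
    linear_combination -(2 * ℓ + ℓ ^ 2) * k ^ 2 * C ^ 2 * H * D * hk2

theorem isLeadingEigenvalue_companion {k : ℝ} (hk : k ∈ moduli) {ℓ m : ℝ} {r : ℝ → ℝ}
    (hrp : Function.Periodic r Real.pi)
    (hr : ∀ x, HasDerivAt r ((delta k (2 * x))⁻¹ * (m + (2 * ℓ + ℓ ^ 2) *
      (k ^ 2 * Real.cos (2 * x) ^ 2 / delta k (2 * x) ^ 2) - r x ^ 2)) x)
    (hr0 : ∫ x in (0 : ℝ)..Real.pi, (delta k (2 * x))⁻¹ * r x = 0) :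
    IsLeadingEigenvalue (companion 2 k) ℓ m := by
  obtain ⟨h, h', h'', hs, hp, hpos, hd, hd', heq⟩ := exists_pos_eigenfunction hk hrp hr hr0
  refine ⟨mem_eigenvalues_companion_iff.2 ⟨fun x => (h x : ℂ), Complex.ofRealCLM.contDiff.comp hs,
    fun x => by simp only [hp x], ⟨0, Complex.ofReal_ne_zero.2 (hpos 0).ne'⟩, fun x => ?_⟩,
    fun lam hlam => ?_⟩
  · have e1 : deriv (fun x => (h x : ℂ)) = fun x => (h' x : ℂ) :=
      funext fun x => (hd x).ofReal_comp.deriv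
    rw [e1, (hd' x).ofReal_comp.deriv]
    have := congrArg (fun t : ℝ => (t : ℂ)) (heq x)
    push_cast at this ⊢
    linear_combination this
  · obtain ⟨g, hgs, hgp, hg0, hg⟩ := mem_eigenvalues_companion_iff.1 hlam
    obtain ⟨h1, h2⟩ := contDiff_infty_iff_deriv.1 hgs
    refine re_le_of_pos_solution Real.pi_pos.ne' (fun x => delta_arg_pos hk (2 * x)) hd hd' hpos hp
      heq (fun x => (h1 x).hasDerivAt)
      (fun x => ((contDiff_infty_iff_deriv.1 h2).1 x).hasDerivAt) hgp hg0 fun x => ?_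
    have := hg x
    push_cast at this ⊢
    linear_combination this

/-! ### Taylor coefficients of `μ` and of the Lyapunov exponent -/

theorem IsLeadingEigenvalue.mu_eq {k ℓ m : ℝ} (h : IsLeadingEigenvalue (companion 2 k) ℓ m) :
    mu 2 k ℓ = m :=
  IsGreatest.csSup_eq ⟨⟨m, h.1, Complex.ofReal_re m⟩, by rintro _ ⟨lam, hlam, rfl⟩; exact h.2 lam hlam⟩

/-- The leading eigenvalue of the companion problem near `ℓ = 0`. -/
theorem exists_mu_eq {k : ℝ} (hk : k ∈ moduli) :
    ∃ m : ℝ → ℝ, AnalyticAt ℝ m 0 ∧ m 0 = 0 ∧ deriv m 0 = ellE k / ellK k - 1 ∧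
      2 * iteratedDeriv 2 m 0 = zetaSq k / ellK k ∧
      ∀ᶠ ℓ in 𝓝 (0 : ℝ), mu 2 k ℓ = m (2 * ℓ + ℓ ^ 2) ∧
        IsLeadingEigenvalue (companion 2 k) ℓ (mu 2 k ℓ) := by
  obtain ⟨m, hm, hm0, hm1, hm2, hr⟩ := exists_angular_riccati_branch hk
  have ht : Tendsto (fun ℓ : ℝ => 2 * ℓ + ℓ ^ 2) (𝓝 0) (𝓝 0) := by
    have : Continuous fun ℓ : ℝ => 2 * ℓ + ℓ ^ 2 := by fun_prop
    simpa using this.tendsto 0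
  refine ⟨m, hm, hm0, hm1, hm2, ?_⟩
  filter_upwards [ht.eventually hr] with ℓ ⟨r, h1, h2, h3⟩
  have h := isLeadingEigenvalue_companion hk h1 h2 h3
  exact ⟨h.mu_eq, by rwa [h.mu_eq]⟩

/-- The extra `2 m'(0)` in the second derivative comes from the curvature of `ε = 2ℓ + ℓ²`. -/
theorem deriv_comp_two_mul_add_sq {m : ℝ → ℝ} (hm : AnalyticAt ℝ m 0) :
    AnalyticAt ℝ (fun ℓ : ℝ => m (2 * ℓ + ℓ ^ 2)) 0 ∧
    deriv (fun ℓ : ℝ => m (2 * ℓ + ℓ ^ 2)) 0 = 2 * deriv m 0 ∧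
    iteratedDeriv 2 (fun ℓ : ℝ => m (2 * ℓ + ℓ ^ 2)) 0 =
      4 * iteratedDeriv 2 m 0 + 2 * deriv m 0 := by
  have hpoly : ∀ ℓ : ℝ, HasDerivAt (fun ℓ : ℝ => 2 * ℓ + ℓ ^ 2) (2 + 2 * ℓ) ℓ := fun ℓ => by
    refine (((hasDerivAt_id ℓ).const_mul 2).add ((hasDerivAt_id ℓ).pow 2)).congr_deriv ?_
    simp
  have ht : Tendsto (fun ℓ : ℝ => 2 * ℓ + ℓ ^ 2) (𝓝 0) (𝓝 0) := by
    simpa using (hpoly 0).continuousAt.tendsto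
  have hd : ∀ᶠ ℓ in 𝓝 (0 : ℝ), HasDerivAt (fun ℓ : ℝ => m (2 * ℓ + ℓ ^ 2))
      (deriv m (2 * ℓ + ℓ ^ 2) * (2 + 2 * ℓ)) ℓ := by
    filter_upwards [ht.eventually hm.eventually_analyticAt] with ℓ hℓ
    exact hℓ.differentiableAt.hasDerivAt.comp ℓ (hpoly ℓ)
  refine ⟨?_, ?_, ?_⟩
  · refine AnalyticAt.fun_comp_of_eq hm (by fun_prop) (by simp)
  · rw [hd.self_of_nhds.deriv]
    simp [mul_comm]
  · have h1 : deriv (fun ℓ : ℝ => m (2 * ℓ + ℓ ^ 2)) =ᶠ[𝓝 0]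
        fun ℓ => deriv m (2 * ℓ + ℓ ^ 2) * (2 + 2 * ℓ) := by
      filter_upwards [hd] with ℓ hℓ using hℓ.deriv
    have h2 : HasDerivAt (deriv m) (deriv (deriv m) 0) (2 * 0 + 0 ^ 2) := by
      simpa using hm.deriv.differentiableAt.hasDerivAt
    have h3 := (h2.comp 0 (hpoly 0)).mul (((hasDerivAt_id (0 : ℝ)).const_mul 2).const_add 2)
    rw [iteratedDeriv_succ, iteratedDeriv_one, iteratedDeriv_succ, iteratedDeriv_one,
      (h3.congr_of_eventuallyEq h1).deriv]
    simp
    ring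

/-- The Taylor series of a function that is analytic and vanishes at `0`. -/
theorem hasSum_taylor_of_analyticAt {f : ℝ → ℝ} (hf : AnalyticAt ℝ f 0) (h0 : f 0 = 0) :
    ∀ᶠ x in 𝓝 (0 : ℝ),
      HasSum (fun i : ℕ => iteratedDeriv (i + 1) f 0 * (x ^ (i + 1) / ((i + 1)! : ℝ))) (f x) := by
  have h := hf.hasFPowerSeriesAt.eventually_hasSum
  filter_upwards [h] with x hx
  -- The term of index `0` is `f 0 = 0`, so the sum may start at index `1`.
  rw [zero_add, ← hasSum_nat_add_iff' 1] at hx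
  simp only [FormalMultilinearSeries.apply_eq_pow_smul_coeff, FormalMultilinearSeries.coeff_ofScalars,
    smul_eq_mul, Finset.range_one, Finset.sum_singleton, iteratedDeriv_zero, h0, zero_div,
    mul_zero, sub_zero] at hx
  refine hx.congr_fun fun i => ?_
  ring

/-- The leading part of the Lyapunov exponent in dimension two. -/
theorem lyap_two_eq (τ k : ℝ) :
    lyap 2 τ k = fun ℓ => τ ^ 2 * (ℓ + 1 / 2 * ℓ ^ 2 + mu 2 k ℓ) := by
  ext ℓ
  simp only [lyap]
  norm_num

theorem lyap_two_derivs {τ k : ℝ} (h : AnalyticAt ℝ (mu 2 k) 0) :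
    AnalyticAt ℝ (lyap 2 τ k) 0 ∧ deriv (lyap 2 τ k) 0 = τ ^ 2 * (1 + deriv (mu 2 k) 0) ∧
      iteratedDeriv 2 (lyap 2 τ k) 0 = τ ^ 2 * (1 + iteratedDeriv 2 (mu 2 k) 0) := by
  have hpoly : ∀ ℓ : ℝ, HasDerivAt (fun ℓ : ℝ => ℓ + 1 / 2 * ℓ ^ 2) (1 + ℓ) ℓ := fun ℓ => by
    refine ((hasDerivAt_id ℓ).add (((hasDerivAt_id ℓ).pow 2).const_mul (1 / 2))).congr_deriv ?_
    simp
  rw [lyap_two_eq]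
  have hd : ∀ᶠ ℓ in 𝓝 (0 : ℝ), HasDerivAt (fun ℓ => τ ^ 2 * (ℓ + 1 / 2 * ℓ ^ 2 + mu 2 k ℓ))
      (τ ^ 2 * (1 + ℓ + deriv (mu 2 k) ℓ)) ℓ := by
    filter_upwards [h.eventually_analyticAt] with ℓ hℓ
    exact ((hpoly ℓ).add hℓ.differentiableAt.hasDerivAt).const_mul _
  refine ⟨?_, ?_, ?_⟩
  · exact analyticAt_const.mul (AnalyticAt.add (by fun_prop) h)
  · rw [hd.self_of_nhds.deriv, add_zero]
  · have h1 : deriv (fun ℓ => τ ^ 2 * (ℓ + 1 / 2 * ℓ ^ 2 + mu 2 k ℓ)) =ᶠ[𝓝 0]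
        fun ℓ => τ ^ 2 * (1 + ℓ + deriv (mu 2 k) ℓ) := by
      filter_upwards [hd] with ℓ hℓ using hℓ.deriv
    have h2 := (((hasDerivAt_id (0 : ℝ)).const_add 1).add
      h.deriv.differentiableAt.hasDerivAt).const_mul (τ ^ 2)
    rw [iteratedDeriv_succ, iteratedDeriv_one, iteratedDeriv_succ, iteratedDeriv_one,
      (h2.congr_of_eventuallyEq h1).deriv]

/-- In the physical case the leading eigenvalue of the transfer operator is `1 + L`. -/
theorem IsLeadingEigenvalue.transfer {k ℓ τ : ℝ} (hk : k ^ 2 = 1 / 2) (hτ : τ ≠ 0)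
    (h : IsLeadingEigenvalue (companion 2 k) ℓ (mu 2 k ℓ)) :
    IsLeadingEigenvalue (RenewingFlow.transfer 2 τ) ℓ (1 + lyap 2 τ k ℓ) := by
  refine ⟨?_, fun lam hlam => ?_⟩
  · have := (mem_eigenvalues_transfer_iff hk hτ).2 h.1
    rw [lyap_two_eq]
    push_cast
    convert this using 1
    ring
  · have hτ' : (τ : ℂ) ≠ 0 := Complex.ofReal_ne_zero.2 hτ
    -- As `τ ≠ 0`, the affine map relating the two spectra is onto: each `lam` comes from some `nu`.
    -- Its slope `τ²` is positive, so the order of real parts is preserved.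
    obtain ⟨nu, rfl⟩ : ∃ nu : ℂ, lam = 1 + (τ : ℂ) ^ 2 * (ℓ + (ℓ : ℂ) ^ 2 / 2 + nu) :=
      ⟨(lam - 1) / (τ : ℂ) ^ 2 - (ℓ + (ℓ : ℂ) ^ 2 / 2), by field_simp; ring⟩
    have h1 := h.2 nu ((mem_eigenvalues_transfer_iff hk hτ).1 hlam)
    have h2 : (1 + (τ : ℂ) ^ 2 * (ℓ + (ℓ : ℂ) ^ 2 / 2 + nu)).re =
        1 + τ ^ 2 * (ℓ + ℓ ^ 2 / 2 + nu.re) := by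
      have h3 : ((ℓ : ℂ) + (ℓ : ℂ) ^ 2 / 2 + nu) = ((ℓ + ℓ ^ 2 / 2 : ℝ) : ℂ) + nu := by push_cast; ring
      rw [h3, ← Complex.ofReal_pow, Complex.add_re, Complex.re_ofReal_mul, Complex.add_re,
        Complex.ofReal_re, Complex.one_re]
    rw [h2, lyap_two_eq]
    dsimp only
    nlinarith [mul_le_mul_of_nonneg_left h1 (sq_nonneg τ)]

end RenewingFlow

end

theorem mainTheorem2 (k : ℝ) (hk0 : 0 ≤ k) (hk1 : k < 1) (τ : ℝ) (hτ : 0 < τ) :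
    -- the leading eigenvalue of the companion problem exists for small `ℓ`
    (∀ᶠ ℓ in 𝓝 (0 : ℝ),
      RenewingFlow.IsLeadingEigenvalue (RenewingFlow.companion 2 k) ℓ (RenewingFlow.mu 2 k ℓ)) ∧
    -- `L(k, ℓ) = ∑_{j ≥ 1} γ_j(k) ℓ^j / j!` for small `ℓ`
    (∀ᶠ ℓ in 𝓝 (0 : ℝ),
      HasSum (fun i : ℕ => RenewingFlow.cumulant 2 τ k (i + 1) * (ℓ ^ (i + 1) / ((i + 1)! : ℝ)))
        (RenewingFlow.lyap 2 τ k ℓ)) ∧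
    -- the coefficients `μ_0`, `μ_1`, `μ_2` of `ℓ^0`, `ℓ^1`, `ℓ^2` in the leading eigenvalue
    AnalyticAt ℝ (RenewingFlow.mu 2 k) 0 ∧
    RenewingFlow.mu 2 k 0 = 0 ∧
    deriv (RenewingFlow.mu 2 k) 0 = 2 * (RenewingFlow.ellE k / RenewingFlow.ellK k - 1) ∧
    Summable (RenewingFlow.evenTerm (RenewingFlow.nome k)) ∧
    Summable (RenewingFlow.oddTerm (RenewingFlow.nome k)) ∧
    iteratedDeriv 2 (RenewingFlow.mu 2 k) 0 / 2 =
      1 - k ^ 2 - RenewingFlow.ellE k / RenewingFlow.ellK k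
        + 2 * Real.pi ^ 2 / RenewingFlow.ellK k ^ 2 *
            ∑' i : ℕ, RenewingFlow.evenTerm (RenewingFlow.nome k) i
        - 6 * Real.pi ^ 2 / RenewingFlow.ellK k ^ 2 *
            ∑' i : ℕ, RenewingFlow.oddTerm (RenewingFlow.nome k) i ∧
    -- the first two cumulants
    RenewingFlow.cumulant 2 τ k 1 / τ ^ 2 = 2 * (RenewingFlow.ellE k / RenewingFlow.ellK k) - 1 ∧
    1 / τ ^ 2 * (RenewingFlow.cumulant 2 τ k 2 / 2) =
      3 / 2 - k ^ 2 - RenewingFlow.ellE k / RenewingFlow.ellK k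
        + 2 * Real.pi ^ 2 / RenewingFlow.ellK k ^ 2 *
            ∑' i : ℕ, RenewingFlow.evenTerm (RenewingFlow.nome k) i
        - 6 * Real.pi ^ 2 / RenewingFlow.ellK k ^ 2 *
            ∑' i : ℕ, RenewingFlow.oddTerm (RenewingFlow.nome k) i ∧
    -- the physical case
    (k = 1 / √2 → ∀ᶠ ℓ in 𝓝 (0 : ℝ),
      RenewingFlow.IsLeadingEigenvalue (RenewingFlow.transfer 2 τ) ℓ
        (1 + RenewingFlow.lyap 2 τ k ℓ)) := by
  have hk := RenewingFlow.mem_moduli hk0 hk1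
  obtain ⟨m, hm, hm0, hm1, hm2, hev⟩ := RenewingFlow.exists_mu_eq hk
  obtain ⟨ha, hd1, hd2⟩ := RenewingFlow.deriv_comp_two_mul_add_sq hm
  have heq : RenewingFlow.mu 2 k =ᶠ[𝓝 0] fun ℓ => m (2 * ℓ + ℓ ^ 2) := hev.mono fun ℓ h => h.1
  have hmu : AnalyticAt ℝ (RenewingFlow.mu 2 k) 0 := ha.congr heq.symm
  have hmu0 : RenewingFlow.mu 2 k 0 = 0 := by
    rw [heq.self_of_nhds]
    simp [hm0]
  have hmu1 : deriv (RenewingFlow.mu 2 k) 0 = 2 * (RenewingFlow.ellE k / RenewingFlow.ellK k - 1) := by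
    rw [heq.deriv_eq, hd1, hm1]
  have hmu2 := RenewingFlow.zetaSq_eq_lambert hk0 hk1
  -- `μ₂ = (4 m''(0) + 2 m'(0)) / 2 = m'(0) + 2 m''(0)`.
  have hmu2' : iteratedDeriv 2 (RenewingFlow.mu 2 k) 0 / 2 =
      RenewingFlow.ellE k / RenewingFlow.ellK k - 1 +
        RenewingFlow.zetaSq k / RenewingFlow.ellK k := by
    rw [heq.iteratedDeriv_eq, hd2, hm1, ← hm2]
    ring
  rw [← hmu2'] at hmu2
  obtain ⟨hL, hL1, hL2⟩ := RenewingFlow.lyap_two_derivs (τ := τ) hmu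
  have hL0 : RenewingFlow.lyap 2 τ k 0 = 0 := by simp [RenewingFlow.lyap_two_eq, hmu0]
  have hτ2 : τ ^ 2 ≠ 0 := (pow_pos hτ 2).ne'
  refine ⟨hev.mono fun ℓ h => h.2, RenewingFlow.hasSum_taylor_of_analyticAt hL hL0, hmu, hmu0, hmu1,
    RenewingFlow.summable_evenTerm hk0 hk1, RenewingFlow.summable_oddTerm hk0 hk1, hmu2, ?_, ?_,
    fun hphys => hev.mono fun ℓ h => h.2.transfer ?_ hτ.ne'⟩
  · rw [RenewingFlow.cumulant, iteratedDeriv_one, hL1, mul_div_cancel_left₀ _ hτ2, hmu1]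
    ring
  · rw [RenewingFlow.cumulant, hL2]
    have : 1 / τ ^ 2 * (τ ^ 2 * (1 + iteratedDeriv 2 (RenewingFlow.mu 2 k) 0) / 2) =
        1 / 2 + iteratedDeriv 2 (RenewingFlow.mu 2 k) 0 / 2 := by
      field_simp
    rw [this, hmu2]
    ring
  · rw [hphys, div_pow, one_pow, Real.sq_sqrt (by norm_num)]
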